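/- Let $\mathbb S=\mathbb R/\mathbb Z$ with Lebesgue measure $\mathfrak m$, let $(\Omega,\mathcal F,\eta)$ be a probability space, and for each $\omega_1\in\Omega$ let $T_{\omega_1}:\mathbb S\to\mathbb S$ be a $C^2$ map without critical points, such that $(\omega_1,x)\mapsto T_{\omega_1}x$ is measurable. Put $\lambda_{\omega_1}=\inf|T_{\omega_1}'|$ and $\Delta_{\omega_1}=\|T_{\omega_1}''/(T_{\omega_1}')^2\|_\infty$, and assume $$\int\lambda_{\omega_1}^{-2}\,d\eta(\omega_1)<1\quad\text{and}\quad\int\Delta_{\omega_1}^{2}\,d\eta(\omega_1)<\infty .$$ Let $X_n(\omega,x)=T_{\omega_n}\circ\cdots\circ T_{\omega_1}(x)$ for $\omega=(\omega_i)_{i\ge1}\in\Omega^{\mathbb N}$ and $x\in\mathbb S$ (with $X_0(\omega,x)=x$). A probability measure $\mu$ on $\mathbb S$ is called stationary if $\int\!\int h(T_{\omega_1}x)\,d\eta(\omega_1)\,d\mu(x)=\int h\,d\mu$ for all bounded measurable $h:\mathbb S\to\mathbb R$. Then there exists a stationary probability measure that is absolutely continuous with respect to $\mathfrak m$. Let $\mu$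 be any such measure, let $E^\mu$ denote expectation with respect to $\eta^{\mathbb N}\times\mu$, and let $\mathbf f:\mathbb S\to\mathbb R^d$ be Hölder continuous (with some exponent in $(0,1)$) with $\int\mathbf f\,d\mu=0$. Then the limit $$\mathbf\Sigma^2=\lim_{n\to\infty}\frac1n\,E^\mu\Bigl(\sum_{k=0}^{n-1}\mathbf f(X_k)\otimes\sum_{k=0}^{n-1}\mathbf f(X_k)\Bigr)$$ exists, and for every nonzero vector $\mathbf v\in\mathbb R^d$ the following are equivalent: (i) $\mathbf v^{\mathsf T}\mathbf\Sigma^2\mathbf v=0$; (ii) there exists a Hölder continuous function $g:\mathbb S\to\mathbb R$ (with some exponent in $(0,1)$) such that, for $\eta$-almost every $\omega_1$, $\mathbf v^{\mathsf T}\mathbf f(x)=g(x)-g(T_{\omega_1}x)$ for all $x\in\mathbb S$. -/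

import Mathlib

open MeasureTheory Filter Topology
open scoped NNReal ENNReal

namespace RandomCircle

/-- The circle `ℝ / ℤ`, with its quotient metric; `volume` is Lebesgue measure of total mass one. -/
abbrev S : Type := UnitAddCircle

/-- `F : ℝ → ℝ` is a lift of `T : S → S` to the universal cover. -/
def IsLift (F : ℝ → ℝ) (T : S → S) : Prop :=
  ∀ t : ℝ, T (t : S) = (F t : S)

/-- `T` is a `C²` circle map without critical points. -/
def IsC2NoCritical (T : S → S) : Prop :=
  ∃ F : ℝ → ℝ, IsLift F T ∧ ContDiff ℝ 2 F ∧ ∀ t, deriv F t ≠ 0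

open Classical in
/-- A `C²` lift of `T` without critical points (the junk value `id` if there is none). Two such
lifts differ by an additive constant, so that the derivatives below do not depend on the choice:
see `deriv_eq_deriv_lift`. -/
noncomputable def lift (T : S → S) : ℝ → ℝ :=
  if h : IsC2NoCritical T then h.choose else id

theorem lift_spec {T : S → S} (h : IsC2NoCritical T) :
    IsLift (lift T) T ∧ ContDiff ℝ 2 (lift T) ∧ ∀ t, deriv (lift T) t ≠ 0 := by
  unfold lift
  rw [dif_pos h]
  exact h.choose_spec

/-- The derivatives of a circle map, read in a lift, do not depend on the lift. -/
theorem deriv_eq_deriv_lift {T : S → S} (h : IsC2NoCritical T) {F : ℝ → ℝ} (hF : IsLift F T)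
    (hFc : Continuous F) : deriv F = deriv (lift T) := by
  obtain ⟨hL, hLc, -⟩ := lift_spec h
  have hc : Continuous fun t => F t - lift T t := hFc.sub hLc.continuous
  have hint : ∀ t, ∃ n : ℤ, (n : ℝ) = F t - lift T t := by
    intro t
    have h0 : ((F t - lift T t : ℝ) : S) = 0 := by
      rw [AddCircle.coe_sub, ← hF t, ← hL t, sub_self]
    obtain ⟨n, hn⟩ := (AddCircle.coe_eq_zero_iff (1 : ℝ)).1 h0
    exact ⟨n, by simpa using hn⟩
  choose n hn using hint
  have hnc : Continuous n := by
    have h1 : Continuous fun t => ((n t : ℤ) : ℝ) := by simpa only [hn] using hc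
    exact Int.isClosedEmbedding_coe_real.isInducing.continuous_iff.2 h1
  have hconst : ∀ t, n t = n 0 := fun t =>
    PreconnectedSpace.constant inferInstance hnc
  have hFl : F = fun t => lift T t + (n 0 : ℝ) := by
    funext t
    have := hn t
    rw [hconst t] at this
    linarith
  rw [hFl]
  funext t
  exact deriv_add_const _

/-- The dilation `inf |T'|`. -/
noncomputable def dilation (T : S → S) : ℝ :=
  ⨅ t : ℝ, |deriv (lift T) t|

/-- The distortion `‖T'' / (T')²‖_∞`. -/
noncomputable def distortion (T : S → S) : ℝ :=
  ⨆ t : ℝ, |deriv (deriv (lift T)) t / (deriv (lift T) t) ^ 2|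

/-- Hölder continuity on the circle, with some exponent in `(0, 1)`. -/
def IsHolder {E : Type*} [PseudoEMetricSpace E] (f : S → E) : Prop :=
  ∃ C α : ℝ≥0, 0 < α ∧ α < 1 ∧ HolderWith C α f

section Model

variable {Ω : Type*} [MeasurableSpace Ω]

/-- A measurable family of `C²` circle maps without critical points, selected according to `η`,
with `⟨λ⁻²⟩ < 1` and `⟨Δ²⟩ < ∞`. -/
structure IsExpandingOnAverage (η : Measure Ω) (T : Ω → S → S) : Prop where
  measurable : Measurable fun p : Ω × S => T p.1 p.2
  smooth : ∀ ω, IsC2NoCritical (T ω)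
  dilation_moment : ∫⁻ ω, ENNReal.ofReal ((dilation (T ω) ^ 2)⁻¹) ∂η < 1
  distortion_moment : ∫⁻ ω, ENNReal.ofReal (distortion (T ω) ^ 2) ∂η < ∞

/-- The Markov operator `Q f(x) = ∫ f(T_ω x) dη(ω)`. -/
noncomputable def markovOp (η : Measure Ω) (T : Ω → S → S) (f : S → ℝ) (x : S) : ℝ :=
  ∫ ω, f (T ω x) ∂η

/-- `μ` is an absolutely continuous stationary probability distribution of the Markov chain. -/
structure IsACStationary (η : Measure Ω) (T : Ω → S → S) (μ : Measure S) : Prop where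
  isProbabilityMeasure : IsProbabilityMeasure μ
  absolutelyContinuous : μ ≪ volume
  stationary : ∀ f : S → ℝ, Measurable f → (∃ C, ∀ x, |f x| ≤ C) →
    ∫ x, markovOp η T f x ∂μ = ∫ x, f x ∂μ

/-- The chain `X_n(ω, x) = T_{ω_n} ∘ ⋯ ∘ T_{ω_1} (x)`, the sequence `ω` being indexed from `0`. -/
def chain (T : Ω → S → S) : ℕ → (ℕ → Ω) → S → S
  | 0, _, x => x
  | n + 1, ω, x => T (ω n) (chain T n ω x)

/-- The law `P^μ`: the `ω_i` are independent with law `η`, independent of `x`, which has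
law `μ`. -/
noncomputable def pathMeasure (η : Measure Ω) [IsProbabilityMeasure η] (μ : Measure S) :
    Measure ((ℕ → Ω) × S) :=
  (Measure.infinitePi fun _ : ℕ => η).prod μ

/-- The partial sums `∑_{k < n} f(X_k)`. -/
def birkhoff (T : Ω → S → S) {d : ℕ} (f : S → Fin d → ℝ) (n : ℕ) (p : (ℕ → Ω) × S) :
    Fin d → ℝ :=
  ∑ k ∈ Finset.range n, f (chain T k p.1 p.2)

/-- `Sig` is the limit covariance of `n^{-1/2} ∑_{k < n} f(X_k)`, that is, the limit of
`n⁻¹ E^μ (∑_{k < n} f(X_k) ⊗ ∑_{k < n} f(X_k))`. -/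
def IsLimitCovariance (η : Measure Ω) [IsProbabilityMeasure η] (T : Ω → S → S) (μ : Measure S)
    {d : ℕ} (f : S → Fin d → ℝ) (Sig : Matrix (Fin d) (Fin d) ℝ) : Prop :=
  ∀ i j, Tendsto
    (fun n : ℕ => (1 / (n : ℝ)) *
      ∫ p, birkhoff T f n p i * birkhoff T f n p j ∂(pathMeasure η μ))
    atTop (𝓝 (Sig i j))

end Model

end RandomCircle

/-! The Markov operator `Q` acts on continuous functions, and its dual acts on densities through `∫
h' φ = ∫ h (Q φ)` (`IsTransfer`). All regularity is gained on the dual side: composition with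
expanding maps roughens functions, while transfer smooths densities.

Lasota–Yorke. With `w = 1 / T'` and `κ = T'' / (T')²` one has `(φ∘T · w)' = φ'∘T - φ∘T · κ`.
Integrating by parts against an `L`-Lipschitz density `h` bounds `∫ h φ'∘T` by a constant affine in
`L` times `∫ |φ|`. Averaging over the maps keeps this form, and a functional satisfying such a bound
has a Lipschitz density (`exists_lipschitz_density`, `exists_transfer_density`). Along compositions
the second moment of the inverse dilation decays geometrically and that of the distortion stays
bounded, so a high iterate contracts large Lipschitz constants.

Doeblin. A density with Lipschitz constant `K` is at least `1/2` on an interval of length `1 /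
(2K)`. After enough steps that interval is stretched over the whole circle with positive
probability, so the image density is bounded below (`exists_lower_bound_transfer`). Removing the
common part `c` and iterating gives exponential loss of memory for Lipschitz functions of mean zero
(`HasDoeblin.exists_decay`), hence an invariant Lipschitz density `ρ ≥ c`. It is the density of
every absolutely continuous stationary measure (`IsACStationary.integral_eq_pairing`). Approximation
by Lipschitz functions at a suitable scale extends the decay to Hölder functions.

Variance. For mean zero `f`, let `ρ g₀` be the sum over `k ≥ 1` of the `k`-th transfers of `ρ f`.
This series converges to a Hölder function (`HasDoeblin.exists_corrector`), and correlations sum to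
the limit covariance (`tendsto_covariance`). Put `u = f + g₀`. Since `ρ u` transfers to `ρ g₀`,
expanding the square gives `E^μ (u(X₀) - g₀(X₁))² = σ²`: a martingale approximation in reversed
time. If `σ² = 0`, then `f = g₀∘T - g₀` almost surely, first at each point and then everywhere by
continuity (`coboundary_of_variance_eq_zero`). Conversely the partial sums of a coboundary telescope
and stay bounded. -/

namespace RandomCircle

/-! ### Calculus on the circle -/

/-- `φ'` is the derivative of `φ : S → ℝ`, read in the universal cover. -/
def CircDeriv (φ φ' : S → ℝ) : Prop :=
  ∀ t : ℝ, HasDerivAt (fun s : ℝ => φ (s : S)) (φ' (t : S)) t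

theorem continuous_coe : Continuous ((↑) : ℝ → S) := AddCircle.continuous_mk' 1

theorem coe_surj (x : S) : ∃ t : ℝ, (t : S) = x := QuotientAddGroup.mk_surjective x

theorem continuous_of_comp_coe {E : Type*} [TopologicalSpace E] {f : S → E}
    (h : Continuous fun t : ℝ => f (t : S)) : Continuous f :=
  (QuotientAddGroup.isQuotientMap_mk _).continuous_iff.2 h

theorem CircDeriv.continuous {φ φ' : S → ℝ} (h : CircDeriv φ φ') : Continuous φ :=
  continuous_of_comp_coe (continuous_iff_continuousAt.2 fun t => (h t).continuousAt)

theorem exists_rep_norm (x : S) : ∃ r : ℝ, (r : S) = x ∧ |r| = ‖x‖ := by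
  obtain ⟨t, rfl⟩ := coe_surj x
  refine ⟨t - round t, ?_, ?_⟩
  · rw [AddCircle.coe_sub]
    have : ((round t : ℝ) : S) = 0 := by
      rw [AddCircle.coe_eq_zero_iff]
      exact ⟨round t, by simp⟩
    rw [this, sub_zero]
  · exact (UnitAddCircle.norm_eq).symm

theorem dist_le_half (x y : S) : dist x y ≤ 1 / 2 := by
  rw [dist_eq_norm]
  simpa using AddCircle.norm_le_half_period (1 : ℝ) (x := x - y) one_ne_zero

theorem dist_coe_le (s t : ℝ) : dist (s : S) (t : S) ≤ |s - t| := by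
  rw [dist_eq_norm, ← AddCircle.coe_sub, UnitAddCircle.norm_eq]
  simpa using round_le (s - t) 0

theorem integrable_of_continuous {f : S → ℝ} (hf : Continuous f) : Integrable f volume :=
  hf.integrable_of_hasCompactSupport (HasCompactSupport.of_compactSpace f)

theorem integral_eq_interval (f : S → ℝ) (a : ℝ) : ∫ x, f x = ∫ t in a..(a + 1), f (t : S) :=
  (UnitAddCircle.intervalIntegral_preimage a f).symm

theorem abs_integral_le_integral {f g : S → ℝ} (hg : Continuous g) (h : ∀ x, |f x| ≤ g x) :
    |∫ x, f x| ≤ ∫ x, g x := by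
  rw [← Real.norm_eq_abs]
  exact norm_integral_le_of_norm_le (integrable_of_continuous hg) (Eventually.of_forall h)

theorem integral_const_volume (c : ℝ) : ∫ _ : S, c = c := by
  rw [integral_eq_interval _ 0]; simp

/-- Antiderivative of a nonnegative continuous function, corrected by its mean. -/
theorem exists_primitive {ψ : S → ℝ} (hψ : Continuous ψ) (h0 : ∀ x, 0 ≤ ψ x) :
    ∃ Ψ : S → ℝ, CircDeriv Ψ (fun x => ψ x - ∫ y, ψ y) ∧ ∀ x, |Ψ x| ≤ ∫ y, ψ y := by
  set c := ∫ y, ψ y with hc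
  have hψc : Continuous fun t : ℝ => ψ (t : S) := hψ.comp continuous_coe
  let A : ℝ → ℝ := fun t => (∫ s in (0 : ℝ)..t, ψ (s : S)) - c * t
  -- Subtracting the mean is what makes the primitive periodic. On one period both terms of `A` lie
  -- in `[0, c]`, hence `|A| ≤ c`.
  have hper : Function.Periodic A 1 := by
    intro t
    have h1 : (∫ s in (0 : ℝ)..(t + 1), ψ (s : S)) = (∫ s in (0 : ℝ)..t, ψ (s : S)) + c := by
      rw [← intervalIntegral.integral_add_adjacent_intervals
        (hψc.intervalIntegrable 0 t) (hψc.intervalIntegrable t (t + 1)), ← integral_eq_interval]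
    simp only [A, h1]; ring
  have hder : ∀ t : ℝ, HasDerivAt A (ψ (t : S) - c) t := by
    intro t
    have := (hψc.integral_hasStrictDerivAt 0 t).hasDerivAt
    exact (this.sub ((hasDerivAt_id t).const_mul c)).congr_deriv (by simp)
  refine ⟨hper.lift, ?_, ?_⟩
  · intro t
    simpa using hder t
  · intro x
    obtain ⟨t, ht, rfl⟩ := (AddCircle.coe_image_Icc_eq (1 : ℝ) (a := 0) ▸ Set.mem_univ x :
      x ∈ ((↑) : ℝ → S) '' Set.Icc 0 (0 + 1))
    rw [Function.Periodic.lift_coe]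
    have hc0 : 0 ≤ c := integral_nonneg h0
    have h1 : 0 ≤ ∫ s in (0 : ℝ)..t, ψ (s : S) :=
      intervalIntegral.integral_nonneg ht.1 fun s _ => h0 _
    have h2 : (∫ s in (0 : ℝ)..t, ψ (s : S)) ≤ c := by
      rw [hc, integral_eq_interval ψ 0]
      exact intervalIntegral.integral_mono_interval le_rfl ht.1 ht.2
        (Eventually.of_forall fun s => h0 _) (hψc.intervalIntegrable _ _)
    have h3 : 0 ≤ c * t := mul_nonneg hc0 ht.1
    have h4 : c * t ≤ c := by
      have := ht.2
      nlinarith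
    simp only [A]
    rw [abs_le]; constructor <;> linarith

/-- Weak integration by parts against a Lipschitz function. -/
theorem abs_integral_mul_deriv_le {h φ φ' : S → ℝ} {L : ℝ}
    (hh : Continuous h) (hL : ∀ x y, |h x - h y| ≤ L * dist x y)
    (hφ : CircDeriv φ φ') (hφ' : Continuous φ') :
    |∫ x, h x * φ' x| ≤ L * ∫ x, |φ x| := by
  have hφc := hφ.continuous
  obtain ⟨C, hC⟩ := (isCompact_range hφ').isBounded.exists_norm_le
  let s : ℕ → ℝ := fun n => 1 / ((n : ℝ) + 1)
  have hs0 : ∀ n, 0 < s n := fun n => by positivity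
  have hs : Tendsto s atTop (𝓝 0) := tendsto_one_div_add_atTop_nhds_zero_nat
  have hbd : ∀ n x, |(s n)⁻¹ * (φ (x + (s n : S)) - φ x)| ≤ C := by
    intro n x
    obtain ⟨t, rfl⟩ := coe_surj x
    have := (convex_univ (𝕜 := ℝ) (E := ℝ)).norm_image_sub_le_of_norm_hasDerivWithin_le
      (f := fun s : ℝ => φ (s : S)) (f' := fun s : ℝ => φ' (s : S)) (C := C)
      (fun x _ => (hφ x).hasDerivWithinAt) (fun x _ => hC _ ⟨_, rfl⟩)
      (Set.mem_univ t) (Set.mem_univ (t + s n))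
    simp only [AddCircle.coe_add, add_sub_cancel_left, Real.norm_eq_abs] at this
    rw [abs_mul, abs_inv, abs_of_pos (hs0 n)]
    rw [abs_of_pos (hs0 n)] at this
    rw [inv_mul_le_iff₀ (hs0 n)]
    linarith
  have hlim : Tendsto (fun n => ∫ x, h x * ((s n)⁻¹ * (φ (x + (s n : S)) - φ x))) atTop
      (𝓝 (∫ x, h x * φ' x)) := by
    obtain ⟨M, hM⟩ := (isCompact_range hh).isBounded.exists_norm_le
    refine tendsto_integral_of_dominated_convergence (fun _ => M * C) ?_ ?_ ?_ ?_
    · intro n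
      exact (by fun_prop : Continuous _).aestronglyMeasurable
    · exact integrable_const _
    · intro n
      refine Eventually.of_forall fun x => ?_
      rw [norm_mul]
      exact mul_le_mul (hM _ ⟨x, rfl⟩) (hbd n x) (norm_nonneg _)
        ((norm_nonneg _).trans (hM _ ⟨x, rfl⟩))
    · refine Eventually.of_forall fun x => ?_
      obtain ⟨t, rfl⟩ := coe_surj x
      have := (hφ t).tendsto_slope_zero
      have h2 : Tendsto s atTop (𝓝[≠] 0) :=
        tendsto_nhdsWithin_iff.2 ⟨hs, Eventually.of_forall fun n => (hs0 n).ne'⟩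
      have h3 := this.comp h2
      simp only [Function.comp_def, smul_eq_mul, AddCircle.coe_add] at h3
      exact h3.const_mul _
  -- Since `h` need not be differentiable, translation invariance of Lebesgue measure moves the
  -- difference quotient from `φ` to `h`, where it is at most `L`.
  have hb : ∀ n, |∫ x, h x * ((s n)⁻¹ * (φ (x + (s n : S)) - φ x))| ≤ L * ∫ x, |φ x| := by
    intro n
    have e1 : ∫ x, h x * ((s n)⁻¹ * (φ (x + (s n : S)) - φ x))
        = ∫ x, (s n)⁻¹ * (h (x - (s n : S)) - h x) * φ x := by
      have i1 : Integrable (fun x => (s n)⁻¹ * (h x * φ (x + (s n : S)))) (volume : Measure S) :=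
        integrable_of_continuous (by fun_prop)
      have i2 : Integrable (fun x => (s n)⁻¹ * (h x * φ x)) (volume : Measure S) :=
        integrable_of_continuous (by fun_prop)
      have i3 : Integrable (fun x => (s n)⁻¹ * (h (x - (s n : S)) * φ x)) (volume : Measure S) :=
        integrable_of_continuous (by fun_prop)
      have e2 : ∫ x, (s n)⁻¹ * (h x * φ (x + (s n : S)))
          = ∫ x, (s n)⁻¹ * (h (x - (s n : S)) * φ x) := by
        rw [← integral_add_right_eq_self (μ := (volume : Measure S))
          (fun x => (s n)⁻¹ * (h (x - (s n : S)) * φ x)) (s n : S)]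
        simp
      calc _ = ∫ x, ((s n)⁻¹ * (h x * φ (x + (s n : S))) - (s n)⁻¹ * (h x * φ x)) := by
            congr 1; ext x; ring
        _ = ∫ x, ((s n)⁻¹ * (h (x - (s n : S)) * φ x) - (s n)⁻¹ * (h x * φ x)) := by
            rw [integral_sub i1 i2, e2, ← integral_sub i3 i2]
        _ = _ := by congr 1; ext x; ring
    rw [e1, ← integral_const_mul]
    refine abs_integral_le_integral (by fun_prop) fun x => ?_
    rw [abs_mul]
    refine mul_le_mul_of_nonneg_right ?_ (abs_nonneg _)
    have hd : dist (x - (s n : S)) x ≤ s n := by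
      have := dist_coe_le 0 (s n)
      rw [dist_eq_norm] at this ⊢
      simpa [abs_of_pos (hs0 n)] using this
    have hLn : 0 ≤ L * dist (x - (s n : S)) x := (abs_nonneg _).trans (hL _ _)
    -- The sign of `L` comes from the Lipschitz inequality at two points at distance `1 / 2`.
    have hL0 : 0 ≤ L := by
      have hq : 0 ≤ L * dist ((1 / 2 : ℝ) : S) 0 := (abs_nonneg _).trans (hL _ _)
      have hq2 : dist ((1 / 2 : ℝ) : S) 0 = 1 / 2 := by
        rw [dist_zero_right]
        simpa using AddCircle.norm_half_period_eq (1 : ℝ)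
      rw [hq2] at hq
      linarith
    rw [abs_mul, abs_inv, abs_of_pos (hs0 n), inv_mul_le_iff₀ (hs0 n)]
    calc _ ≤ L * dist (x - (s n : S)) x := hL _ _
      _ ≤ L * s n := by gcongr
      _ = _ := by ring
  exact le_of_tendsto hlim.abs (Eventually.of_forall hb)

/-! ### Functionals represented by Lipschitz densities -/

/-- An approximate identity. -/
theorem exists_kernel {ε : ℝ} (hε : 0 < ε) : ∃ K : C(S, ℝ), (∀ x, 0 ≤ K x) ∧ ∫ x, K x = 1 ∧
    ∀ x, ε ≤ ‖x‖ → K x = 0 := by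
  let k : C(S, ℝ) := ⟨fun x => max 0 (ε - ‖x‖), by fun_prop⟩
  have hk0 : ∀ x, 0 ≤ k x := fun x => le_max_left _ _
  have hpos : 0 < ∫ x, k x := by
    refine k.continuous.integral_pos_of_hasCompactSupport_nonneg_nonzero
      (HasCompactSupport.of_compactSpace _) hk0 (x := 0) ?_
    simp [k, hε.ne', hε.le]
  refine ⟨(∫ x, k x)⁻¹ • k, fun x => ?_, ?_, fun x hx => ?_⟩
  · simp only [ContinuousMap.smul_apply, smul_eq_mul]
    exact mul_nonneg (inv_nonneg.2 hpos.le) (hk0 x)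
  · simp only [ContinuousMap.smul_apply, smul_eq_mul]
    rw [integral_const_mul, inv_mul_cancel₀ hpos.ne']
  · simp [k, hx]

/-- The reflected translate `x ↦ K (y - x)`, as a continuous family. -/
def reflTranslate (K : C(S, ℝ)) : C(S, C(S, ℝ)) :=
  ContinuousMap.curry ⟨fun p : S × S => K (p.1 - p.2), by fun_prop⟩

theorem reflTranslate_apply (K : C(S, ℝ)) (y x : S) : reflTranslate K y x = K (y - x) := rfl

/-- `Ψ x` is the mass that the kernel `K (· - x)` gives to `[s', s]`, and Fubini gives its `L¹`
norm. This is the test function that turns a bound on the distributional derivative of a functional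
into a Lipschitz bound for its mollification. -/
theorem reflTranslate_diff_primitive (K : C(S, ℝ)) (h0 : ∀ x, 0 ≤ K x) (h1 : ∫ x, K x = 1)
    {s s' : ℝ} (hs : s' ≤ s) :
    ∃ Ψ : S → ℝ, CircDeriv Ψ (reflTranslate K s' - reflTranslate K s : C(S, ℝ)) ∧
      ∫ x, |Ψ x| ≤ s - s' := by
  have hKc : Continuous fun r : ℝ => K (r : S) := K.continuous.comp continuous_coe
  refine ⟨fun x => ∫ r in s'..s, K ((r : S) - x), ?_, ?_⟩
  · intro t
    let A : ℝ → ℝ := fun u => ∫ r in (0 : ℝ)..u, K (r : S)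
    have hA : ∀ u : ℝ, HasDerivAt A (K (u : S)) u := fun u =>
      (hKc.integral_hasStrictDerivAt 0 u).hasDerivAt
    have e : (fun u : ℝ => ∫ r in s'..s, K ((r : S) - (u : S))) = fun u => A (s - u) - A (s' - u) := by
      ext u
      have : ∫ r in s'..s, K ((r : S) - (u : S)) = ∫ r in (s' - u)..(s - u), K (r : S) := by
        rw [← intervalIntegral.integral_comp_sub_right (fun r : ℝ => K (r : S)) u]
        simp
      rw [this]
      simp only [A]
      rw [intervalIntegral.integral_interval_sub_left] <;> exact hKc.intervalIntegrable _ _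
    rw [e]
    have d1 := (hA (s - t)).comp t ((hasDerivAt_id t).const_sub s)
    have d2 := (hA (s' - t)).comp t ((hasDerivAt_id t).const_sub s')
    refine (d1.sub d2).congr_deriv ?_
    simp [reflTranslate_apply]
    ring
  · have hnn : ∀ x : S, 0 ≤ ∫ r in s'..s, K ((r : S) - x) := fun x =>
      intervalIntegral.integral_nonneg hs fun r _ => h0 _
    simp_rw [abs_of_nonneg (hnn _)]
    have hcont : Continuous fun p : S × ℝ => K ((p.2 : S) - p.1) :=
      K.continuous.comp ((continuous_coe.comp continuous_snd).sub continuous_fst)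
    obtain ⟨C, hC⟩ := (isCompact_range K.continuous).isBounded.exists_norm_le
    have hint : Integrable (Function.uncurry fun (x : S) (r : ℝ) => K ((r : S) - x))
        ((volume : Measure S).prod (volume.restrict (Set.Ioc s' s))) := by
      refine Integrable.of_bound hcont.aestronglyMeasurable C (Eventually.of_forall fun p => ?_)
      exact hC _ ⟨_, rfl⟩
    simp_rw [intervalIntegral.integral_of_le hs]
    rw [integral_integral_swap hint]
    have : ∀ r : ℝ, ∫ x : S, K ((r : S) - x) = 1 := by
      intro r
      rw [integral_sub_left_eq_self (fun x => K x) (volume : Measure S) (r : S), h1]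
    simp_rw [this]
    simp [hs]

/-- A continuous functional commutes with the Bochner integral in `C(S, ℝ)`, so mollifying `Λ`
amounts to mollifying the test function. -/
theorem integral_functional_reflTranslate (Λ : C(S, ℝ) →L[ℝ] ℝ) (K φ : C(S, ℝ)) :
    ∃ ψ : C(S, ℝ), (∀ x, ψ x = ∫ y, φ y * K (y - x)) ∧
      ∫ y, Λ (reflTranslate K y) * φ y = Λ ψ := by
  have hc : Continuous fun y : S => φ y • reflTranslate K y := by fun_prop
  have hi : Integrable (fun y : S => φ y • reflTranslate K y) volume :=
    hc.integrable_of_hasCompactSupport (HasCompactSupport.of_compactSpace _)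
  refine ⟨∫ y, φ y • reflTranslate K y, fun x => ?_, ?_⟩
  · have := (ContinuousMap.evalCLM ℝ x).integral_comp_comm hi
    simpa [reflTranslate_apply] using this.symm
  · rw [← Λ.integral_comp_comm hi]
    simp [mul_comm]

/-- A functional on `C(S, ℝ)` whose distributional derivative is bounded in the dual of `L¹` is
given by a Lipschitz density. -/
theorem exists_lipschitz_density (Λ : C(S, ℝ) →L[ℝ] ℝ) {L : ℝ} (hL0 : 0 ≤ L)
    (hΛ : ∀ (φ : S → ℝ) (φ' : C(S, ℝ)), CircDeriv φ φ' → |Λ φ'| ≤ L * ∫ x, |φ x|) :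
    ∃ h : C(S, ℝ), (∀ x y, |h x - h y| ≤ L * dist x y) ∧ ∀ φ : C(S, ℝ), Λ φ = ∫ x, h x * φ x := by
  have hε : ∀ n : ℕ, (0 : ℝ) < 1 / ((n : ℝ) + 1) := fun n => by positivity
  choose K hK0 hK1 hKs using fun n => exists_kernel (hε n)
  -- Mollifications of `Λ`: they are `L`-Lipschitz by hypothesis and converge weakly to `Λ`. A
  -- uniform limit along a subsequence is then the density.
  let H : ℕ → C(S, ℝ) := fun n => ⟨fun y => Λ (reflTranslate (K n) y), by fun_prop⟩
  have hlip1 : ∀ n (s s' : ℝ), s' ≤ s → |H n s - H n s'| ≤ L * (s - s') := by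
    intro n s s' hs
    obtain ⟨Ψ, hΨ, hb⟩ := reflTranslate_diff_primitive (K n) (hK0 n) (hK1 n) hs
    have := hΛ Ψ _ hΨ
    rw [map_sub, abs_sub_comm] at this
    exact this.trans (by gcongr)
  have hlip : ∀ n x y, |H n x - H n y| ≤ L * dist x y := by
    intro n x y
    obtain ⟨r, hr, hrn⟩ := exists_rep_norm (x - y)
    obtain ⟨t, rfl⟩ := coe_surj y
    have hx : x = ((t + r : ℝ) : S) := by rw [AddCircle.coe_add, hr]; abel
    rw [dist_eq_norm, ← hrn, hx]
    rcases le_total 0 r with h | h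
    · have := hlip1 n (t + r) t (by linarith)
      rw [abs_of_nonneg h]
      simpa using this
    · have := hlip1 n t (t + r) (by linarith)
      rw [abs_of_nonpos h, abs_sub_comm]
      simpa using this
  have hconv : ∀ φ : C(S, ℝ), Tendsto (fun n => ∫ x, H n x * φ x) atTop (𝓝 (Λ φ)) := by
    intro φ
    choose ψ hψ hψΛ using fun n => integral_functional_reflTranslate Λ (K n) φ
    have e : (fun n => ∫ x, H n x * φ x) = fun n => Λ (ψ n) := funext hψΛ
    rw [e]
    refine (Λ.continuous.tendsto φ).comp ?_
    rw [Metric.tendsto_atTop]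
    intro δ hδ
    obtain ⟨ε, hε0, hεφ⟩ := Metric.uniformContinuous_iff.1
      (CompactSpace.uniformContinuous_of_continuous φ.continuous) (δ / 2) (by positivity)
    obtain ⟨N, hN⟩ := exists_nat_one_div_lt hε0
    refine ⟨N, fun n hn => ?_⟩
    refine lt_of_le_of_lt ((ContinuousMap.dist_le (by positivity : (0 : ℝ) ≤ δ / 2)).2 fun x => ?_)
      (half_lt_self hδ)
    have hn' : 1 / ((n : ℝ) + 1) < ε := lt_of_le_of_lt (by gcongr) hN
    have hone : ∫ y, K n (y - x) = 1 := by
      rw [integral_sub_right_eq_self (fun y => K n y) x, hK1]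
    rw [Real.dist_eq, hψ]
    have i1 : Integrable (fun y => φ y * K n (y - x)) (volume : Measure S) :=
      integrable_of_continuous (by fun_prop)
    have i2 : Integrable (fun y => φ x * K n (y - x)) (volume : Measure S) :=
      integrable_of_continuous (by fun_prop)
    have e2 : (∫ y, φ y * K n (y - x)) - φ x = ∫ y, (φ y - φ x) * K n (y - x) := by
      simp_rw [sub_mul]
      rw [integral_sub i1 i2, integral_const_mul, hone, mul_one]
    rw [e2]
    have e3 : δ / 2 = ∫ y, δ / 2 * K n (y - x) := by rw [integral_const_mul, hone, mul_one]
    rw [e3]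
    refine abs_integral_le_integral (by fun_prop) fun y => ?_
    rw [abs_mul, abs_of_nonneg (hK0 n _)]
    by_cases hy : ‖y - x‖ < ε
    · refine mul_le_mul_of_nonneg_right ?_ (hK0 n _)
      rw [← dist_eq_norm] at hy
      exact (hεφ hy).le
    · rw [hKs n (y - x) (hn'.le.trans (not_lt.1 hy))]
      simp
  -- The means `∫ H n` converge to `Λ 1`, hence are bounded, and the Lipschitz constant controls the
  -- deviation from the mean.
  have hbound : ∃ M : ℝ, ∀ n x, |H n x| ≤ M := by
    obtain ⟨M, hM⟩ := (hconv 1).abs.bddAbove_range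
    refine ⟨M + L, fun n x => ?_⟩
    have hm : |∫ y, H n y| ≤ M := hM ⟨n, by simp⟩
    have e : H n x - ∫ y, H n y = ∫ y, (H n x - H n y) := by
      rw [integral_sub (integrable_const _) (integrable_of_continuous (H n).continuous),
        integral_const_volume]
    have h2 : |H n x - ∫ y, H n y| ≤ L := by
      rw [e, ← integral_const_volume L]
      refine abs_integral_le_integral continuous_const fun y => ?_
      exact (hlip n x y).trans (by nlinarith [dist_le_half x y])
    have := abs_sub_abs_le_abs_sub (H n x) (∫ y, H n y)
    linarith
  obtain ⟨M, hM⟩ := hbound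
  let A : Set (BoundedContinuousFunction S ℝ) :=
    {f | (∀ x y, |f x - f y| ≤ L * dist x y) ∧ ∀ x, |f x| ≤ M}
  have hA : IsCompact (closure A) := by
    refine BoundedContinuousFunction.arzela_ascoli (Set.Icc (-M) M) isCompact_Icc A
      (fun f x hf => abs_le.1 (hf.2 x)) ?_
    refine UniformEquicontinuous.equicontinuous ?_
    refine LipschitzWith.uniformEquicontinuous _ (L.toNNReal) fun f => ?_
    refine LipschitzWith.of_dist_le_mul fun x y => ?_
    rw [Real.coe_toNNReal L hL0, Real.dist_eq]
    exact f.2.1 x y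
  let B : ℕ → BoundedContinuousFunction S ℝ := fun n => BoundedContinuousFunction.mkOfCompact (H n)
  obtain ⟨b, -, θ, hθ, hb⟩ := hA.tendsto_subseq (x := B)
    (fun n => subset_closure ⟨hlip n, hM n⟩)
  have hpt : ∀ x, Tendsto (fun n => H (θ n) x) atTop (𝓝 (b x)) := fun x =>
    ((BoundedContinuousFunction.lipschitz_eval_const x).continuous.tendsto b).comp hb
  refine ⟨b.toContinuousMap, fun x y => ?_, fun φ => ?_⟩
  · exact le_of_tendsto ((hpt x).sub (hpt y)).abs (Eventually.of_forall fun n => hlip _ x y)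
  · refine tendsto_nhds_unique ((hconv φ).comp hθ.tendsto_atTop) ?_
    obtain ⟨C, hC⟩ := (isCompact_range φ.continuous).isBounded.exists_norm_le
    refine tendsto_integral_of_dominated_convergence (fun _ => M * C) ?_ ?_ ?_ ?_
    · intro n
      exact (by fun_prop : Continuous _).aestronglyMeasurable
    · exact integrable_const _
    · intro n
      refine Eventually.of_forall fun x => ?_
      rw [norm_mul]
      exact mul_le_mul (hM _ x) (hC _ ⟨x, rfl⟩) (norm_nonneg _) ((abs_nonneg _).trans (hM 0 x))
    · exact Eventually.of_forall fun x => (hpt x).mul_const _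

/-! ### Densities and their image under a single map -/

/-- A probability density on the circle which is Lipschitz with constant `L`. -/
structure IsDensity (L : ℝ) (h : C(S, ℝ)) : Prop where
  nonneg : ∀ x, 0 ≤ h x
  mass : ∫ x, h x = 1
  lip : ∀ x y, |h x - h y| ≤ L * dist x y

theorem IsDensity.mono {L L' : ℝ} {h : C(S, ℝ)} (hh : IsDensity L h) (hL : L ≤ L') :
    IsDensity L' h :=
  ⟨hh.nonneg, hh.mass, fun x y => (hh.lip x y).trans (by gcongr)⟩

theorem isDensity_one : IsDensity 0 (1 : C(S, ℝ)) :=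
  ⟨fun x => by simp, by simpa using integral_const_volume 1, fun x y => by simp⟩

theorem IsDensity.exists_one_le {L : ℝ} {h : C(S, ℝ)} (hh : IsDensity L h) : ∃ x, 1 ≤ h x := by
  by_contra! hlt
  obtain ⟨x, -, hx⟩ := isCompact_univ.exists_isMaxOn (Set.univ_nonempty (α := S))
    h.continuous.continuousOn
  have h1 : ∫ y, h y ≤ ∫ _ : S, h x := integral_mono (integrable_of_continuous h.continuous)
    (integrable_const _) fun y => hx (Set.mem_univ y)
  rw [hh.mass, integral_const_volume] at h1
  exact absurd (hlt x) (not_lt.2 h1)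

theorem IsDensity.le {L : ℝ} {h : C(S, ℝ)} (hh : IsDensity L h) (hL : 0 ≤ L) (x : S) :
    h x ≤ 1 + L := by
  have e : h x - 1 = ∫ y, (h x - h y) := by
    rw [integral_sub (integrable_const _) (integrable_of_continuous h.continuous),
      integral_const_volume, hh.mass]
  have h2 : |h x - 1| ≤ L := by
    rw [e, ← integral_const_volume L]
    refine abs_integral_le_integral continuous_const fun y => ?_
    exact (hh.lip x y).trans (by nlinarith [dist_le_half x y])
  linarith [le_abs_self (h x - 1)]

theorem IsLift.continuous {F : ℝ → ℝ} {T : S → S} (hF : IsLift F T) (hc : Continuous F) :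
    Continuous T :=
  continuous_of_comp_coe (by simp only [hF _]; exact continuous_coe.comp hc)

/-- `T` is a local diffeomorphism with inverse derivative `w`, and `κ = T'' / (T')²`. -/
structure IsLocalDiffeo (T : S → S) (w κ : C(S, ℝ)) : Prop where
  exists_lift : ∃ F : ℝ → ℝ, IsLift F T ∧ ∀ t : ℝ, HasDerivAt F (w (t : S))⁻¹ t
  deriv_inv : CircDeriv w (fun x => -κ x)
  ne_zero : ∀ x, w x ≠ 0

/-- Uniform bounds on the inverse derivative and on the distortion of a circle map. -/
def HasBounds (T : S → S) (a D : ℝ) : Prop :=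
  ∃ w κ : C(S, ℝ), IsLocalDiffeo T w κ ∧ (∀ x, |w x| ≤ a) ∧ ∀ x, |κ x| ≤ D

theorem IsLocalDiffeo.continuous {T : S → S} {w κ : C(S, ℝ)} (hT : IsLocalDiffeo T w κ) :
    Continuous T := by
  obtain ⟨F, hF, hF'⟩ := hT.exists_lift
  exact hF.continuous (continuous_iff_continuousAt.2 fun t => (hF' t).continuousAt)

theorem HasBounds.continuous {T : S → S} {a D : ℝ} (hT : HasBounds T a D) : Continuous T := by
  obtain ⟨w, κ, h, -⟩ := hT
  exact h.continuous

/-- The weight `w = 1 / T'` cancels the chain rule factor, so `φ'∘T` is a derivative up to a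
distortion term without derivatives of `φ`. The Lasota–Yorke inequality rests on this identity. -/
theorem IsLocalDiffeo.circDeriv_comp_mul {T : S → S} {w κ : C(S, ℝ)} (hT : IsLocalDiffeo T w κ)
    {φ φ' : S → ℝ} (hφ : CircDeriv φ φ') :
    CircDeriv (fun x => φ (T x) * w x) (fun x => φ' (T x) - φ (T x) * κ x) := by
  obtain ⟨F, hF, hF'⟩ := hT.exists_lift
  intro t
  have h1 : HasDerivAt (fun s : ℝ => φ (T (s : S))) (φ' (T (t : S)) * (w (t : S))⁻¹) t := by
    simp only [hF _]
    exact (hφ (F t)).comp t (hF' t)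
  refine (h1.mul (hT.deriv_inv t)).congr_deriv ?_
  have := hT.ne_zero (t : S)
  field_simp
  ring

theorem hasBounds_id : HasBounds id 1 0 := by
  refine ⟨1, 0, ⟨⟨id, fun t => rfl, fun t => ?_⟩, fun t => ?_, fun x => by simp⟩, fun x => by simp,
    fun x => by simp⟩
  · simpa using hasDerivAt_id t
  · simpa using hasDerivAt_const t (1 : ℝ)

/-- The quantity `T'' / (T')²` of the composition is `κ₂∘T₁ + (w₂∘T₁) κ₁`: the earlier distortion is
multiplied by the inverse derivative of the later map, which keeps distortion under control along
long compositions. -/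
theorem HasBounds.comp {T₁ T₂ : S → S} {a₁ a₂ D₁ D₂ : ℝ} (h₂ : HasBounds T₂ a₂ D₂)
    (h₁ : HasBounds T₁ a₁ D₁) : HasBounds (fun x => T₂ (T₁ x)) (a₂ * a₁) (D₂ + a₂ * D₁) := by
  have c₁ := h₁.continuous
  obtain ⟨w₁, κ₁, d₁, hw₁, hκ₁⟩ := h₁
  obtain ⟨w₂, κ₂, d₂, hw₂, hκ₂⟩ := h₂
  have ha₂ : 0 ≤ a₂ := (abs_nonneg _).trans (hw₂ 0)
  let w : C(S, ℝ) := ⟨fun x => w₂ (T₁ x) * w₁ x, by fun_prop⟩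
  let κ : C(S, ℝ) := ⟨fun x => κ₂ (T₁ x) + w₂ (T₁ x) * κ₁ x, by fun_prop⟩
  refine ⟨w, κ, ⟨?_, ?_, fun x => mul_ne_zero (d₂.ne_zero _) (d₁.ne_zero _)⟩, fun x => ?_,
    fun x => ?_⟩
  · obtain ⟨F₁, hF₁, hF₁'⟩ := d₁.exists_lift
    obtain ⟨F₂, hF₂, hF₂'⟩ := d₂.exists_lift
    refine ⟨fun t => F₂ (F₁ t), fun t => by simp only [hF₁ t, hF₂ _], fun t => ?_⟩
    refine ((hF₂' (F₁ t)).comp t (hF₁' t)).congr_deriv ?_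
    simp only [w, ContinuousMap.coe_mk, hF₁ t, mul_inv]
  · have := d₁.circDeriv_comp_mul d₂.deriv_inv
    intro t
    refine (this t).congr_deriv ?_
    simp only [κ, ContinuousMap.coe_mk]
    ring
  · simp only [w, ContinuousMap.coe_mk, abs_mul]
    exact mul_le_mul (hw₂ _) (hw₁ _) (abs_nonneg _) ha₂
  · simp only [κ, ContinuousMap.coe_mk]
    refine (abs_add_le _ _).trans (add_le_add (hκ₂ _) ?_)
    rw [abs_mul]
    exact mul_le_mul (hw₂ _) (hκ₁ _) (abs_nonneg _) ha₂

section SingleMap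

variable {T : S → S} {a D L : ℝ} {h : C(S, ℝ)}

theorem HasBounds.nonneg (hT : HasBounds T a D) : 0 ≤ a ∧ 0 ≤ D := by
  obtain ⟨w, κ, -, hw, hκ⟩ := hT
  exact ⟨(abs_nonneg _).trans (hw 0), (abs_nonneg _).trans (hκ 0)⟩

theorem IsDensity.abs_integral_mul_le (hh : IsDensity L h) {g : S → ℝ} {c : ℝ}
    (hg : ∀ x, |g x| ≤ c) : |∫ x, h x * g x| ≤ c := by
  have e : c = ∫ x, h x * c := by rw [integral_mul_const, hh.mass, one_mul]
  rw [e]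
  refine abs_integral_le_integral (by fun_prop) fun x => ?_
  rw [abs_mul, abs_of_nonneg (hh.nonneg x)]
  exact mul_le_mul_of_nonneg_left (hg x) (hh.nonneg x)

/-- The image density is bounded. -/
theorem HasBounds.integral_comp_le (hT : HasBounds T a D) (hL : 0 ≤ L) (hh : IsDensity L h)
    {ψ : S → ℝ} (hψ : Continuous ψ) (h0 : ∀ x, 0 ≤ ψ x) :
    ∫ x, h x * ψ (T x) ≤ (1 + L * a + D) * ∫ x, ψ x := by
  have hTc := hT.continuous
  obtain ⟨w, κ, d, hw, hκ⟩ := hT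
  -- With `c` the mean of `ψ`, write `ψ∘T = ((Ψ∘T) w)' + (Ψ∘T) κ + c`. As `|Ψ| ≤ c`, the three terms
  -- contribute `L * a`, `D` and `1` times `c`.
  obtain ⟨Ψ, hΨ, hΨb⟩ := exists_primitive hψ h0
  have hΨc := hΨ.continuous
  set c := ∫ x, ψ x
  have hc0 : 0 ≤ c := integral_nonneg h0
  have hχ := d.circDeriv_comp_mul hΨ
  have b1 := abs_integral_mul_deriv_le h.continuous hh.lip hχ (by fun_prop)
  have b2 : ∫ x, |Ψ (T x) * w x| ≤ c * a := by
    rw [← integral_const_volume (c * a)]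
    refine integral_mono (integrable_of_continuous (by fun_prop)) (integrable_const _) fun x => ?_
    simp only [abs_mul]
    exact mul_le_mul (hΨb _) (hw _) (abs_nonneg _) hc0
  have b3 : |∫ x, h x * (Ψ (T x) * κ x)| ≤ c * D := hh.abs_integral_mul_le fun x => by
    rw [abs_mul]
    exact mul_le_mul (hΨb _) (hκ _) (abs_nonneg _) hc0
  have i1 : Integrable (fun x => h x * (ψ (T x) - c - Ψ (T x) * κ x)) (volume : Measure S) :=
    integrable_of_continuous (by fun_prop)
  have i2 : Integrable (fun x => h x * (Ψ (T x) * κ x)) (volume : Measure S) :=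
    integrable_of_continuous (by fun_prop)
  have i3 : Integrable (fun x => h x * c) (volume : Measure S) :=
    integrable_of_continuous (by fun_prop)
  have e : ∫ x, h x * ψ (T x) = (∫ x, h x * (ψ (T x) - c - Ψ (T x) * κ x)) +
      (∫ x, h x * (Ψ (T x) * κ x)) + c := by
    have e3 : c = ∫ x, h x * c := by rw [integral_mul_const, hh.mass, one_mul]
    calc ∫ x, h x * ψ (T x) = ∫ x, (h x * (ψ (T x) - c - Ψ (T x) * κ x) +
          h x * (Ψ (T x) * κ x) + h x * c) := by congr 1; ext x; ring
      _ = _ := by rw [integral_add (by exact i1.add i2) i3, integral_add i1 i2, ← e3]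
  have := mul_le_mul_of_nonneg_left b2 hL
  rw [e]
  nlinarith [le_abs_self (∫ x, h x * (ψ (T x) - c - Ψ (T x) * κ x)),
    le_abs_self (∫ x, h x * (Ψ (T x) * κ x))]

/-- The image density is Lipschitz, in weak form. -/
theorem HasBounds.abs_integral_deriv_comp_le (hT : HasBounds T a D) (hL : 0 ≤ L)
    (hh : IsDensity L h) {φ φ' : S → ℝ} (hφ : CircDeriv φ φ') (hφ' : Continuous φ') :
    |∫ x, h x * φ' (T x)| ≤ (L * (a * (1 + 2 * D)) + D * (1 + D)) * ∫ x, |φ x| := by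
  have hφc := hφ.continuous
  have m1 := hT.integral_comp_le hL hh (ψ := fun x => |φ x|) (by fun_prop) fun x => abs_nonneg _
  -- Lebesgue measure has Lipschitz constant `0`, so this bound does not involve `L`. It is used on
  -- the term that already carries a factor `L`, which keeps the final estimate affine in `L`.
  have m2 := hT.integral_comp_le le_rfl isDensity_one (ψ := fun x => |φ x|) (by fun_prop)
    fun x => abs_nonneg _
  obtain ⟨ha, hD⟩ := hT.nonneg
  have hTc := hT.continuous
  obtain ⟨w, κ, d, hw, hκ⟩ := hT
  set c := ∫ x, |φ x|
  simp only [ContinuousMap.one_apply, one_mul, zero_mul, add_zero] at m2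
  have b1 := abs_integral_mul_deriv_le h.continuous hh.lip (d.circDeriv_comp_mul hφ) (by fun_prop)
  have b2 : ∫ x, |φ (T x) * w x| ≤ a * ((1 + D) * c) := by
    refine le_trans ?_ (mul_le_mul_of_nonneg_left m2 ha)
    rw [← integral_const_mul]
    refine integral_mono (integrable_of_continuous (by fun_prop))
      (integrable_of_continuous (by fun_prop)) fun x => ?_
    simp only [abs_mul]
    rw [mul_comm a]
    exact mul_le_mul_of_nonneg_left (hw _) (abs_nonneg _)
  have b3 : |∫ x, h x * (φ (T x) * κ x)| ≤ D * ((1 + L * a + D) * c) := by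
    refine le_trans ?_ (mul_le_mul_of_nonneg_left m1 hD)
    rw [← integral_const_mul]
    refine abs_integral_le_integral (by fun_prop) fun x => ?_
    rw [abs_mul, abs_mul, abs_of_nonneg (hh.nonneg x), mul_comm D, mul_assoc]
    exact mul_le_mul_of_nonneg_left (mul_le_mul_of_nonneg_left (hκ _) (abs_nonneg _))
      (hh.nonneg x)
  have i1 : Integrable (fun x => h x * (φ' (T x) - φ (T x) * κ x)) (volume : Measure S) :=
    integrable_of_continuous (by fun_prop)
  have i2 : Integrable (fun x => h x * (φ (T x) * κ x)) (volume : Measure S) :=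
    integrable_of_continuous (by fun_prop)
  have e : ∫ x, h x * φ' (T x) = (∫ x, h x * (φ' (T x) - φ (T x) * κ x)) +
      ∫ x, h x * (φ (T x) * κ x) := by
    rw [← integral_add i1 i2]
    congr 1; ext x; ring
  have := mul_le_mul_of_nonneg_left b2 hL
  rw [e]
  refine (abs_add_le _ _).trans ?_
  nlinarith

/-- An interval of length at least one in the cover wraps around the circle. The absolute value
covers maps reversing orientation. -/
theorem integral_le_abs_intervalIntegral {ψ : S → ℝ} (hψ : Continuous ψ) (h0 : ∀ x, 0 ≤ ψ x)
    {p q : ℝ} (hpq : 1 ≤ |q - p|) : ∫ x, ψ x ≤ |∫ t in p..q, ψ (t : S)| := by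
  have hc : Continuous fun t : ℝ => ψ (t : S) := hψ.comp continuous_coe
  have key : ∀ p q : ℝ, p + 1 ≤ q → ∫ x, ψ x ≤ ∫ t in p..q, ψ (t : S) := by
    intro p q h
    rw [integral_eq_interval ψ p]
    exact intervalIntegral.integral_mono_interval le_rfl (by linarith) h
      (Eventually.of_forall fun s => h0 _) (hc.intervalIntegrable _ _)
  rcases le_abs.1 hpq with h | h
  · exact (key p q (by linarith)).trans (le_abs_self _)
  · rw [intervalIntegral.integral_symm, abs_neg]
    exact (key q p (by linarith)).trans (le_abs_self _)

/-- If `T` stretches every interval of length `1 / (2 * L)` over the whole circle, the image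
density is bounded below. -/
theorem IsLocalDiffeo.le_integral_comp {w κ : C(S, ℝ)} (hT : IsLocalDiffeo T w κ) (hL : 1 ≤ L)
    (hh : IsDensity L h) (hw : ∀ x, |w x| ≤ 1 / (2 * L)) {b : ℝ} (hb : 0 ≤ b)
    (hbw : ∀ x, b ≤ |w x|) {ψ : S → ℝ} (hψ : Continuous ψ) (h0 : ∀ x, 0 ≤ ψ x) :
    b / 2 * ∫ x, ψ x ≤ ∫ x, h x * ψ (T x) := by
  obtain ⟨F, hF, hF'⟩ := hT.exists_lift
  have hTc := hT.continuous
  obtain ⟨x₀, hx₀⟩ := hh.exists_one_le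
  obtain ⟨t₀, rfl⟩ := coe_surj x₀
  set ℓ : ℝ := 1 / (2 * L) with hℓ
  have hℓ0 : 0 < ℓ := by positivity
  have hLℓ : L * ℓ = 1 / 2 := by rw [hℓ]; field_simp
  -- The interval fits into one fundamental domain, so the integral over it is at most the integral
  -- over the circle.
  have hℓ1 : ℓ ≤ 1 := by nlinarith
  have hhalf : ∀ t ∈ Set.Icc t₀ (t₀ + ℓ), 1 / 2 ≤ h (t : S) := by
    intro t ht
    have h1 := hh.lip t t₀
    have h2 : dist (t : S) (t₀ : S) ≤ ℓ := (dist_coe_le t t₀).trans (by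
      rw [abs_of_nonneg (by linarith [ht.1])]; linarith [ht.2])
    have h3 : L * dist (t : S) (t₀ : S) ≤ 1 / 2 := by
      rw [← hLℓ]; gcongr
    linarith [neg_abs_le (h (t : S) - h (t₀ : S))]
  have hwc : Continuous fun t : ℝ => (w (t : S))⁻¹ :=
    (w.continuous.comp continuous_coe).inv₀ fun t => hT.ne_zero _
  have hψT : Continuous fun t : ℝ => ψ (T (t : S)) := by
    exact (hψ.comp hTc).comp continuous_coe
  have hhc : Continuous fun t : ℝ => h (t : S) := h.continuous.comp continuous_coe
  -- Mean value theorem: the derivative of the lift has modulus at least `2 * L`, the inverse of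
  -- `ℓ`.
  have hstretch : 1 ≤ |F (t₀ + ℓ) - F t₀| := by
    obtain ⟨s, -, hs⟩ := exists_hasDerivAt_eq_slope F (fun t : ℝ => (w (t : S))⁻¹)
      (lt_add_of_pos_right t₀ hℓ0)
      (fun t _ => (hF' t).continuousAt.continuousWithinAt) (fun t _ => hF' t)
    have : F (t₀ + ℓ) - F t₀ = (w (s : S))⁻¹ * ℓ := by
      rw [hs, add_sub_cancel_left, div_mul_cancel₀ _ hℓ0.ne']
    rw [this, abs_mul, abs_inv, abs_of_pos hℓ0, ← div_eq_inv_mul,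
      one_le_div (abs_pos.2 (hT.ne_zero _))]
    exact hw _
  have hcv : ∫ t in t₀..(t₀ + ℓ), ψ (T (t : S)) * (w (t : S))⁻¹ =
      ∫ u in (F t₀)..(F (t₀ + ℓ)), ψ (u : S) := by
    have := intervalIntegral.integral_comp_mul_deriv (a := t₀) (b := t₀ + ℓ)
      (g := fun u : ℝ => ψ (u : S)) (fun t _ => hF' t) hwc.continuousOn (hψ.comp continuous_coe)
    simpa [hF _] using this
  have s1 := integral_le_abs_intervalIntegral hψ h0 hstretch
  rw [← hcv] at s1
  have s2 : |∫ t in t₀..(t₀ + ℓ), ψ (T (t : S)) * (w (t : S))⁻¹| ≤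
      ∫ t in t₀..(t₀ + ℓ), ψ (T (t : S)) * |(w (t : S))⁻¹| := by
    refine (intervalIntegral.abs_integral_le_integral_abs (by linarith)).trans (le_of_eq ?_)
    congr 1; ext t
    rw [abs_mul, abs_of_nonneg (h0 _)]
  have s3 : b / 2 * ∫ t in t₀..(t₀ + ℓ), ψ (T (t : S)) * |(w (t : S))⁻¹| ≤
      ∫ t in t₀..(t₀ + ℓ), h (t : S) * ψ (T (t : S)) := by
    rw [← intervalIntegral.integral_const_mul]
    refine intervalIntegral.integral_mono_on (by linarith)
      ((by fun_prop : Continuous _).intervalIntegrable _ _)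
      ((by fun_prop : Continuous _).intervalIntegrable _ _) fun t ht => ?_
    have q1 := hhalf t ht
    have q2 : b * |(w (t : S))⁻¹| ≤ 1 := by
      rw [abs_inv, ← div_eq_mul_inv, div_le_one (abs_pos.2 (hT.ne_zero _))]
      exact hbw _
    have q3 := h0 (T (t : S))
    calc b / 2 * (ψ (T (t : S)) * |(w (t : S))⁻¹|)
        = (b * |(w (t : S))⁻¹|) * (1 / 2 * ψ (T (t : S))) := by ring
      _ ≤ 1 * (1 / 2 * ψ (T (t : S))) := by gcongr
      _ ≤ h (t : S) * ψ (T (t : S)) := by rw [one_mul]; gcongr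
  have s4 : ∫ t in t₀..(t₀ + ℓ), h (t : S) * ψ (T (t : S)) ≤ ∫ x, h x * ψ (T x) := by
    rw [integral_eq_interval (fun x => h x * ψ (T x)) t₀]
    exact intervalIntegral.integral_mono_interval le_rfl (by linarith) (by linarith)
      (Eventually.of_forall fun s => mul_nonneg (hh.nonneg _) (h0 _))
      ((hhc.mul hψT).intervalIntegrable _ _)
  calc b / 2 * ∫ x, ψ x ≤ b / 2 * ∫ t in t₀..(t₀ + ℓ), ψ (T (t : S)) * |(w (t : S))⁻¹| := by
        gcongr; exact s1.trans s2
    _ ≤ _ := s3.trans s4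

end SingleMap

/-! ### Dilation and distortion -/

section LiftDerivatives

variable {T : S → S}

theorem IsC2NoCritical.contDiff_deriv (h : IsC2NoCritical T) : ContDiff ℝ 1 (deriv (lift T)) :=
  ((contDiff_succ_iff_deriv (n := 1)).1 (lift_spec h).2.1).2.2

theorem IsC2NoCritical.periodic_deriv (h : IsC2NoCritical T) :
    Function.Periodic (deriv (lift T)) 1 := by
  obtain ⟨hL, hc, -⟩ := lift_spec h
  intro t
  have h1 : IsLift (fun s => lift T (s + 1)) T := fun s => by
    rw [← hL (s + 1), AddCircle.coe_add_period]
  have h2 := congrFun (deriv_eq_deriv_lift h h1 (hc.continuous.comp (by fun_prop))) t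
  rwa [deriv_comp_add_const] at h2

theorem IsC2NoCritical.periodic_deriv_deriv (h : IsC2NoCritical T) :
    Function.Periodic (deriv (deriv (lift T))) 1 := by
  intro t
  have h1 : (fun s => deriv (lift T) (s + 1)) = deriv (lift T) := funext h.periodic_deriv
  have h2 := congrArg (fun g => deriv g t) h1
  simpa only [deriv_comp_add_const] using h2

/-- A `C²` circle map without critical points is a local diffeomorphism. -/
theorem IsC2NoCritical.exists_isLocalDiffeo (h : IsC2NoCritical T) :
    ∃ w κ : C(S, ℝ), IsLocalDiffeo T w κ ∧ (∀ t : ℝ, w (t : S) = (deriv (lift T) t)⁻¹) ∧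
      ∀ t : ℝ, κ (t : S) = deriv (deriv (lift T)) t / deriv (lift T) t ^ 2 := by
  obtain ⟨hL, hc, h0⟩ := lift_spec h
  have hp := h.periodic_deriv
  have hpp := h.periodic_deriv_deriv
  have hd := h.contDiff_deriv
  have hdd : Continuous (deriv (deriv (lift T))) := hd.continuous_deriv le_rfl
  have p1 : Function.Periodic (fun t => (deriv (lift T) t)⁻¹) 1 := fun t => by simp only [hp t]
  have p2 : Function.Periodic (fun t => deriv (deriv (lift T)) t / deriv (lift T) t ^ 2) 1 :=
    fun t => by simp only [hp t, hpp t]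
  let w : C(S, ℝ) := ⟨p1.lift, continuous_of_comp_coe (by
    simp only [Function.Periodic.lift_coe]
    exact hd.continuous.inv₀ h0)⟩
  let κ : C(S, ℝ) := ⟨p2.lift, continuous_of_comp_coe (by
    simp only [Function.Periodic.lift_coe]
    exact hdd.div (hd.continuous.pow 2) fun t => pow_ne_zero 2 (h0 t))⟩
  have hw : ∀ t : ℝ, w (t : S) = (deriv (lift T) t)⁻¹ := fun t => Function.Periodic.lift_coe p1 t
  have hκ : ∀ t : ℝ, κ (t : S) = deriv (deriv (lift T)) t / deriv (lift T) t ^ 2 := fun t =>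
    Function.Periodic.lift_coe p2 t
  refine ⟨w, κ, ⟨⟨lift T, hL, fun t => ?_⟩, fun t => ?_, fun x => ?_⟩, hw, hκ⟩
  · rw [hw, inv_inv]
    exact (hc.differentiable (by norm_num) t).hasDerivAt
  · simp only [hw, hκ]
    have := ((hd.differentiable (by norm_num) t).hasDerivAt).inv (h0 t)
    refine this.congr_deriv ?_
    ring
  · obtain ⟨t, rfl⟩ := coe_surj x
    rw [hw]
    exact inv_ne_zero (h0 t)

theorem IsC2NoCritical.dilation_le (t : ℝ) : dilation T ≤ |deriv (lift T) t| :=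
  ciInf_le ⟨0, by rintro _ ⟨s, rfl⟩; exact abs_nonneg _⟩ t

theorem IsC2NoCritical.dilation_pos (h : IsC2NoCritical T) : 0 < dilation T := by
  obtain ⟨w, κ, d, hw, -⟩ := h.exists_isLocalDiffeo
  obtain ⟨M, hM⟩ := (isCompact_range w.continuous).isBounded.exists_norm_le
  have hMpos : 0 < M := lt_of_lt_of_le (abs_pos.2 (d.ne_zero 0)) (hM _ ⟨0, rfl⟩)
  refine lt_of_lt_of_le (inv_pos.2 hMpos) (le_ciInf fun t => ?_)
  have h1 := hM _ ⟨(t : S), rfl⟩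
  rw [hw, norm_inv, Real.norm_eq_abs] at h1
  exact inv_le_of_inv_le₀ (abs_pos.2 ((lift_spec h).2.2 t)) h1

theorem IsC2NoCritical.le_distortion (h : IsC2NoCritical T) (t : ℝ) :
    |deriv (deriv (lift T)) t / deriv (lift T) t ^ 2| ≤ distortion T := by
  obtain ⟨w, κ, -, -, hκ⟩ := h.exists_isLocalDiffeo
  obtain ⟨M, hM⟩ := (isCompact_range κ.continuous).isBounded.exists_norm_le
  refine le_ciSup (f := fun t => |deriv (deriv (lift T)) t / deriv (lift T) t ^ 2|) ⟨M, ?_⟩ t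
  rintro _ ⟨s, rfl⟩
  simp only [← hκ]
  exact hM _ ⟨_, rfl⟩

theorem IsC2NoCritical.hasBounds (h : IsC2NoCritical T) :
    HasBounds T (dilation T)⁻¹ (distortion T) := by
  obtain ⟨w, κ, d, hw, hκ⟩ := h.exists_isLocalDiffeo
  refine ⟨w, κ, d, fun x => ?_, fun x => ?_⟩ <;> obtain ⟨t, rfl⟩ := coe_surj x
  · rw [hw, abs_inv]
    exact inv_anti₀ h.dilation_pos (dilation_le t)
  · rw [hκ]
    exact h.le_distortion t

/-- A countable infimum is needed for measurability in the parameter. -/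
theorem IsC2NoCritical.dilation_eq_iInf_rat (h : IsC2NoCritical T) :
    dilation T = ⨅ q : ℚ, |deriv (lift T) (q : ℝ)| := by
  have hbdd : BddBelow (Set.range fun q : ℚ => |deriv (lift T) (q : ℝ)|) :=
    ⟨0, by rintro _ ⟨s, rfl⟩; exact abs_nonneg _⟩
  refine le_antisymm (le_ciInf fun q => dilation_le _) (le_ciInf fun t => ?_)
  have hc := h.contDiff_deriv.continuous
  refine Rat.denseRange_cast.induction_on (p := fun t : ℝ =>
    ⨅ q : ℚ, |deriv (lift T) (q : ℝ)| ≤ |deriv (lift T) t|) t ?_ fun q => ciInf_le hbdd q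
  exact isClosed_le continuous_const hc.abs

theorem IsC2NoCritical.distortion_eq_iSup_rat (h : IsC2NoCritical T) :
    distortion T = ⨆ q : ℚ, |deriv (deriv (lift T)) (q : ℝ) / deriv (lift T) (q : ℝ) ^ 2| := by
  have hbdd : BddAbove (Set.range fun q : ℚ =>
      |deriv (deriv (lift T)) (q : ℝ) / deriv (lift T) (q : ℝ) ^ 2|) :=
    ⟨distortion T, by rintro _ ⟨s, rfl⟩; exact h.le_distortion _⟩
  refine le_antisymm (ciSup_le fun t => ?_) (ciSup_le fun q => h.le_distortion _)
  have hc := h.contDiff_deriv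
  refine Rat.denseRange_cast.induction_on (p := fun t : ℝ =>
    |deriv (deriv (lift T)) t / deriv (lift T) t ^ 2| ≤
      ⨆ q : ℚ, |deriv (deriv (lift T)) (q : ℝ) / deriv (lift T) (q : ℝ) ^ 2|) t ?_
    fun q => le_ciSup hbdd q
  exact isClosed_le (((hc.continuous_deriv le_rfl).div (hc.continuous.pow 2)
    fun t => pow_ne_zero 2 ((lift_spec h).2.2 t)).abs) continuous_const

theorem tendsto_slope_nat {F : ℝ → ℝ} {F' t : ℝ} (h : HasDerivAt F F' t) :
    Tendsto (fun n : ℕ => ((n : ℝ) + 1) * (F (t + 1 / ((n : ℝ) + 1)) - F t)) atTop (𝓝 F') := by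
  have h2 : Tendsto (fun n : ℕ => 1 / ((n : ℝ) + 1)) atTop (𝓝[≠] 0) :=
    tendsto_nhdsWithin_iff.2 ⟨tendsto_one_div_add_atTop_nhds_zero_nat,
      Eventually.of_forall fun n => (by positivity : (1 / ((n : ℝ) + 1)) ≠ 0)⟩
  have := h.tendsto_slope_zero.comp h2
  simpa only [Function.comp_def, one_div, inv_inv, smul_eq_mul] using this

/-- The lifts are chosen without any measurability in the parameter. Here `|T'|` is recovered from
distances between values of `T` itself: for small increments the circle distance equals the distance
in the lift. -/
theorem tendsto_dist_slope (h : IsC2NoCritical T) (t : ℝ) :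
    Tendsto (fun n : ℕ => ((n : ℝ) + 1) * dist (T ((t + 1 / ((n : ℝ) + 1) : ℝ) : S)) (T (t : S)))
      atTop (𝓝 |deriv (lift T) t|) := by
  obtain ⟨hL, hc, -⟩ := lift_spec h
  have hd : HasDerivAt (lift T) (deriv (lift T) t) t :=
    (hc.differentiable (by norm_num) t).hasDerivAt
  refine (tendsto_slope_nat hd).abs.congr' ?_
  have hcont : Tendsto (fun n : ℕ => lift T (t + 1 / ((n : ℝ) + 1)) - lift T t) atTop (𝓝 0) := by
    have h1 : Tendsto (fun n : ℕ => t + 1 / ((n : ℝ) + 1)) atTop (𝓝 t) := by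
      simpa using tendsto_one_div_add_atTop_nhds_zero_nat.const_add t
    simpa using ((hc.continuous.tendsto t).comp h1).sub_const (lift T t)
  have hsmall := hcont.abs.eventually (gt_mem_nhds (by simp : |(0 : ℝ)| < 1 / 2))
  filter_upwards [hsmall] with n hn
  rw [hL, hL, dist_eq_norm, ← AddCircle.coe_sub, abs_mul, abs_of_pos (by positivity)]
  congr 1
  exact ((AddCircle.norm_coe_eq_abs_iff (1 : ℝ) one_ne_zero).2 (by simpa using hn.le)).symm

theorem abs_sub_eq_abs_abs_sub_abs {a b : ℝ} (h : 0 < a * b) : |a - b| = |(|a| - |b|)| := by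
  rcases pos_and_pos_or_neg_and_neg_of_mul_pos h with ⟨ha, hb⟩ | ⟨ha, hb⟩
  · rw [abs_of_pos ha, abs_of_pos hb]
  · rw [abs_of_neg ha, abs_of_neg hb, ← abs_neg]
    congr 1; ring

/-- Only `|T'|` is known to be measurable in the parameter. As `T'` has constant sign near `t`,
difference quotients of `1 / |T'|` suffice to recover `|T'' / (T')²|`. -/
theorem tendsto_inv_slope (h : IsC2NoCritical T) (t : ℝ) :
    Tendsto (fun n : ℕ => ((n : ℝ) + 1) *
      |(|deriv (lift T) (t + 1 / ((n : ℝ) + 1))|⁻¹ - |deriv (lift T) t|⁻¹)|)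
      atTop (𝓝 |deriv (deriv (lift T)) t / deriv (lift T) t ^ 2|) := by
  obtain ⟨w, κ, d, hw, hκ⟩ := h.exists_isLocalDiffeo
  have hd := (tendsto_slope_nat (d.deriv_inv t)).abs
  rw [abs_neg, hκ] at hd
  refine hd.congr' ?_
  have h1 : Tendsto (fun n : ℕ => t + 1 / ((n : ℝ) + 1)) atTop (𝓝 t) := by
    simpa using tendsto_one_div_add_atTop_nhds_zero_nat.const_add t
  have h2 : Tendsto (fun n : ℕ => w ((t + 1 / ((n : ℝ) + 1) : ℝ) : S) * w (t : S)) atTop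
      (𝓝 (w (t : S) * w (t : S))) :=
    (((w.continuous.comp continuous_coe).tendsto t).comp h1).mul_const _
  have h3 : 0 < w (t : S) * w (t : S) := mul_self_pos.2 (d.ne_zero _)
  filter_upwards [h2.eventually (lt_mem_nhds h3)] with n hn
  rw [abs_mul, abs_of_pos (by positivity : (0 : ℝ) < (n : ℝ) + 1), abs_sub_eq_abs_abs_sub_abs hn,
    hw, hw, abs_inv, abs_inv]

end LiftDerivatives

/-! ### Measurability of dilation and distortion in the parameter -/

section Measurability

variable {Ω : Type*} [MeasurableSpace Ω] {T : Ω → S → S}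

theorem measurable_abs_deriv_lift (hm : Measurable fun p : Ω × S => T p.1 p.2)
    (hs : ∀ ω, IsC2NoCritical (T ω)) (t : ℝ) : Measurable fun ω => |deriv (lift (T ω)) t| := by
  refine measurable_of_tendsto_metrizable (f := fun (n : ℕ) ω => ((n : ℝ) + 1) *
    dist (T ω ((t + 1 / ((n : ℝ) + 1) : ℝ) : S)) (T ω (t : S))) (fun n => ?_)
    (tendsto_pi_nhds.2 fun ω => tendsto_dist_slope (hs ω) t)
  exact (((hm.comp measurable_prodMk_right).dist (hm.comp measurable_prodMk_right)).const_mul _)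

theorem measurable_dilation (hm : Measurable fun p : Ω × S => T p.1 p.2)
    (hs : ∀ ω, IsC2NoCritical (T ω)) : Measurable fun ω => dilation (T ω) := by
  simp only [fun ω => (hs ω).dilation_eq_iInf_rat]
  exact Measurable.iInf fun q => measurable_abs_deriv_lift hm hs q

theorem measurable_distortion (hm : Measurable fun p : Ω × S => T p.1 p.2)
    (hs : ∀ ω, IsC2NoCritical (T ω)) : Measurable fun ω => distortion (T ω) := by
  simp only [fun ω => (hs ω).distortion_eq_iSup_rat]
  refine Measurable.iSup fun q => ?_
  refine measurable_of_tendsto_metrizable (fun n => ?_)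
    (tendsto_pi_nhds.2 fun ω => tendsto_inv_slope (hs ω) q)
  have m1 := measurable_abs_deriv_lift hm hs
  exact (((m1 _).inv.sub (m1 _).inv).abs).const_mul _

end Measurability

/-! ### Independence of the coordinates -/

section Update

variable {Ω : Type*} [MeasurableSpace Ω] (η : Measure Ω) [IsProbabilityMeasure η]

/-- Resampling one coordinate preserves the product measure. -/
theorem measurePreserving_update (n : ℕ) :
    MeasurePreserving (fun p : (ℕ → Ω) × Ω => Function.update p.1 n p.2)
      ((Measure.infinitePi fun _ : ℕ => η).prod η) (Measure.infinitePi fun _ : ℕ => η) := by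
  have hm : Measurable fun p : (ℕ → Ω) × Ω => Function.update p.1 n p.2 := by
    refine measurable_pi_iff.2 fun i => ?_
    by_cases h : i = n
    · subst h
      simpa using measurable_snd
    · simp only [Function.update_of_ne h]
      exact (measurable_pi_apply i).comp measurable_fst
  refine ⟨hm, Measure.eq_infinitePi _ fun s t ht => ?_⟩
  rw [Measure.map_apply hm (MeasurableSet.pi s.countable_toSet fun i _ => ht i)]
  by_cases hn : n ∈ s
  · have e : (fun p : (ℕ → Ω) × Ω => Function.update p.1 n p.2) ⁻¹' (Set.pi s t) =
        (Set.pi (s.erase n : Finset ℕ) t) ×ˢ t n := by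
      ext p
      simp only [Set.mem_preimage, Set.mem_pi, Finset.mem_coe, Finset.mem_erase, Set.mem_prod]
      constructor
      · intro h
        refine ⟨fun i hi => ?_, by simpa using h n hn⟩
        simpa [Function.update_of_ne hi.1] using h i hi.2
      · rintro ⟨h1, h2⟩ i hi
        by_cases hin : i = n
        · subst hin; simpa using h2
        · simpa [Function.update_of_ne hin] using h1 i ⟨hin, hi⟩
    rw [e, Measure.prod_prod, Measure.infinitePi_pi _ (fun i _ => ht i),
      Finset.prod_erase_mul _ _ hn]
  · have e : (fun p : (ℕ → Ω) × Ω => Function.update p.1 n p.2) ⁻¹' (Set.pi s t) =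
        (Set.pi s t) ×ˢ Set.univ := by
      ext p
      simp only [Set.mem_preimage, Set.mem_pi, Finset.mem_coe, Set.mem_prod, Set.mem_univ, and_true]
      refine forall₂_congr fun i hi => ?_
      rw [Function.update_of_ne (fun h : i = n => hn (h ▸ hi))]
    rw [e, Measure.prod_prod, Measure.infinitePi_pi _ (fun i _ => ht i), measure_univ, mul_one]

theorem lintegral_update (n : ℕ) {G : (ℕ → Ω) → ℝ≥0∞} (hG : Measurable G) :
    ∫⁻ ω, G ω ∂(Measure.infinitePi fun _ : ℕ => η) =
      ∫⁻ ω, ∫⁻ z, G (Function.update ω n z) ∂η ∂(Measure.infinitePi fun _ : ℕ => η) := by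
  have hp := measurePreserving_update η n
  rw [← hp.lintegral_comp hG]
  exact lintegral_prod _ (hG.comp hp.measurable).aemeasurable

theorem integral_update (n : ℕ) {G : (ℕ → Ω) → ℝ} (hG : Measurable G) {C : ℝ}
    (hC : ∀ ω, |G ω| ≤ C) :
    ∫ ω, G ω ∂(Measure.infinitePi fun _ : ℕ => η) =
      ∫ ω, ∫ z, G (Function.update ω n z) ∂η ∂(Measure.infinitePi fun _ : ℕ => η) := by
  have hp := measurePreserving_update η n
  have hm : Measurable fun p : (ℕ → Ω) × Ω => G (Function.update p.1 n p.2) :=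
    hG.comp hp.measurable
  rw [← hp.map_eq, integral_map hp.measurable.aemeasurable hG.aestronglyMeasurable, hp.map_eq]
  exact integral_prod _ (Integrable.of_bound hm.aestronglyMeasurable C
    (Eventually.of_forall fun p => hC _))

theorem integral_path_update (ν : Measure S) [IsProbabilityMeasure ν] (n : ℕ)
    {G : (ℕ → Ω) × S → ℝ} (hG : Measurable G) {C : ℝ} (hC : ∀ p, |G p| ≤ C) :
    ∫ p, G p ∂(pathMeasure η ν) =
      ∫ p, ∫ z, G (Function.update p.1 n z, p.2) ∂η ∂(pathMeasure η ν) := by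
  have hm : Measurable fun q : ((ℕ → Ω) × S) × Ω => G (Function.update q.1.1 n q.2, q.1.2) := by
    refine hG.comp (Measurable.prodMk ?_ (measurable_snd.comp measurable_fst))
    exact (measurePreserving_update η n).measurable.comp
      ((measurable_fst.comp measurable_fst).prodMk measurable_snd)
  have hm2 : StronglyMeasurable fun p : (ℕ → Ω) × S =>
      ∫ z, G (Function.update p.1 n z, p.2) ∂η :=
    StronglyMeasurable.integral_prod_right (f := fun (p : (ℕ → Ω) × S) z =>
      G (Function.update p.1 n z, p.2)) hm.stronglyMeasurable
  unfold pathMeasure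
  rw [integral_prod_symm _ (Integrable.of_bound hG.aestronglyMeasurable C
    (Eventually.of_forall hC)), integral_prod_symm]
  · congr 1; ext x
    exact integral_update η n (hG.comp measurable_prodMk_right) (fun ω => hC _)
  · refine Integrable.of_bound hm2.aestronglyMeasurable C (Eventually.of_forall fun p => ?_)
    simpa using norm_integral_le_of_norm_le_const (μ := η) (C := C)
      (f := fun z => G (Function.update p.1 n z, p.2)) (Eventually.of_forall fun z => hC _)

end Update

/-! ### Moments of inverse dilation and distortion along random compositions -/

section Chain

variable {Ω : Type*} {T : Ω → S → S}

theorem chain_update {k n : ℕ} (hk : k ≤ n) (ω : ℕ → Ω) (z : Ω) (x : S) :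
    chain T k (Function.update ω n z) x = chain T k ω x := by
  induction k with
  | zero => rfl
  | succ k ih =>
    simp only [chain]
    rw [ih (by omega), Function.update_of_ne (by omega)]

theorem chain_succ_update (n : ℕ) (ω : ℕ → Ω) (z : Ω) (x : S) :
    chain T (n + 1) (Function.update ω n z) x = T z (chain T n ω x) := by
  simp only [chain, Function.update_self, chain_update le_rfl]

theorem measurable_chain [MeasurableSpace Ω] (hT : Measurable fun p : Ω × S => T p.1 p.2) (n : ℕ) :
    Measurable fun p : (ℕ → Ω) × S => chain T n p.1 p.2 := by
  induction n with
  | zero => exact measurable_snd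
  | succ n ih =>
    exact hT.comp (((measurable_pi_apply n).comp measurable_fst).prodMk ih)

/-- The product of the bounds `a` on the inverse derivatives along a path. -/
def invDilationBound (a : Ω → ℝ) : ℕ → (ℕ → Ω) → ℝ
  | 0, _ => 1
  | n + 1, ω => a (ω n) * invDilationBound a n ω

/-- The bound on the distortion of a composition along a path. -/
def distortionBound (a D : Ω → ℝ) : ℕ → (ℕ → Ω) → ℝ
  | 0, _ => 0
  | n + 1, ω => D (ω n) + a (ω n) * distortionBound a D n ω

variable {a D : Ω → ℝ}

theorem hasBounds_chain (hT : ∀ ω, HasBounds (T ω) (a ω) (D ω)) (n : ℕ) (ω : ℕ → Ω) :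
    HasBounds (chain T n ω) (invDilationBound a n ω) (distortionBound a D n ω) := by
  induction n with
  | zero => exact hasBounds_id
  | succ n ih => exact (hT (ω n)).comp ih

theorem invDilationBound_update {k n : ℕ} (hk : k ≤ n) (ω : ℕ → Ω) (z : Ω) :
    invDilationBound a k (Function.update ω n z) = invDilationBound a k ω := by
  induction k with
  | zero => rfl
  | succ k ih =>
    simp only [invDilationBound]
    rw [ih (by omega), Function.update_of_ne (by omega)]

theorem distortionBound_update {k n : ℕ} (hk : k ≤ n) (ω : ℕ → Ω) (z : Ω) :
    distortionBound a D k (Function.update ω n z) = distortionBound a D k ω := by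
  induction k with
  | zero => rfl
  | succ k ih =>
    simp only [distortionBound]
    rw [ih (by omega), Function.update_of_ne (by omega)]

variable [MeasurableSpace Ω]

theorem measurable_invDilationBound (ha : Measurable a) (n : ℕ) :
    Measurable (invDilationBound a n) := by
  induction n with
  | zero => exact measurable_const
  | succ n ih => exact (ha.comp (measurable_pi_apply n)).mul ih

theorem measurable_distortionBound (ha : Measurable a) (hD : Measurable D) (n : ℕ) :
    Measurable (distortionBound a D n) := by
  induction n with
  | zero => exact measurable_const
  | succ n ih =>
    exact (hD.comp (measurable_pi_apply n)).add ((ha.comp (measurable_pi_apply n)).mul ih)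

variable (η : Measure Ω) [IsProbabilityMeasure η]

theorem lintegral_invDilationBound_sq (ha : Measurable a) (n : ℕ) :
    ∫⁻ ω, ENNReal.ofReal (invDilationBound a n ω ^ 2) ∂(Measure.infinitePi fun _ : ℕ => η) =
      (∫⁻ ω, ENNReal.ofReal (a ω ^ 2) ∂η) ^ n := by
  induction n with
  | zero => simp [invDilationBound]
  | succ n ih =>
    rw [lintegral_update η n ((measurable_invDilationBound ha (n + 1)).pow_const 2).ennreal_ofReal]
    simp only [invDilationBound, Function.update_self, invDilationBound_update le_rfl, mul_pow]
    simp_rw [ENNReal.ofReal_mul (sq_nonneg _)]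
    simp_rw [lintegral_mul_const _ (ha.pow_const 2).ennreal_ofReal]
    rw [lintegral_const_mul _ ((measurable_invDilationBound ha n).pow_const 2).ennreal_ofReal, ih,
      pow_succ, mul_comm]

/-- The recursion is `D_{n+1} = D + a D_n` with the new pair `(a, D)` independent of `D_n`. A
weighted Young inequality `(D + y)² ≤ (1 + 1/s) D² + (1 + s) y²` turns it into an affine recursion
for second moments, contracting because the second moment `q` of `a` is less than one. -/
theorem exists_lintegral_distortionBound_sq_le (ha : Measurable a) (hD : Measurable D)
    (ha2 : ∫⁻ ω, ENNReal.ofReal (a ω ^ 2) ∂η < 1) (hD2 : ∫⁻ ω, ENNReal.ofReal (D ω ^ 2) ∂η < ∞) :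
    ∃ R : ℝ, 0 ≤ R ∧ ∀ n, ∫⁻ ω, ENNReal.ofReal (distortionBound a D n ω ^ 2)
      ∂(Measure.infinitePi fun _ : ℕ => η) ≤ ENNReal.ofReal R := by
  set q := (∫⁻ ω, ENNReal.ofReal (a ω ^ 2) ∂η).toReal with hq
  set d := (∫⁻ ω, ENNReal.ofReal (D ω ^ 2) ∂η).toReal with hd
  have hqe : ∫⁻ ω, ENNReal.ofReal (a ω ^ 2) ∂η = ENNReal.ofReal q :=
    (ENNReal.ofReal_toReal (ha2.trans ENNReal.one_lt_top).ne).symm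
  have hde : ∫⁻ ω, ENNReal.ofReal (D ω ^ 2) ∂η = ENNReal.ofReal d :=
    (ENNReal.ofReal_toReal hD2.ne).symm
  have hq0 : 0 ≤ q := ENNReal.toReal_nonneg
  have hd0 : 0 ≤ d := ENNReal.toReal_nonneg
  have hq1 : q < 1 := by
    rw [hqe] at ha2
    exact ENNReal.ofReal_lt_one.1 ha2
  -- Small enough that `(1 + s) * q < 1`; the number `R` below is the fixed point of `x ↦ (1 + 1 /
  -- s) * d + (1 + s) * q * x`.
  set s := (1 - q) / 2 with hs
  have hs0 : 0 < s := by rw [hs]; linarith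
  have hr : (1 + s) * q < 1 := by rw [hs]; nlinarith
  set R := (1 + 1 / s) * d / (1 - (1 + s) * q) with hR
  have hR0 : 0 ≤ R := div_nonneg (by positivity) (by linarith)
  have hRe : (1 + 1 / s) * d + (1 + s) * q * R = R := by
    rw [hR]; field_simp [(by linarith : (1 - (1 + s) * q) ≠ 0)]; ring
  refine ⟨R, hR0, fun n => ?_⟩
  induction n with
  | zero => simp [distortionBound]
  | succ n ih =>
    have hpt : ∀ (ω : ℕ → Ω) (z : Ω),
        ENNReal.ofReal (distortionBound a D (n + 1) (Function.update ω n z) ^ 2) ≤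
        ENNReal.ofReal (1 + 1 / s) * ENNReal.ofReal (D z ^ 2) +
          ENNReal.ofReal ((1 + s) * distortionBound a D n ω ^ 2) * ENNReal.ofReal (a z ^ 2) := by
      intro ω z
      simp only [distortionBound, Function.update_self, distortionBound_update le_rfl]
      rw [← ENNReal.ofReal_mul (by positivity), ← ENNReal.ofReal_mul (by positivity),
        ← ENNReal.ofReal_add (by positivity) (by positivity)]
      refine ENNReal.ofReal_le_ofReal ?_
      set y := a z * distortionBound a D n ω
      have h1 : 0 ≤ (1 / s) * (D z - s * y) ^ 2 := by positivity
      have h2 : (1 / s) * (D z - s * y) ^ 2 = (1 / s) * D z ^ 2 - 2 * D z * y + s * y ^ 2 := by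
        field_simp; ring
      have h3 : (1 + s) * distortionBound a D n ω ^ 2 * a z ^ 2 = (1 + s) * y ^ 2 := by
        simp only [y]; ring
      rw [h3]
      nlinarith
    rw [lintegral_update η n
      ((measurable_distortionBound ha hD (n + 1)).pow_const 2).ennreal_ofReal]
    calc _ ≤ ∫⁻ ω, ∫⁻ z, (ENNReal.ofReal (1 + 1 / s) * ENNReal.ofReal (D z ^ 2) +
          ENNReal.ofReal ((1 + s) * distortionBound a D n ω ^ 2) * ENNReal.ofReal (a z ^ 2)) ∂η
          ∂(Measure.infinitePi fun _ : ℕ => η) :=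
          lintegral_mono fun ω => lintegral_mono fun z => hpt ω z
      _ = ∫⁻ ω, (ENNReal.ofReal ((1 + 1 / s) * d) +
          ENNReal.ofReal ((1 + s) * q) * ENNReal.ofReal (distortionBound a D n ω ^ 2))
          ∂(Measure.infinitePi fun _ : ℕ => η) := by
          congr 1; ext ω
          rw [lintegral_add_left ((hD.pow_const 2).ennreal_ofReal.const_mul _),
            lintegral_const_mul _ (hD.pow_const 2).ennreal_ofReal,
            lintegral_const_mul _ (ha.pow_const 2).ennreal_ofReal, hqe, hde,
            ← ENNReal.ofReal_mul (by positivity), ← ENNReal.ofReal_mul (by positivity),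
            ← ENNReal.ofReal_mul (by positivity)]
          congr 2; ring
      _ = ENNReal.ofReal ((1 + 1 / s) * d) + ENNReal.ofReal ((1 + s) * q) *
          ∫⁻ ω, ENNReal.ofReal (distortionBound a D n ω ^ 2)
            ∂(Measure.infinitePi fun _ : ℕ => η) := by
          rw [lintegral_add_left measurable_const, lintegral_const_mul _
            ((measurable_distortionBound ha hD n).pow_const 2).ennreal_ofReal]
          simp
      _ ≤ ENNReal.ofReal ((1 + 1 / s) * d) + ENNReal.ofReal ((1 + s) * q) * ENNReal.ofReal R := by
          gcongr
      _ = ENNReal.ofReal R := by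
          rw [← ENNReal.ofReal_mul (by positivity), ← ENNReal.ofReal_add (by positivity)
            (by positivity), hRe]

theorem integrable_and_integral_le {Y : Type*} [MeasurableSpace Y] {ν : Measure Y} {f : Y → ℝ}
    (hf : Measurable f) (h0 : ∀ y, 0 ≤ f y) {R : ℝ} (hR : 0 ≤ R)
    (h : ∫⁻ y, ENNReal.ofReal (f y) ∂ν ≤ ENNReal.ofReal R) :
    Integrable f ν ∧ ∫ y, f y ∂ν ≤ R := by
  refine ⟨⟨hf.aestronglyMeasurable, ?_⟩, ?_⟩
  · rw [hasFiniteIntegral_iff_ofReal (Eventually.of_forall h0)]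
    exact h.trans_lt ENNReal.ofReal_lt_top
  · rw [integral_eq_lintegral_of_nonneg_ae (Eventually.of_forall h0) hf.aestronglyMeasurable]
    exact ENNReal.toReal_le_of_le_ofReal hR h

end Chain

/-! ### The Markov operator on continuous functions -/

/-- A jointly measurable family of continuous circle maps. -/
structure IsRandomMap {Ω : Type*} [MeasurableSpace Ω] (T : Ω → S → S) : Prop where
  measurable : Measurable fun p : Ω × S => T p.1 p.2
  continuous : ∀ ω, Continuous (T ω)

instance isProbabilityMeasure_volume : IsProbabilityMeasure (volume : Measure S) :=
  ⟨UnitAddCircle.measure_univ⟩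

/-- Integration against a continuous density. -/
noncomputable def pairing (h : C(S, ℝ)) : C(S, ℝ) →L[ℝ] ℝ :=
  LinearMap.mkContinuous
    { toFun := fun φ => ∫ x, h x * φ x
      map_add' := fun φ ψ => by
        simp only [ContinuousMap.add_apply, mul_add]
        exact integral_add (integrable_of_continuous (by fun_prop))
          (integrable_of_continuous (by fun_prop))
      map_smul' := fun c φ => by
        simp only [ContinuousMap.smul_apply, smul_eq_mul, RingHom.id_apply]
        rw [← integral_const_mul]
        congr 1; ext x; ring } ‖h‖ fun φ => by
    change |∫ x, h x * φ x| ≤ _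
    rw [← integral_const_volume (‖h‖ * ‖φ‖)]
    refine abs_integral_le_integral continuous_const fun x => ?_
    rw [abs_mul]
    exact mul_le_mul (h.norm_coe_le_norm x) (φ.norm_coe_le_norm x) (abs_nonneg _) (norm_nonneg _)

theorem pairing_apply (h φ : C(S, ℝ)) : pairing h φ = ∫ x, h x * φ x := rfl

theorem pairing_comm (h φ : C(S, ℝ)) : pairing h φ = pairing φ h := by
  simp only [pairing_apply, mul_comm]

theorem pairing_add_left (h h' φ : C(S, ℝ)) : pairing (h + h') φ = pairing h φ + pairing h' φ := by
  rw [pairing_comm, map_add, pairing_comm, pairing_comm h']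

theorem pairing_sub_left (h h' φ : C(S, ℝ)) : pairing (h - h') φ = pairing h φ - pairing h' φ := by
  rw [pairing_comm, map_sub, pairing_comm, pairing_comm h']

theorem pairing_smul_left (c : ℝ) (h φ : C(S, ℝ)) : pairing (c • h) φ = c * pairing h φ := by
  rw [pairing_comm, map_smul, pairing_comm, smul_eq_mul]

theorem pairing_one_left (φ : C(S, ℝ)) : pairing 1 φ = ∫ x, φ x := by simp [pairing_apply]

/-- A lower bound in the weak sense is a pointwise lower bound. -/
theorem le_of_forall_le_pairing {h : C(S, ℝ)} {c : ℝ}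
    (H : ∀ φ : C(S, ℝ), (∀ x, 0 ≤ φ x) → c * ∫ x, φ x ≤ pairing h φ) (x : S) : c ≤ h x := by
  -- Testing against the negative part of `h - c` turns the hypothesis into `∫ φ² ≤ 0`.
  let φ : C(S, ℝ) := ⟨fun x => max 0 (c - h x), by fun_prop⟩
  have h1 := H φ fun x => le_max_left _ _
  have e : pairing h φ - c * ∫ x, φ x = -∫ x, φ x * φ x := by
    rw [pairing_apply, ← integral_const_mul, ← integral_sub (integrable_of_continuous (by fun_prop))
      (integrable_of_continuous (by fun_prop)), ← integral_neg]
    congr 1; ext x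
    simp only [φ, ContinuousMap.coe_mk]
    rcases le_total (c - h x) 0 with hx | hx
    · rw [max_eq_left hx]; ring
    · rw [max_eq_right hx]; ring
  have h2 : ∫ x, φ x * φ x ≤ 0 := by linarith
  by_contra! hlt
  have h3 : 0 < ∫ x, φ x * φ x := by
    refine (φ.continuous.mul φ.continuous).integral_pos_of_hasCompactSupport_nonneg_nonzero
      (HasCompactSupport.of_compactSpace _) (fun x => mul_self_nonneg _) (x := x) ?_
    have : 0 < φ x := lt_of_lt_of_le (sub_pos.2 hlt) (le_max_right _ _)
    exact (mul_pos this this).ne'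
  linarith

section Markov

variable {Ω : Type*} [MeasurableSpace Ω] {T : Ω → S → S}

theorem IsRandomMap.integrable_comp (hT : IsRandomMap T) (η : Measure Ω) [IsProbabilityMeasure η]
    (φ : C(S, ℝ)) (x : S) : Integrable (fun ω => φ (T ω x)) η :=
  Integrable.of_bound (φ.continuous.measurable.comp
    (hT.measurable.comp measurable_prodMk_right)).aestronglyMeasurable ‖φ‖
    (Eventually.of_forall fun _ => φ.norm_coe_le_norm _)

/-- The Markov operator acting on continuous functions. -/
noncomputable def markovCLM (η : Measure Ω) [IsProbabilityMeasure η] (hT : IsRandomMap T) :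
    C(S, ℝ) →L[ℝ] C(S, ℝ) :=
  LinearMap.mkContinuous
    { toFun := fun φ => ⟨markovOp η T φ, continuous_of_dominated (bound := fun _ => ‖φ‖)
        (fun x => (hT.integrable_comp η φ x).aestronglyMeasurable)
        (fun _ => Eventually.of_forall fun _ => φ.norm_coe_le_norm _) (integrable_const _)
        (Eventually.of_forall fun ω => φ.continuous.comp (hT.continuous ω))⟩
      map_add' := fun φ ψ => by
        ext x
        exact integral_add (hT.integrable_comp η φ x) (hT.integrable_comp η ψ x)
      map_smul' := fun c φ => by
        ext x
        exact integral_const_mul c _ } 1 fun φ => by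
    rw [one_mul]
    refine (ContinuousMap.norm_le _ (norm_nonneg _)).2 fun x => ?_
    have := norm_integral_le_of_norm_le_const (μ := η) (C := ‖φ‖) (f := fun ω => φ (T ω x))
      (Eventually.of_forall fun ω => φ.norm_coe_le_norm _)
    simp only [probReal_univ, mul_one] at this
    exact this

variable (η : Measure Ω) [IsProbabilityMeasure η]

theorem markovCLM_apply (hT : IsRandomMap T) (φ : C(S, ℝ)) (x : S) : markovCLM η hT φ x = ∫ ω, φ (T ω x) ∂η := rfl

theorem markovCLM_one (hT : IsRandomMap T) : markovCLM η hT 1 = 1 := by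
  ext x; simp [markovCLM_apply]

theorem markovCLM_nonneg (hT : IsRandomMap T) {φ : C(S, ℝ)} (hφ : ∀ x, 0 ≤ φ x) (x : S) : 0 ≤ markovCLM η hT φ x :=
  integral_nonneg fun _ => hφ _

theorem norm_markovCLM_apply_le (hT : IsRandomMap T) (φ : C(S, ℝ)) : ‖markovCLM η hT φ‖ ≤ ‖φ‖ := by
  refine ((markovCLM η hT).le_of_opNorm_le 
    (LinearMap.mkContinuous_norm_le _ zero_le_one _) φ).trans ?_
  rw [one_mul]

theorem integrable_mul_comp (hT : IsRandomMap T) (ν : Measure S) [IsProbabilityMeasure ν] (h φ : C(S, ℝ)) :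
    Integrable (fun p : S × Ω => h p.1 * φ (T p.2 p.1)) (ν.prod η) := by
  refine Integrable.of_bound (Measurable.aestronglyMeasurable ?_) (‖h‖ * ‖φ‖)
    (Eventually.of_forall fun p => ?_)
  · exact (h.continuous.measurable.comp measurable_fst).mul
      (φ.continuous.measurable.comp (hT.measurable.comp measurable_swap))
  · rw [norm_mul]
    exact mul_le_mul (h.norm_coe_le_norm _) (φ.norm_coe_le_norm _) (norm_nonneg _) (norm_nonneg _)

theorem pairing_markovCLM (hT : IsRandomMap T) (h φ : C(S, ℝ)) :
    pairing h (markovCLM η hT φ) = ∫ ω, (∫ x, h x * φ (T ω x)) ∂η := by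
  rw [pairing_apply]
  simp only [markovCLM_apply, ← integral_const_mul]
  exact integral_integral_swap (integrable_mul_comp η hT volume h φ)

theorem integrable_integral_mul_comp (hT : IsRandomMap T) (h φ : C(S, ℝ)) :
    Integrable (fun ω => ∫ x, h x * φ (T ω x)) η :=
  (integrable_mul_comp η hT volume h φ).integral_prod_right

/-- The `n`-fold composition is again a random map, with parameter in the sequence space, so results
about one step apply to `n` steps. -/
theorem IsRandomMap.chain (hT : IsRandomMap T) (n : ℕ) : IsRandomMap (chain T n) := by
  refine ⟨measurable_chain hT.measurable n, fun ω => ?_⟩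
  induction n with
  | zero => exact continuous_id
  | succ n ih => exact (hT.continuous (ω n)).comp ih

/-- The map applied last depends on a coordinate independent of the others; integrating it out
replaces `φ` by its image under the one-step operator. -/
theorem markovCLM_chain (hT : IsRandomMap T) (n : ℕ) (φ : C(S, ℝ)) :
    markovCLM (Measure.infinitePi fun _ : ℕ => η) (hT.chain n) φ = (markovCLM η hT ^ n) φ := by
  induction n generalizing φ with
  | zero =>
    ext x
    simp [markovCLM_apply, chain]
  | succ n ih =>
    rw [pow_succ, mul_apply_eq_comp, ← ih]
    ext x
    rw [markovCLM_apply, markovCLM_apply, integral_update η n (C := ‖φ‖)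
      (G := fun ω => φ (RandomCircle.chain T (n + 1) ω x))
      (φ.continuous.measurable.comp ((hT.chain (n + 1)).measurable.comp measurable_prodMk_right))
      (fun ω => φ.norm_coe_le_norm _)]
    simp only [chain_succ_update]
    rfl

end Markov

/-! ### The dual action on densities -/

/-- `h'` is the density obtained from `h` by the dual of `Q`. -/
def IsTransfer (Q : C(S, ℝ) →L[ℝ] C(S, ℝ)) (h h' : C(S, ℝ)) : Prop :=
  ∀ φ, pairing h' φ = pairing h (Q φ)

theorem IsExpandingOnAverage.isRandomMap {Ω : Type*} [MeasurableSpace Ω] {η : Measure Ω}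
    {T : Ω → S → S} (hT : IsExpandingOnAverage η T) : IsRandomMap T :=
  ⟨hT.measurable, fun ω => (hT.smooth ω).hasBounds.continuous⟩

section Random

variable {Ω : Type*} [MeasurableSpace Ω] {T : Ω → S → S} (η : Measure Ω) [IsProbabilityMeasure η]

/-- The Lasota–Yorke inequality. -/
theorem exists_transfer_density (hT : IsRandomMap T) {a D : Ω → ℝ}
    (hb : ∀ ω, HasBounds (T ω) (a ω) (D ω)) (ia : Integrable (fun ω => a ω ^ 2) η)
    (iD : Integrable (fun ω => D ω ^ 2) η) {α R : ℝ} (hα : ∫ ω, a ω ^ 2 ∂η ≤ α)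
    (hR : ∫ ω, D ω ^ 2 ∂η ≤ R) {s : ℝ} (hs : 0 < s) {L : ℝ} (hL : 0 ≤ L) {h : C(S, ℝ)}
    (hh : IsDensity L h) :
    ∃ h', IsDensity (L * (α / (2 * s) + s * (1 + 4 * R)) + (1 + 2 * R)) h' ∧
      IsTransfer (markovCLM η hT) h h' := by
  have hα0 : 0 ≤ α := (integral_nonneg fun _ => sq_nonneg _).trans hα
  have hR0 : 0 ≤ R := (integral_nonneg fun _ => sq_nonneg _).trans hR
  set L' := L * (α / (2 * s) + s * (1 + 4 * R)) + (1 + 2 * R) with hL'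
  have hL'0 : 0 ≤ L' := by positivity
  have hweak : ∀ (φ : S → ℝ) (φ' : C(S, ℝ)), CircDeriv φ φ' →
      |((pairing h).comp (markovCLM η hT)) φ'| ≤ L' * ∫ x, |φ x| := by
    intro φ φ' hφ
    have hφ0 : 0 ≤ ∫ x, |φ x| := integral_nonneg fun _ => abs_nonneg _
    let W : Ω → ℝ := fun ω => L * (a ω ^ 2 * (1 / (2 * s)) + s * (1 + 4 * D ω ^ 2)) +
      (1 + 2 * D ω ^ 2)
    have iW1 : Integrable (fun ω => a ω ^ 2 * (1 / (2 * s))) η := ia.mul_const _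
    have iW2 : Integrable (fun ω => s * (1 + 4 * D ω ^ 2)) η :=
      ((integrable_const _).add (iD.const_mul 4)).const_mul s
    have iW3 : Integrable (fun ω => 1 + 2 * D ω ^ 2) η := (integrable_const _).add (iD.const_mul 2)
    have iW : Integrable W η := ((iW1.add iW2).const_mul L).add iW3
    have eW : ∫ ω, W ω ∂η ≤ L' := by
      have e1 : ∫ ω, W ω ∂η = L * ((∫ ω, a ω ^ 2 ∂η) * (1 / (2 * s)) +
          s * (1 + 4 * ∫ ω, D ω ^ 2 ∂η)) + (1 + 2 * ∫ ω, D ω ^ 2 ∂η) := by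
        simp only [W]
        rw [integral_add (by exact (iW1.add iW2).const_mul L) iW3, integral_const_mul,
          integral_add iW1 iW2, integral_mul_const, integral_const_mul,
          integral_add (integrable_const _) (iD.const_mul 4),
          integral_add (integrable_const _) (iD.const_mul 2), integral_const_mul,
          integral_const_mul]
        simp
      rw [e1, hL', div_eq_mul_one_div α]
      gcongr
    rw [ContinuousLinearMap.comp_apply, pairing_markovCLM]
    refine le_trans ?_ (mul_le_mul_of_nonneg_right eW hφ0)
    rw [← integral_mul_const, ← Real.norm_eq_abs]
    refine norm_integral_le_of_norm_le (iW.mul_const _) (Eventually.of_forall fun ω => ?_)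
    refine ((hb ω).abs_integral_deriv_comp_le hL hh hφ φ'.continuous).trans ?_
    refine mul_le_mul_of_nonneg_right ?_ hφ0
    -- `a` and `D` come from the same map and need not be independent. Young's inequality with a
    -- free weight `s` separates them into second moments.
    have y1 : a ω * (1 + 2 * D ω) ≤ a ω ^ 2 * (1 / (2 * s)) + s * (1 + 4 * D ω ^ 2) := by
      have k1 : 0 ≤ (1 / (2 * s)) * (a ω - s * (1 + 2 * D ω)) ^ 2 := by positivity
      have k2 : (1 / (2 * s)) * (a ω - s * (1 + 2 * D ω)) ^ 2 = a ω ^ 2 * (1 / (2 * s)) -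
          a ω * (1 + 2 * D ω) + s * ((1 + 2 * D ω) ^ 2 / 2) := by field_simp; ring
      have k3 : (1 + 2 * D ω) ^ 2 / 2 ≤ 1 + 4 * D ω ^ 2 := by nlinarith [sq_nonneg (1 - 2 * D ω)]
      have k4 := mul_le_mul_of_nonneg_left k3 hs.le
      linarith
    have y2 : D ω * (1 + D ω) ≤ 1 + 2 * D ω ^ 2 := by nlinarith [sq_nonneg (1 - D ω)]
    exact add_le_add (mul_le_mul_of_nonneg_left y1 hL) y2
  obtain ⟨h', hlip, hrep⟩ := exists_lipschitz_density ((pairing h).comp (markovCLM η hT)) hL'0 hweak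
  have htr : IsTransfer (markovCLM η hT) h h' := fun φ => (hrep φ).symm
  refine ⟨h', ⟨fun x => ?_, ?_, hlip⟩, htr⟩
  · refine le_of_forall_le_pairing (c := 0) (fun φ hφ => ?_) x
    rw [zero_mul, htr φ]
    exact integral_nonneg fun x => mul_nonneg (hh.nonneg x) (markovCLM_nonneg η hT hφ x)
  · have := htr 1
    rw [markovCLM_one, pairing_comm, pairing_one_left, pairing_comm, pairing_one_left,
      hh.mass] at this
    exact this

/-- Densities with a given Lipschitz constant acquire a uniform lower bound, if the maps stretch
enough with positive probability. -/
theorem exists_lower_bound_transfer (hT : IsRandomMap T) {a D : Ω → ℝ}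
    (hb : ∀ ω, HasBounds (T ω) (a ω) (D ω)) {K : ℝ} (hK : 1 ≤ K)
    (hpos : η {ω | a ω ≤ 1 / (2 * K)} ≠ 0) :
    ∃ c : ℝ, 0 < c ∧ ∀ h h' : C(S, ℝ), IsDensity K h → IsTransfer (markovCLM η hT) h h' →
      ∀ x, c ≤ h' x := by
  -- For each map, `|w|` has a positive minimum, but not uniformly in `ω`. Countable subadditivity
  -- yields one lower bound valid on a set of positive outer measure; only monotonicity of the
  -- measure is used afterwards, so `E m` need not be measurable.
  let E : ℕ → Set Ω := fun m => {ω | ∃ w κ : C(S, ℝ), IsLocalDiffeo (T ω) w κ ∧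
    (∀ x, |w x| ≤ 1 / (2 * K)) ∧ ∀ x, 1 / ((m : ℝ) + 1) ≤ |w x|}
  have hE : {ω | a ω ≤ 1 / (2 * K)} ⊆ ⋃ m, E m := by
    intro ω hω
    obtain ⟨w, κ, d, hw, -⟩ := hb ω
    obtain ⟨x₀, -, hx₀⟩ := isCompact_univ.exists_isMinOn (Set.univ_nonempty (α := S))
      (w.continuous.abs).continuousOn
    obtain ⟨m, hm⟩ := exists_nat_one_div_lt (abs_pos.2 (d.ne_zero x₀))
    exact Set.mem_iUnion.2 ⟨m, w, κ, d, fun x => (hw x).trans hω,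
      fun x => hm.le.trans (hx₀ (Set.mem_univ x))⟩
  obtain ⟨m, hm⟩ := exists_measure_pos_of_not_measure_iUnion_null
    (fun h0 => hpos (measure_mono_null hE h0))
  set b : ℝ := 1 / ((m : ℝ) + 1) with hbdef
  have hb0 : 0 < b := by positivity
  have hmr : 0 < η.real (E m) := ENNReal.toReal_pos hm.ne' (measure_ne_top _ _)
  refine ⟨b / 2 * η.real (E m), by positivity, fun h h' hh htr => ?_⟩
  refine le_of_forall_le_pairing fun φ hφ => ?_
  rw [htr φ, pairing_markovCLM]
  have hg0 : ∀ ω, 0 ≤ ∫ x, h x * φ (T ω x) := fun ω =>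
    integral_nonneg fun x => mul_nonneg (hh.nonneg x) (hφ _)
  have key := mul_meas_ge_le_integral_of_nonneg (μ := η) (Eventually.of_forall hg0)
    (integrable_integral_mul_comp η hT h φ) (b / 2 * ∫ x, φ x)
  refine le_trans ?_ key
  have hsub : E m ⊆ {ω | b / 2 * ∫ x, φ x ≤ ∫ x, h x * φ (T ω x)} := by
    rintro ω ⟨w, κ, d, hw, hbw⟩
    exact d.le_integral_comp hK hh hw hb0.le hbw φ.continuous hφ
  have hmono : η.real (E m) ≤ η.real {ω | b / 2 * ∫ x, φ x ≤ ∫ x, h x * φ (T ω x)} :=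
    measureReal_mono hsub
  have hφi : 0 ≤ ∫ x, φ x := integral_nonneg hφ
  calc b / 2 * η.real (E m) * ∫ x, φ x = (b / 2 * ∫ x, φ x) * η.real (E m) := by ring
    _ ≤ _ := by gcongr

/-- What the transfer operator does to Lipschitz densities: uniform Lipschitz bounds for all
iterates, and a lower bound together with a Lasota–Yorke contraction for one of them. -/
structure HasDoeblin (Q : C(S, ℝ) →L[ℝ] C(S, ℝ)) (A B K c : ℝ) (N : ℕ) : Prop where
  one_le_A : 1 ≤ A
  B_nonneg : 0 ≤ B
  one_le_K : 1 ≤ K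
  B_le_K : B ≤ K
  c_pos : 0 < c
  c_le : c ≤ 1 / 4
  N_pos : 0 < N
  map_one : Q 1 = 1
  positive : ∀ φ : C(S, ℝ), (∀ x, 0 ≤ φ x) → ∀ x, 0 ≤ Q φ x
  iterate : ∀ (n : ℕ) (L : ℝ) (h : C(S, ℝ)), 0 ≤ L → IsDensity L h →
    ∃ h', IsDensity (A * L + B) h' ∧ IsTransfer (Q ^ n) h h'
  contract : ∀ h : C(S, ℝ), IsDensity K h →
    ∃ h', IsDensity (3 / 4 * K) h' ∧ IsTransfer (Q ^ N) h h' ∧ ∀ x, c ≤ h' x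

/-- For `N` steps the factor of the Lipschitz constant is `q ^ N / (2 * s) + s * (1 + 4 * R)`.
Because `R` bounds the distortion moments for all `N` at once, `s` can be fixed before `N`. The same
decay of `q ^ N` forces strong stretching with positive probability, whence the lower bound. -/
theorem IsExpandingOnAverage.exists_hasDoeblin (hT : IsExpandingOnAverage η T) :
    ∃ (A B K c : ℝ) (N : ℕ), HasDoeblin (markovCLM η (hT.isRandomMap)) A B K c N := by
  have hr := hT.isRandomMap
  let a : Ω → ℝ := fun ω => (dilation (T ω))⁻¹
  let D : Ω → ℝ := fun ω => distortion (T ω)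
  have ma : Measurable a := (measurable_dilation hT.measurable hT.smooth).inv
  have mD : Measurable D := measurable_distortion hT.measurable hT.smooth
  have hb : ∀ ω, HasBounds (T ω) (a ω) (D ω) := fun ω => (hT.smooth ω).hasBounds
  have ha2 : ∫⁻ ω, ENNReal.ofReal (a ω ^ 2) ∂η < 1 := by
    simpa only [a, inv_pow] using hT.dilation_moment
  have hD2 : ∫⁻ ω, ENNReal.ofReal (D ω ^ 2) ∂η < ∞ := hT.distortion_moment
  obtain ⟨R, hR0, hR⟩ := exists_lintegral_distortionBound_sq_le η ma mD ha2 hD2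
  set P := Measure.infinitePi fun _ : ℕ => η
  set q := (∫⁻ ω, ENNReal.ofReal (a ω ^ 2) ∂η).toReal with hq
  have hqe : ∫⁻ ω, ENNReal.ofReal (a ω ^ 2) ∂η = ENNReal.ofReal q :=
    (ENNReal.ofReal_toReal (ha2.trans ENNReal.one_lt_top).ne).symm
  have hq0 : 0 ≤ q := ENNReal.toReal_nonneg
  have hq1 : q < 1 := by
    rw [hqe] at ha2
    exact ENNReal.ofReal_lt_one.1 ha2
  have Ma : ∀ n, Integrable (fun ω => invDilationBound a n ω ^ 2) P ∧
      ∫ ω, invDilationBound a n ω ^ 2 ∂P ≤ q ^ n := fun n =>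
    integrable_and_integral_le ((measurable_invDilationBound ma n).pow_const 2)
      (fun _ => sq_nonneg _) (pow_nonneg hq0 n)
      (by rw [lintegral_invDilationBound_sq η ma n, hqe, ENNReal.ofReal_pow hq0])
  have MD : ∀ n, Integrable (fun ω => distortionBound a D n ω ^ 2) P ∧
      ∫ ω, distortionBound a D n ω ^ 2 ∂P ≤ R := fun n =>
    integrable_and_integral_le ((measurable_distortionBound ma mD n).pow_const 2)
      (fun _ => sq_nonneg _) hR0 (hR n)
  set B := 1 + 2 * R with hB
  set K := 4 * B with hK
  have hK1 : 1 ≤ K := by rw [hK, hB]; linarith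
  -- This makes `s * (1 + 4 * R)` equal to `1 / 8`; then `N` makes `q ^ N / (2 * s)` at most `1 / 8`
  -- and the second moment of the inverse dilation less than `(1 / (2 * K)) ^ 2`.
  set s := 1 / (8 * (1 + 4 * R)) with hs
  have hs0 : 0 < s := by positivity
  have hs1 : s * (1 + 4 * R) = 1 / 8 := by rw [hs]; field_simp
  obtain ⟨n₀, hn₀⟩ := exists_pow_lt_of_lt_one
    (lt_min (by positivity : 0 < s / 4) (by positivity : 0 < (1 / (2 * K)) ^ 2)) hq1
  set N := n₀ + 1 with hN
  have hqN : q ^ N ≤ q ^ n₀ := pow_le_pow_of_le_one hq0 hq1.le (by omega)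
  have hqN1 : q ^ N < s / 4 := hqN.trans_lt (hn₀.trans_le (min_le_left _ _))
  have hqN2 : q ^ N < (1 / (2 * K)) ^ 2 := hqN.trans_lt (hn₀.trans_le (min_le_right _ _))
  -- Otherwise the second moment of the inverse dilation would be at least `(1 / (2 * K)) ^ 2`.
  have hpos : P {ω | invDilationBound a N ω ≤ 1 / (2 * K)} ≠ 0 := by
    intro h0
    have hae : ∀ᵐ ω ∂P, (1 / (2 * K)) ^ 2 ≤ invDilationBound a N ω ^ 2 := by
      refine measure_mono_null (fun ω hω => ?_) h0
      by_contra hlt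
      simp only [Set.mem_ofPred_eq, not_le] at hlt
      exact hω (by
        change (1 / (2 * K)) ^ 2 ≤ invDilationBound a N ω ^ 2
        gcongr)
    have := integral_mono_ae (integrable_const _) (Ma N).1 hae
    simp only [integral_const, probReal_univ, one_smul] at this
    linarith [(Ma N).2]
  have hbN := fun n => hasBounds_chain hb n
  obtain ⟨c, hc0, hc⟩ := exists_lower_bound_transfer P (hr.chain N) (hbN N) hK1 hpos
  have htrans : ∀ n h h', IsTransfer (markovCLM P (hr.chain n)) h h' ↔
      IsTransfer (markovCLM η hr ^ n) h h' := by
    intro n h h'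
    refine forall_congr' fun φ => ?_
    rw [markovCLM_chain η hr n φ]
  -- The value `2 + 4 * R` comes from Young's weight `s = 1`, valid for every number of steps.
  -- Capping `c` at `1 / 4` leaves room to renormalize after subtracting it.
  refine ⟨2 + 4 * R, B, K, min c (1 / 4), N, by linarith, by positivity, hK1, by linarith,
    lt_min hc0 (by norm_num), min_le_right _ _, Nat.succ_pos _, markovCLM_one η hr,
    fun φ hφ => markovCLM_nonneg η hr hφ, fun n L h hL hh => ?_, fun h hh => ?_⟩
  · obtain ⟨h', hd, ht⟩ := exists_transfer_density P (hr.chain n) (hbN n) (Ma n).1 (MD n).1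
      ((Ma n).2.trans (pow_le_one₀ hq0 hq1.le)) (MD n).2 one_pos hL hh
    refine ⟨h', hd.mono ?_, (htrans n h h').1 ht⟩
    rw [← hB]
    nlinarith
  · obtain ⟨h', hd, ht⟩ := exists_transfer_density P (hr.chain N) (hbN N) (Ma N).1 (MD N).1
      (Ma N).2 (MD N).2 hs0 (zero_le_one.trans hK1) hh
    refine ⟨h', hd.mono ?_, (htrans N h h').1 ht, fun x => (min_le_left _ _).trans (hc h h' hh ht x)⟩
    rw [hs1, ← hB]
    have : q ^ N / (2 * s) ≤ 1 / 8 := by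
      rw [div_le_iff₀ (by positivity)]; linarith
    have : K * (q ^ N / (2 * s) + 1 / 8) ≤ K * (1 / 4) := by gcongr; linarith
    linarith

end Random

/-! ### Exponential loss of memory -/

section Transfer

variable {Q : C(S, ℝ) →L[ℝ] C(S, ℝ)} {h h' p p' : C(S, ℝ)}

theorem IsTransfer.unique (h₁ : IsTransfer Q h p) (h₂ : IsTransfer Q h p') : p = p' := by
  have key : ∀ u v : C(S, ℝ), (∀ φ, pairing u φ = pairing v φ) → ∀ x, u x ≤ v x := by
    intro u v huv x
    have := le_of_forall_le_pairing (h := v - u) (c := 0) (fun φ _ => by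
      rw [pairing_sub_left, huv φ]; simp) x
    simpa using this
  ext x
  exact le_antisymm (key p p' (fun φ => (h₁ φ).trans (h₂ φ).symm) x)
    (key p' p (fun φ => (h₂ φ).trans (h₁ φ).symm) x)

theorem IsTransfer.add (h₁ : IsTransfer Q h p) (h₂ : IsTransfer Q h' p') :
    IsTransfer Q (h + h') (p + p') := fun φ => by
  rw [pairing_add_left, pairing_add_left, h₁ φ, h₂ φ]

theorem IsTransfer.sub (h₁ : IsTransfer Q h p) (h₂ : IsTransfer Q h' p') :
    IsTransfer Q (h - h') (p - p') := fun φ => by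
  rw [pairing_sub_left, pairing_sub_left, h₁ φ, h₂ φ]

theorem IsTransfer.smul (r : ℝ) (h₁ : IsTransfer Q h p) : IsTransfer Q (r • h) (r • p) := fun φ => by
  rw [pairing_smul_left, pairing_smul_left, h₁ φ]

theorem IsTransfer.comp {j k : ℕ} (h₁ : IsTransfer (Q ^ j) h p) (h₂ : IsTransfer (Q ^ k) p p') :
    IsTransfer (Q ^ (j + k)) h p' := fun φ => by
  rw [h₂ φ, h₁, pow_add, mul_apply_eq_comp]

theorem isTransfer_pow_of_isTransfer (h₁ : IsTransfer Q h h) (k : ℕ) : IsTransfer (Q ^ k) h h := by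
  induction k with
  | zero => intro φ; simp
  | succ k ih =>
    refine ih.comp (k := 1) ?_
    rwa [pow_one]

end Transfer

/-- A function which is Lipschitz up to an error is close to a Lipschitz function. -/
theorem exists_lipschitz_approx (h : C(S, ℝ)) {M ε : ℝ} (hM : 0 ≤ M)
    (hh : ∀ x y, |h x - h y| ≤ ε + M * dist x y) :
    ∃ g : C(S, ℝ), (∀ x y, |g x - g y| ≤ M * dist x y) ∧ ∀ x, |h x - g x| ≤ ε := by
  -- The largest `M`-Lipschitz function below `h`, by inf-convolution.
  let g : S → ℝ := fun x => ⨅ y, (h y + M * dist x y)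
  have hlow : ∀ x y, h x - ε ≤ h y + M * dist x y := fun x y => by
    have := le_abs_self (h x - h y)
    linarith [hh x y]
  have hbdd : ∀ x, BddBelow (Set.range fun y => h y + M * dist x y) := fun x =>
    ⟨h x - ε, by rintro _ ⟨y, rfl⟩; exact hlow x y⟩
  have hgle : ∀ x, g x ≤ h x := fun x => by
    simpa using ciInf_le (hbdd x) x
  have hgge : ∀ x, h x - ε ≤ g x := fun x => le_ciInf fun y => hlow x y
  have hlip1 : ∀ x y, g x ≤ g y + M * dist x y := by
    intro x y
    rw [← sub_le_iff_le_add]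
    refine le_ciInf fun z => ?_
    have h1 : g x ≤ h z + M * dist x z := ciInf_le (hbdd x) z
    have h2 := mul_le_mul_of_nonneg_left (dist_triangle x y z) hM
    linarith
  have hlip : ∀ x y, |g x - g y| ≤ M * dist x y := by
    intro x y
    have h1 := hlip1 x y
    have h2 := hlip1 y x
    rw [dist_comm y x] at h2
    rw [abs_le]; constructor <;> linarith
  have hgc : Continuous g := by
    refine (LipschitzWith.of_dist_le_mul (K := M.toNNReal) fun x y => ?_).continuous
    rw [Real.coe_toNNReal M hM, Real.dist_eq]
    exact hlip x y
  refine ⟨⟨g, hgc⟩, hlip, fun x => ?_⟩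
  simp only [ContinuousMap.coe_mk]
  rw [abs_le]
  constructor <;> linarith [hgle x, hgge x]

/-- Lipschitz functions are dense. -/
theorem exists_lipschitz_near (h : C(S, ℝ)) {ε : ℝ} (hε : 0 < ε) :
    ∃ (g : C(S, ℝ)) (M : ℝ), 0 ≤ M ∧ (∀ x y, |g x - g y| ≤ M * dist x y) ∧
      ∀ x, |h x - g x| ≤ ε := by
  obtain ⟨δ, hδ, hδh⟩ := Metric.uniformContinuous_iff.1
    (CompactSpace.uniformContinuous_of_continuous h.continuous) ε hε
  have hM : 0 ≤ 2 * ‖h‖ / δ := by positivity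
  obtain ⟨g, hg, hgh⟩ := exists_lipschitz_approx h (ε := ε) hM (fun x y => by
    by_cases hxy : dist x y < δ
    · have := hδh hxy
      rw [Real.dist_eq] at this
      have : 0 ≤ 2 * ‖h‖ / δ * dist x y := by positivity
      linarith
    · rw [not_lt] at hxy
      have h1 : |h x - h y| ≤ 2 * ‖h‖ := by
        have h2 := abs_sub (h x) (h y)
        have h3 : |h x| ≤ ‖h‖ := h.norm_coe_le_norm x
        have h4 : |h y| ≤ ‖h‖ := h.norm_coe_le_norm y
        linarith
      have h5 : 2 * ‖h‖ ≤ 2 * ‖h‖ / δ * dist x y := by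
        rw [div_mul_eq_mul_div, le_div_iff₀ hδ]
        gcongr
      linarith)
  exact ⟨g, _, hM, hg, hgh⟩

section Doeblin

variable {Q : C(S, ℝ) →L[ℝ] C(S, ℝ)} {A B K c : ℝ} {N : ℕ}

theorem HasDoeblin.pow_map_nonneg (H : HasDoeblin Q A B K c N) (n : ℕ) {φ : C(S, ℝ)}
    (hφ : ∀ x, 0 ≤ φ x) (x : S) : 0 ≤ (Q ^ n) φ x := by
  induction n generalizing φ with
  | zero => simpa using hφ x
  | succ n ih =>
    rw [pow_succ, mul_apply_eq_comp]
    exact ih (H.positive φ hφ)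

/-- Positivity compares `h` with the constants `±ε`, and the images of the constant density are
bounded by `1 + B` for every number of steps. The transfers are thus bounded in sup norm uniformly
in `n`. -/
theorem HasDoeblin.abs_le_of_isTransfer (H : HasDoeblin Q A B K c N) {n : ℕ} {h p : C(S, ℝ)}
    (hp : IsTransfer (Q ^ n) h p) {ε : ℝ} (hε : 0 ≤ ε) (hh : ∀ x, |h x| ≤ ε) (x : S) :
    |p x| ≤ ε * (1 + B) := by
  obtain ⟨t, ht, htr⟩ := H.iterate n 0 1 le_rfl isDensity_one
  rw [mul_zero, zero_add] at ht
  have key : ∀ h p : C(S, ℝ), IsTransfer (Q ^ n) h p → (∀ x, -ε ≤ h x) → ∀ x, -(ε * (1 + B)) ≤ p x := by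
    intro h p hp hh x
    refine le_of_forall_le_pairing (fun φ hφ => ?_) x
    have h1 : 0 ≤ pairing (h + ε • 1) ((Q ^ n) φ) := by
      refine integral_nonneg fun x => mul_nonneg ?_ (H.pow_map_nonneg n hφ x)
      have := hh x
      simp only [ContinuousMap.add_apply, ContinuousMap.smul_apply, ContinuousMap.one_apply,
        smul_eq_mul, mul_one]
      linarith
    have h2 : pairing t φ ≤ (1 + B) * ∫ x, φ x := by
      rw [pairing_apply, ← integral_const_mul]
      refine integral_mono (integrable_of_continuous (by fun_prop))
        (integrable_of_continuous (by fun_prop)) fun x => ?_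
      exact mul_le_mul_of_nonneg_right (ht.le H.B_nonneg x) (hφ x)
    rw [pairing_add_left, pairing_smul_left, ← htr φ, ← hp φ] at h1
    have h3 := mul_le_mul_of_nonneg_left h2 hε
    linarith
  rw [abs_le]
  refine ⟨key h p hp (fun x => (abs_le.1 (hh x)).1) x, ?_⟩
  have := key (-h) (-p) (by simpa using hp.smul (-1)) (fun x => by
    have := (abs_le.1 (hh x)).2
    simp only [ContinuousMap.neg_apply]
    linarith) x
  simp only [ContinuousMap.neg_apply] at this
  linarith

/-- After `N` steps a density splits off a fixed proportion of Lebesgue measure. -/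
theorem HasDoeblin.exists_split (H : HasDoeblin Q A B K c N) {h : C(S, ℝ)} (hh : IsDensity K h) :
    ∃ r, IsDensity K r ∧ IsTransfer (Q ^ N) h (c • 1 + (1 - c) • r) := by
  obtain ⟨h', hd, htr, hc⟩ := H.contract h hh
  have hc1 : 0 < 1 - c := by linarith [H.c_le]
  refine ⟨(1 - c)⁻¹ • (h' - c • 1), ⟨fun x => ?_, ?_, fun x y => ?_⟩, ?_⟩
  · simp only [ContinuousMap.smul_apply, ContinuousMap.sub_apply, ContinuousMap.one_apply,
      smul_eq_mul, mul_one]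
    exact mul_nonneg (inv_nonneg.2 hc1.le) (sub_nonneg.2 (hc x))
  · simp only [ContinuousMap.smul_apply, ContinuousMap.sub_apply, ContinuousMap.one_apply,
      smul_eq_mul, mul_one]
    rw [integral_const_mul, integral_sub (integrable_of_continuous h'.continuous)
      (integrable_const _), hd.mass, integral_const_volume, inv_mul_cancel₀ hc1.ne']
  · simp only [ContinuousMap.smul_apply, ContinuousMap.sub_apply, ContinuousMap.one_apply,
      smul_eq_mul, mul_one]
    rw [← mul_sub, sub_sub_sub_cancel_right, abs_mul, abs_of_pos (inv_pos.2 hc1),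
      inv_mul_le_iff₀ hc1]
    refine (hd.lip x y).trans ?_
    have hKd : 0 ≤ K * dist x y := mul_nonneg (zero_le_one.trans H.one_le_K) dist_nonneg
    -- `c ≤ 1 / 4` gives `3 / 4 * K ≤ (1 - c) * K`.
    nlinarith [H.c_le]
  · rw [smul_smul, mul_inv_cancel₀ hc1.ne', one_smul, add_sub_cancel]
    exact htr

/-- Both images contain the same part `c`, which cancels in the difference. The remainders are `1 -
c` times densities of the same class, so the splitting can be repeated. -/
theorem HasDoeblin.exists_coupling (H : HasDoeblin Q A B K c N) {h₁ h₂ : C(S, ℝ)}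
    (hh₁ : IsDensity K h₁) (hh₂ : IsDensity K h₂) (j : ℕ) :
    ∃ r₁ r₂, IsDensity K r₁ ∧ IsDensity K r₂ ∧
      IsTransfer (Q ^ (N * j)) (h₁ - h₂) ((1 - c) ^ j • (r₁ - r₂)) := by
  induction j with
  | zero => exact ⟨h₁, h₂, hh₁, hh₂, fun φ => by simp⟩
  | succ j ih =>
    obtain ⟨r₁, r₂, hr₁, hr₂, htr⟩ := ih
    obtain ⟨s₁, hs₁, t₁⟩ := H.exists_split hr₁
    obtain ⟨s₂, hs₂, t₂⟩ := H.exists_split hr₂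
    refine ⟨s₁, s₂, hs₁, hs₂, ?_⟩
    have := htr.comp ((t₁.sub t₂).smul ((1 - c) ^ j))
    rw [add_sub_add_left_eq_sub, ← smul_sub, smul_smul, ← pow_succ] at this
    exact this

/-- Exponential decay for Lipschitz functions of mean zero. -/
theorem HasDoeblin.exists_decay (H : HasDoeblin Q A B K c N) :
    ∃ C κ : ℝ, 0 < C ∧ 0 < κ ∧ κ < 1 ∧ ∀ (M : ℝ) (h : C(S, ℝ)), 0 < M →
      (∀ x y, |h x - h y| ≤ M * dist x y) → (∀ x, |h x| ≤ M) → ∫ x, h x = 0 →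
      ∀ k : ℕ, ∃ p, IsTransfer (Q ^ k) h p ∧ (∀ x, |p x| ≤ M * (C * κ ^ k)) ∧
        ∀ x y, |p x - p y| ≤ M * C * dist x y := by
  have hc1 : 0 < 1 - c := by linarith [H.c_le]
  have hc2 : 1 - c < 1 := by linarith [H.c_pos]
  have hN0 : N ≠ 0 := H.N_pos.ne'
  -- An `N`-th root spreads the loss over single steps; the remainder of `k` modulo `N` costs the
  -- factor `1 / (1 - c)` in `C`.
  set κ := (1 - c) ^ ((N : ℝ)⁻¹) with hκ
  have hκN : κ ^ N = 1 - c := Real.rpow_inv_natCast_pow hc1.le hN0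
  have hκ0 : 0 < κ := Real.rpow_pos_of_pos hc1 _
  have hκ1 : κ < 1 := by
    by_contra! h
    have := one_le_pow₀ h (n := N)
    linarith
  have hK0 : 0 ≤ K := zero_le_one.trans H.one_le_K
  set K' := A * K + B with hK'
  have hK'0 : 0 ≤ K' := add_nonneg (mul_nonneg (zero_le_one.trans H.one_le_A) hK0) H.B_nonneg
  set C := 2 * (1 + K') / (1 - c) with hC
  have hC0 : 0 < C := by positivity
  refine ⟨C, κ, hC0, hκ0, hκ1, fun M h hM hlip hsup hmean k => ?_⟩
  set j := k / N
  set r := k % N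
  have hk : N * j + r = k := Nat.div_add_mod k N
  -- A function of mean zero is a multiple of the difference between two densities, one of them
  -- constant.
  have h₁ : IsDensity K (1 + M⁻¹ • h) := by
    refine ⟨fun x => ?_, ?_, fun x y => ?_⟩
    · simp only [ContinuousMap.add_apply, ContinuousMap.one_apply, ContinuousMap.smul_apply,
        smul_eq_mul]
      have := (abs_le.1 (hsup x)).1
      have : -1 ≤ M⁻¹ * h x := by
        rw [← div_eq_inv_mul, le_div_iff₀ hM]; linarith
      linarith
    · simp only [ContinuousMap.add_apply, ContinuousMap.one_apply, ContinuousMap.smul_apply,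
        smul_eq_mul]
      rw [integral_add (integrable_const _) (integrable_of_continuous (by fun_prop)),
        integral_const_mul, hmean, integral_const_volume, mul_zero, add_zero]
    · simp only [ContinuousMap.add_apply, ContinuousMap.one_apply, ContinuousMap.smul_apply,
        smul_eq_mul]
      rw [add_sub_add_left_eq_sub, ← mul_sub, abs_mul, abs_of_pos (inv_pos.2 hM),
        inv_mul_le_iff₀ hM]
      refine (hlip x y).trans ?_
      have := mul_le_mul_of_nonneg_right H.one_le_K (mul_nonneg hM.le (dist_nonneg (x := x) (y := y)))
      linarith
  obtain ⟨r₁, r₂, hr₁, hr₂, htr⟩ := H.exists_coupling h₁ (isDensity_one.mono hK0) j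
  obtain ⟨s₁, hs₁, t₁⟩ := H.iterate r K r₁ hK0 hr₁
  obtain ⟨s₂, hs₂, t₂⟩ := H.iterate r K r₂ hK0 hr₂
  have hpow : (1 - c) ^ j * (1 - c) ≤ κ ^ k := by
    rw [← hκN, ← pow_mul, ← hk, pow_add]
    refine mul_le_mul_of_nonneg_left ?_ (by positivity)
    exact pow_le_pow_of_le_one hκ0.le hκ1.le (Nat.mod_lt k H.N_pos).le
  have hpow1 : (1 - c) ^ j ≤ 1 := pow_le_one₀ hc1.le hc2.le
  have hpow0 : 0 ≤ (1 - c) ^ j := by positivity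
  refine ⟨M • ((1 - c) ^ j • (s₁ - s₂)), ?_, fun x => ?_, fun x y => ?_⟩
  · have := (htr.comp ((t₁.sub t₂).smul ((1 - c) ^ j))).smul M
    rwa [hk, add_sub_cancel_left, smul_smul, mul_inv_cancel₀ hM.ne', one_smul] at this
  · simp only [ContinuousMap.smul_apply, ContinuousMap.sub_apply, smul_eq_mul]
    rw [abs_mul, abs_mul, abs_of_pos hM, abs_of_nonneg hpow0]
    have h1 : |s₁ x - s₂ x| ≤ 2 * (1 + K') := by
      rw [abs_le]
      constructor <;> linarith [hs₁.nonneg x, hs₂.nonneg x, hs₁.le hK'0 x, hs₂.le hK'0 x]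
    refine mul_le_mul_of_nonneg_left ?_ hM.le
    calc (1 - c) ^ j * |s₁ x - s₂ x| ≤ (1 - c) ^ j * (2 * (1 + K')) := by gcongr
      _ = C * ((1 - c) ^ j * (1 - c)) := by rw [hC]; field_simp
      _ ≤ C * κ ^ k := by gcongr
  · simp only [ContinuousMap.smul_apply, ContinuousMap.sub_apply, smul_eq_mul]
    rw [← mul_sub, ← mul_sub, abs_mul, abs_mul, abs_of_pos hM, abs_of_nonneg hpow0, mul_assoc]
    refine mul_le_mul_of_nonneg_left ?_ hM.le
    have h1 : |s₁ x - s₂ x - (s₁ y - s₂ y)| ≤ 2 * K' * dist x y := by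
      have e : s₁ x - s₂ x - (s₁ y - s₂ y) = (s₁ x - s₁ y) - (s₂ x - s₂ y) := by ring
      rw [e]
      refine (abs_sub _ _).trans ?_
      linarith [hs₁.lip x y, hs₂.lip x y]
    have h2 : 2 * K' ≤ C := by
      rw [hC, le_div_iff₀ hc1]
      nlinarith [H.c_pos]
    calc (1 - c) ^ j * |s₁ x - s₂ x - (s₁ y - s₂ y)| ≤ 1 * (2 * K' * dist x y) := by
          gcongr
      _ ≤ C * dist x y := by rw [one_mul]; gcongr

/-- The invariant density. -/
theorem HasDoeblin.exists_invariant (H : HasDoeblin Q A B K c N) :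
    ∃ ρ, IsDensity B ρ ∧ IsTransfer Q ρ ρ ∧ ∀ x, c ≤ ρ x := by
  obtain ⟨C, κ, hC, hκ0, hκ1, hdec⟩ := H.exists_decay
  choose t ht htr using fun n => H.iterate n 0 1 le_rfl isDensity_one
  simp only [mul_zero, zero_add] at ht
  have hB := H.B_nonneg
  -- The increment `t (k + 1) - t k` is the `k`-th transfer of `t 1 - 1`, which has mean zero, so it
  -- decays exponentially.
  have hstep : ∀ k, dist (t k) (t (k + 1)) ≤ (1 + B) * C * κ ^ k := by
    intro k
    obtain ⟨p, hp, hpb, -⟩ := hdec (1 + B) (t 1 - 1) (by positivity) (fun x y => by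
        simp only [ContinuousMap.sub_apply, ContinuousMap.one_apply, sub_sub_sub_cancel_right]
        refine ((ht 1).lip x y).trans ?_
        gcongr
        linarith) (fun x => by
        simp only [ContinuousMap.sub_apply, ContinuousMap.one_apply]
        rw [abs_le]
        constructor <;> linarith [(ht 1).nonneg x, (ht 1).le hB x]) (by
        simp only [ContinuousMap.sub_apply, ContinuousMap.one_apply]
        rw [integral_sub (integrable_of_continuous (t 1).continuous) (integrable_const _),
          (ht 1).mass, integral_const_volume, sub_self]) k
    have h1 : IsTransfer (Q ^ k) (t 1) (t k + p) := by
      have := (htr k).add hp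
      rwa [add_sub_cancel] at this
    have h2 := (htr 1).comp h1
    rw [add_comm 1 k] at h2
    rw [(htr (k + 1)).unique h2]
    refine (ContinuousMap.dist_le (by positivity)).2 fun x => ?_
    simpa [Real.dist_eq, mul_assoc] using hpb x
  obtain ⟨ρ, hρ⟩ := cauchySeq_tendsto_of_complete (cauchySeq_of_le_geometric κ _ hκ1 hstep)
  have hpt : ∀ x, Tendsto (fun k => t k x) atTop (𝓝 (ρ x)) := fun x =>
    ((ContinuousMap.evalCLM ℝ x).continuous.tendsto ρ).comp hρ
  have hpair : ∀ φ, Tendsto (fun k => pairing (t k) φ) atTop (𝓝 (pairing ρ φ)) := fun φ => by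
    simp only [fun h => pairing_comm h φ]
    exact ((pairing φ).continuous.tendsto ρ).comp hρ
  have hden : IsDensity B ρ := by
    refine ⟨fun x => ge_of_tendsto' (hpt x) fun k => (ht k).nonneg x, ?_, fun x y =>
      le_of_tendsto' ((hpt x).sub (hpt y)).abs fun k => (ht k).lip x y⟩
    have h1 := hpair 1
    simp only [fun h => pairing_comm h 1, pairing_one_left, fun k => (ht k).mass] at h1
    exact tendsto_nhds_unique h1 tendsto_const_nhds
  have hinv : IsTransfer Q ρ ρ := by
    intro φ
    refine tendsto_nhds_unique ((hpair φ).comp (tendsto_add_atTop_nat 1)) ?_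
    refine (hpair (Q φ)).congr fun k => ?_
    simp only [Function.comp_apply]
    rw [htr k, htr (k + 1), pow_succ, mul_apply_eq_comp]
  refine ⟨ρ, hden, hinv, fun x => ?_⟩
  -- The invariant density is its own image after `N` steps, and such images are at least `c`.
  obtain ⟨h', -, h2, h3⟩ := H.contract ρ (hden.mono H.B_le_K)
  rw [(isTransfer_pow_of_isTransfer hinv N).unique h2]
  exact h3 x

end Doeblin

/-! ### Hölder observables -/

theorem integral_sub_smul_one (g : C(S, ℝ)) : ∫ x, (g - (∫ y, g y) • (1 : C(S, ℝ))) x = 0 := by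
  simp only [ContinuousMap.sub_apply, ContinuousMap.smul_apply, ContinuousMap.one_apply,
    smul_eq_mul, mul_one]
  rw [integral_sub (integrable_of_continuous g.continuous) (integrable_const _),
    integral_const_volume, sub_self]

theorem abs_sub_integral_le {g : C(S, ℝ)} {M : ℝ} (hM : 0 ≤ M)
    (hg : ∀ x y, |g x - g y| ≤ M * dist x y) (x : S) : |g x - ∫ y, g y| ≤ M := by
  have e : g x - ∫ y, g y = ∫ y, (g x - g y) := by
    rw [integral_sub (integrable_const _) (integrable_of_continuous g.continuous),
      integral_const_volume]
  rw [e, ← integral_const_volume M]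
  refine abs_integral_le_integral continuous_const fun y => ?_
  exact (hg x y).trans (by nlinarith [dist_le_half x y])

section Doeblin

variable {Q : C(S, ℝ) →L[ℝ] C(S, ℝ)} {A B K c : ℝ} {N : ℕ}

theorem HasDoeblin.exists_transfer_of_lipschitz (H : HasDoeblin Q A B K c N) {g : C(S, ℝ)} {M : ℝ}
    (hM : 0 ≤ M) (hg : ∀ x y, |g x - g y| ≤ M * dist x y) (k : ℕ) :
    ∃ p, IsTransfer (Q ^ k) g p := by
  obtain ⟨C, κ, -, -, -, hdec⟩ := H.exists_decay
  obtain ⟨t, -, ht⟩ := H.iterate k 0 1 le_rfl isDensity_one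
  obtain ⟨p, hp, -⟩ := hdec (M + 1) (g - (∫ y, g y) • 1) (by positivity) (fun x y => by
      simp only [ContinuousMap.sub_apply, ContinuousMap.smul_apply, ContinuousMap.one_apply,
        sub_sub_sub_cancel_right]
      refine (hg x y).trans ?_
      gcongr
      linarith) (fun x => by
      simp only [ContinuousMap.sub_apply, ContinuousMap.smul_apply, ContinuousMap.one_apply,
        smul_eq_mul, mul_one]
      exact (abs_sub_integral_le hM hg x).trans (by linarith)) (integral_sub_smul_one g) k
  refine ⟨p + (∫ y, g y) • t, ?_⟩
  have := hp.add (ht.smul (∫ y, g y))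
  rwa [sub_add_cancel] at this

/-- Lipschitz functions are dense, and the sup norm bound on transfers makes the images of an
approximating sequence Cauchy. -/
theorem HasDoeblin.exists_transfer (H : HasDoeblin Q A B K c N) (h : C(S, ℝ)) (k : ℕ) :
    ∃ p, IsTransfer (Q ^ k) h p := by
  have hε : ∀ n : ℕ, (0 : ℝ) < 1 / ((n : ℝ) + 1) := fun n => by positivity
  choose g M hM hg hgh using fun n => exists_lipschitz_near h (hε n)
  choose p hp using fun n => H.exists_transfer_of_lipschitz (hM n) (hg n) k
  have hB := H.B_nonneg
  have hdist : ∀ n m, dist (p n) (p m) ≤ (1 / ((n : ℝ) + 1) + 1 / ((m : ℝ) + 1)) * (1 + B) := by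
    intro n m
    refine (ContinuousMap.dist_le (by positivity)).2 fun x => ?_
    rw [Real.dist_eq]
    refine H.abs_le_of_isTransfer ((hp n).sub (hp m)) (by positivity) (fun y => ?_) x
    have e : (g n - g m) y = (h y - g m y) - (h y - g n y) := by
      simp only [ContinuousMap.sub_apply]; ring
    rw [e]
    refine (abs_sub _ _).trans ?_
    linarith [hgh n y, hgh m y]
  have hz : Tendsto (fun n : ℕ => 2 * (1 + B) * (1 / ((n : ℝ) + 1))) atTop (𝓝 0) := by
    simpa using tendsto_one_div_add_atTop_nhds_zero_nat.const_mul (2 * (1 + B))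
  have hcauchy : CauchySeq p := by
    refine cauchySeq_of_le_tendsto_0 _ (fun n m l hn hm => (hdist n m).trans ?_) hz
    have h1 : 1 / ((n : ℝ) + 1) ≤ 1 / ((l : ℝ) + 1) := by gcongr
    have h2 : 1 / ((m : ℝ) + 1) ≤ 1 / ((l : ℝ) + 1) := by gcongr
    nlinarith
  obtain ⟨q, hq⟩ := cauchySeq_tendsto_of_complete hcauchy
  have hgt : Tendsto g atTop (𝓝 h) := by
    rw [tendsto_iff_dist_tendsto_zero]
    refine squeeze_zero (fun _ => dist_nonneg) (fun n => ?_) tendsto_one_div_add_atTop_nhds_zero_nat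
    refine (ContinuousMap.dist_le (hε n).le).2 fun x => ?_
    rw [dist_comm, Real.dist_eq]
    exact hgh n x
  refine ⟨q, fun φ => ?_⟩
  have h1 : Tendsto (fun n => pairing (p n) φ) atTop (𝓝 (pairing q φ)) := by
    simp only [fun u => pairing_comm u φ]
    exact ((pairing φ).continuous.tendsto q).comp hq
  have h2 : Tendsto (fun n => pairing (g n) ((Q ^ k) φ)) atTop (𝓝 (pairing h ((Q ^ k) φ))) := by
    simp only [fun u => pairing_comm u ((Q ^ k) φ)]
    exact ((pairing _).continuous.tendsto h).comp hgt
  exact tendsto_nhds_unique h1 (h2.congr fun n => (hp n φ).symm)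

/-- Decay at every scale for functions of mean zero. -/
theorem HasDoeblin.exists_decay_approx (H : HasDoeblin Q A B K c N) :
    ∃ C κ : ℝ, 0 < C ∧ 0 < κ ∧ κ < 1 ∧ ∀ (h : C(S, ℝ)), ∫ x, h x = 0 → ∀ M ε : ℝ, 0 < M → 0 ≤ ε →
      (∀ x y, |h x - h y| ≤ ε + M * dist x y) → ∀ (k : ℕ) (p : C(S, ℝ)), IsTransfer (Q ^ k) h p →
      (∀ x, |p x| ≤ C * (ε + M * κ ^ k)) ∧ ∀ x y, |p x - p y| ≤ C * (ε + M * dist x y) := by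
  obtain ⟨C, κ, hC, hκ0, hκ1, hdec⟩ := H.exists_decay
  have hB := H.B_nonneg
  refine ⟨C + 4 * (1 + B), κ, by positivity, hκ0, hκ1, fun h hmean M ε hM hε hh k p hp => ?_⟩
  -- The Lipschitz part, recentred, decays exponentially. What remains has sup norm at most `2 * ε`,
  -- and its transfers stay below `2 * ε * (1 + B)`.
  obtain ⟨g, hg, hgh⟩ := exists_lipschitz_approx h hM.le hh
  have hgm : |∫ y, g y| ≤ ε := by
    have e : ∫ y, g y = -∫ y, (h y - g y) := by
      rw [integral_sub (integrable_of_continuous h.continuous)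
        (integrable_of_continuous g.continuous), hmean]; ring
    rw [e, abs_neg, ← integral_const_volume ε]
    exact abs_integral_le_integral continuous_const hgh
  obtain ⟨p₁, hp₁, hsup, hlip⟩ := hdec M (g - (∫ y, g y) • 1) hM (fun x y => by
      simp only [ContinuousMap.sub_apply, ContinuousMap.smul_apply, ContinuousMap.one_apply,
        sub_sub_sub_cancel_right]
      exact hg x y) (fun x => by
      simp only [ContinuousMap.sub_apply, ContinuousMap.smul_apply, ContinuousMap.one_apply,
        smul_eq_mul, mul_one]
      exact abs_sub_integral_le hM.le hg x) (integral_sub_smul_one g) k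
  have hp₂ := hp.sub hp₁
  have hb₂ : ∀ x, |(p - p₁) x| ≤ (2 * ε) * (1 + B) :=
    H.abs_le_of_isTransfer hp₂ (by positivity) fun x => by
      have e : (h - (g - (∫ y, g y) • (1 : C(S, ℝ)))) x = (h x - g x) + ∫ y, g y := by
        simp only [ContinuousMap.sub_apply, ContinuousMap.smul_apply, ContinuousMap.one_apply,
          smul_eq_mul, mul_one]
        ring
      rw [e]
      refine (abs_add_le _ _).trans ?_
      linarith [hgh x]
  simp only [ContinuousMap.sub_apply] at hb₂
  constructor
  · intro x
    have e : p x = p₁ x + (p x - p₁ x) := by ring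
    rw [e]
    refine (abs_add_le _ _).trans ((add_le_add (hsup x) (hb₂ x)).trans ?_)
    have hMκ : 0 ≤ M * κ ^ k := by positivity
    nlinarith [mul_nonneg hC.le hε, mul_nonneg hB hε, mul_nonneg hB hMκ]
  · intro x y
    have e : p x - p y = (p₁ x - p₁ y) + ((p x - p₁ x) - (p y - p₁ y)) := by ring
    rw [e]
    refine (abs_add_le _ _).trans ((add_le_add (hlip x y)
      ((abs_sub _ _).trans (add_le_add (hb₂ x) (hb₂ y)))).trans ?_)
    have hMd : 0 ≤ M * dist x y := by positivity
    nlinarith [mul_nonneg hC.le hε, mul_nonneg hB hε, mul_nonneg hB hMd]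

/-- The scale `δ` is free: the first term dominates for `r ≤ δ` and the second for `r ≥ δ`. A Hölder
function is thus Lipschitz up to an error, at every scale. -/
theorem rpow_le_scale {α δ r : ℝ} (hα0 : 0 < α) (hα1 : α < 1) (hδ : 0 < δ) (hr : 0 ≤ r) :
    r ^ α ≤ δ ^ α + δ ^ (α - 1) * r := by
  have h1 : 0 ≤ δ ^ α := by positivity
  have h2 : 0 ≤ δ ^ (α - 1) * r := by positivity
  rcases le_total r δ with h | h
  · have := Real.rpow_le_rpow hr h hα0.le
    linarith
  · have hr0 : 0 < r := hδ.trans_le h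
    have e : r ^ α = r ^ (α - 1) * r := by
      rw [← Real.rpow_add_one hr0.ne', sub_add_cancel]
    have h3 : r ^ (α - 1) ≤ δ ^ (α - 1) := Real.rpow_le_rpow_of_nonpos hδ h (by linarith)
    have := mul_le_mul_of_nonneg_right h3 hr
    linarith

/-- Decay and uniform regularity for Hölder functions of mean zero. -/
theorem HasDoeblin.exists_decay_holder (H : HasDoeblin Q A B K c N) {h : C(S, ℝ)}
    (hmean : ∫ x, h x = 0) {C₀ α : ℝ} (hα0 : 0 < α) (hα1 : α < 1)
    (hh : ∀ x y, |h x - h y| ≤ C₀ * dist x y ^ α) :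
    ∃ (C κ : ℝ) (p : ℕ → C(S, ℝ)), 0 < C ∧ 0 < κ ∧ κ < 1 ∧ (∀ k, IsTransfer (Q ^ k) h (p k)) ∧
      (∀ k x, |p k x| ≤ C * κ ^ k) ∧ ∀ k x y, |p k x - p k y| ≤ C * dist x y ^ α := by
  obtain ⟨C, κ, hC, hκ0, hκ1, hdec⟩ := H.exists_decay_approx
  choose p hp using H.exists_transfer h
  have hC0 : 0 < |C₀| + 1 := by positivity
  have hscale : ∀ δ : ℝ, 0 < δ → ∀ x y, |h x - h y| ≤
      (|C₀| + 1) * δ ^ α + (|C₀| + 1) * δ ^ (α - 1) * dist x y := by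
    intro δ hδ x y
    have h1 := rpow_le_scale hα0 hα1 hδ (dist_nonneg (x := x) (y := y))
    have h2 : C₀ * dist x y ^ α ≤ (|C₀| + 1) * dist x y ^ α := by
      gcongr
      linarith [le_abs_self C₀]
    calc |h x - h y| ≤ (|C₀| + 1) * dist x y ^ α := (hh x y).trans h2
      _ ≤ (|C₀| + 1) * (δ ^ α + δ ^ (α - 1) * dist x y) := by gcongr
      _ = _ := by ring
  refine ⟨2 * C * (|C₀| + 1), κ ^ α, p, by positivity, by positivity,
    Real.rpow_lt_one hκ0.le hκ1 hα0, hp, fun k x => ?_, fun k x y => ?_⟩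
  -- The scale `δ = κ ^ k` balances the approximation error with the decay of the Lipschitz part.
  · have hδ : 0 < κ ^ k := by positivity
    have h1 := (hdec h hmean _ _ (by positivity) (by positivity) (hscale _ hδ) k (p k) (hp k)).1 x
    refine h1.trans (le_of_eq ?_)
    have e1 : (κ ^ k) ^ (α - 1) * κ ^ k = (κ ^ k) ^ α := by
      rw [← Real.rpow_add_one hδ.ne', sub_add_cancel]
    have e2 : (κ ^ k) ^ α = (κ ^ α) ^ k := by
      rw [← Real.rpow_natCast, ← Real.rpow_mul hκ0.le, ← Real.rpow_natCast, ← Real.rpow_mul hκ0.le,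
        mul_comm]
    rw [mul_assoc _ _ (κ ^ k), e1, e2]
    ring
  · rcases (dist_nonneg (x := x) (y := y)).eq_or_lt with h0 | hδ
    · have hxy : x = y := dist_eq_zero.1 h0.symm
      subst hxy
      simp only [sub_self, abs_zero]
      positivity
    -- For regularity the scale is `δ = dist x y`.
    · have h1 := (hdec h hmean _ _ (by positivity) (by positivity) (hscale _ hδ) k (p k)
        (hp k)).2 x y
      refine h1.trans (le_of_eq ?_)
      have e1 : dist x y ^ (α - 1) * dist x y = dist x y ^ α := by
        rw [← Real.rpow_add_one hδ.ne', sub_add_cancel]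
      rw [mul_assoc _ _ (dist x y), e1]
      ring

/-- The sum of the forward images of a Hölder function of mean zero. -/
theorem HasDoeblin.exists_corrector (H : HasDoeblin Q A B K c N) {h : C(S, ℝ)}
    (hmean : ∫ x, h x = 0) {C₀ α : ℝ} (hα0 : 0 < α) (hα1 : α < 1)
    (hh : ∀ x y, |h x - h y| ≤ C₀ * dist x y ^ α) :
    ∃ G : C(S, ℝ), (∃ C : ℝ, ∀ x y, |G x - G y| ≤ C * dist x y ^ (α / 2)) ∧
      ∀ φ, HasSum (fun k : ℕ => pairing h ((Q ^ (k + 1)) φ)) (pairing G φ) := by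
  obtain ⟨C, κ, p, hC, hκ0, hκ1, hp, hsup, hhol⟩ := H.exists_decay_holder hmean hα0 hα1 hh
  have hgeo : Summable fun k : ℕ => C * κ ^ (k + 1) :=
    ((summable_nat_add_iff 1).2 (summable_geometric_of_lt_one hκ0.le hκ1)).mul_left C
  have hsum : Summable fun k : ℕ => p (k + 1) := by
    refine Summable.of_norm_bounded hgeo fun k => ?_
    exact (ContinuousMap.norm_le _ (by positivity)).2 fun x => hsup (k + 1) x
  refine ⟨∑' k, p (k + 1), ⟨2 * C * ∑' k : ℕ, √κ ^ (k + 1), fun x y => ?_⟩, fun φ => ?_⟩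
  · have hpt : ∀ x, HasSum (fun k => p (k + 1) x) ((∑' k, p (k + 1) : C(S, ℝ)) x) := fun x =>
      (ContinuousMap.evalCLM ℝ x).hasSum hsum.hasSum
    have hs1 : √κ < 1 := by
      rw [Real.sqrt_lt' one_pos]; simpa using hκ1
    have hgs : Summable fun k : ℕ => √κ ^ (k + 1) :=
      (summable_nat_add_iff 1).2 (summable_geometric_of_lt_one (Real.sqrt_nonneg _) hs1)
    have hd := ((hpt x).sub (hpt y))
    rw [← hd.tsum_eq, mul_assoc, mul_assoc, ← tsum_mul_right, ← tsum_mul_left, ← tsum_mul_left,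
      ← Real.norm_eq_abs]
    refine tsum_of_norm_bounded (((hgs.mul_right _).mul_left _).mul_left _).hasSum fun k => ?_
    rw [Real.norm_eq_abs]
    -- The decay bound `b1` is summable but not small for close points, and `b2` the reverse. Their
    -- geometric mean has both properties, at the price of halving the exponent.
    have b1 : |p (k + 1) x - p (k + 1) y| ≤ 2 * C * κ ^ (k + 1) := by
      refine (abs_sub _ _).trans ?_
      linarith [hsup (k + 1) x, hsup (k + 1) y]
    have b2 := hhol (k + 1) x y
    refine abs_le_of_sq_le_sq' ?_ (by positivity) |>.2
    rw [sq_abs, ← sq_abs]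
    have e : (2 * (C * (√κ ^ (k + 1) * dist x y ^ (α / 2)))) ^ 2 =
        2 * ((2 * C * κ ^ (k + 1)) * (C * dist x y ^ α)) := by
      have e1 : (√κ ^ (k + 1)) ^ 2 = κ ^ (k + 1) := by
        rw [← pow_mul, mul_comm, pow_mul, Real.sq_sqrt hκ0.le]
      have e2 : (dist x y ^ (α / 2)) ^ 2 = dist x y ^ α := by
        rw [← Real.rpow_natCast, ← Real.rpow_mul dist_nonneg]
        congr 1; push_cast; ring
      rw [mul_pow, mul_pow, mul_pow, e1, e2]; ring
    rw [e, sq]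
    have b3 : |p (k + 1) x - p (k + 1) y| * |p (k + 1) x - p (k + 1) y| ≤
        (2 * C * κ ^ (k + 1)) * (C * dist x y ^ α) :=
      mul_le_mul b1 b2 (abs_nonneg _) (by positivity)
    have b4 : 0 ≤ (2 * C * κ ^ (k + 1)) * (C * dist x y ^ α) := by positivity
    linarith
  · have h1 := (pairing φ).hasSum hsum.hasSum
    rw [pairing_comm]
    refine h1.congr_fun ?_
    intro k
    rw [← hp (k + 1) φ, pairing_comm]

/-- Shifting the index in the series that defines `G`: one transfer of `h + G` gives back `G`. -/
theorem pairing_corrector {h G : C(S, ℝ)}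
    (hG : ∀ φ, HasSum (fun k : ℕ => pairing h ((Q ^ (k + 1)) φ)) (pairing G φ)) (φ : C(S, ℝ)) :
    pairing (h + G) (Q φ) = pairing G φ := by
  have h1 := (hasSum_nat_add_iff' 1).2 (hG φ)
  have h2 : (fun k : ℕ => pairing h ((Q ^ (k + 1 + 1)) φ)) =
      fun k : ℕ => pairing h ((Q ^ (k + 1)) (Q φ)) := by
    ext k; rw [pow_succ, mul_apply_eq_comp]
  rw [h2] at h1
  have h3 := h1.unique (hG (Q φ))
  simp only [Finset.sum_range_one, zero_add, pow_one] at h3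
  rw [pairing_add_left]
  linarith

/-- Convergence to equilibrium for Lipschitz densities. -/
theorem HasDoeblin.tendsto_pairing (H : HasDoeblin Q A B K c N) {ρ : C(S, ℝ)} (hρ : IsDensity B ρ)
    (hinv : IsTransfer Q ρ ρ) {g : C(S, ℝ)} {M : ℝ} (hM : 0 ≤ M)
    (hg : ∀ x y, |g x - g y| ≤ M * dist x y) (φ : C(S, ℝ)) :
    Tendsto (fun k : ℕ => pairing g ((Q ^ k) φ)) atTop (𝓝 ((∫ x, g x) * pairing ρ φ)) := by
  obtain ⟨C, κ, hC, hκ0, hκ1, hdec⟩ := H.exists_decay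
  have hB := H.B_nonneg
  set m := ∫ x, g x
  have hmean : ∫ x, (g - m • ρ) x = 0 := by
    simp only [ContinuousMap.sub_apply, ContinuousMap.smul_apply, smul_eq_mul]
    rw [integral_sub (integrable_of_continuous g.continuous)
      (integrable_of_continuous (by fun_prop)), integral_const_mul, hρ.mass, mul_one, sub_self]
  have hlip : ∀ x y, |(g - m • ρ) x - (g - m • ρ) y| ≤ (M + |m| * B) * dist x y := by
    intro x y
    have e : (g - m • ρ) x - (g - m • ρ) y = (g x - g y) - m * (ρ x - ρ y) := by
      simp only [ContinuousMap.sub_apply, ContinuousMap.smul_apply, smul_eq_mul]; ring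
    rw [e]
    refine (abs_sub _ _).trans ?_
    rw [abs_mul, add_mul, mul_assoc]
    exact add_le_add (hg x y) (mul_le_mul_of_nonneg_left (hρ.lip x y) (abs_nonneg _))
  have hM' : 0 ≤ M + |m| * B := by positivity
  have hsup : ∀ x, |(g - m • ρ) x| ≤ M + |m| * B := fun x => by
    have := abs_sub_integral_le hM' hlip x
    rwa [hmean, sub_zero] at this
  choose p hp hpb _ using hdec (M + |m| * B + 1) (g - m • ρ) (by positivity)
    (fun x y => (hlip x y).trans (mul_le_mul_of_nonneg_right (by linarith) dist_nonneg)) (fun x => (hsup x).trans (by linarith))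
    hmean
  have hp0 : Tendsto p atTop (𝓝 0) := by
    rw [tendsto_zero_iff_norm_tendsto_zero]
    have hz : Tendsto (fun k : ℕ => (M + |m| * B + 1) * (C * κ ^ k)) atTop (𝓝 0) := by
      simpa using ((tendsto_pow_atTop_nhds_zero_of_lt_one hκ0.le hκ1).const_mul C).const_mul
        (M + |m| * B + 1)
    exact squeeze_zero (fun _ => norm_nonneg _)
      (fun k => (ContinuousMap.norm_le _ (by positivity)).2 (hpb k)) hz
  have h1 : Tendsto (fun k => pairing (p k) φ) atTop (𝓝 0) := by
    simp only [fun u => pairing_comm u φ]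
    have := ((pairing φ).continuous.tendsto 0).comp hp0
    rwa [map_zero] at this
  have h2 : ∀ k, pairing g ((Q ^ k) φ) = pairing (p k) φ + m * pairing ρ φ := by
    intro k
    rw [hp k φ, pairing_sub_left, pairing_smul_left, ← isTransfer_pow_of_isTransfer hinv k φ]
    ring
  simp only [h2]
  simpa using h1.add_const (m * pairing ρ φ)

end Doeblin

/-! ### Absolutely continuous stationary measures -/

section ScalarSum

variable {Ω : Type*} {T : Ω → S → S}

/-- Partial sums of a scalar observable along the chain. -/
def scalarSum (T : Ω → S → S) (f : C(S, ℝ)) (n : ℕ) (p : (ℕ → Ω) × S) : ℝ :=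
  ∑ k ∈ Finset.range n, f (chain T k p.1 p.2)

theorem abs_scalarSum_le (f : C(S, ℝ)) (n : ℕ) (p : (ℕ → Ω) × S) :
    |scalarSum T f n p| ≤ n * ‖f‖ := by
  refine (Finset.abs_sum_le_sum_abs _ _).trans ?_
  refine (Finset.sum_le_sum fun k _ => f.norm_coe_le_norm (chain T k p.1 p.2)).trans ?_
  simp

end ScalarSum

section Stationary

variable {Ω : Type*} [MeasurableSpace Ω] {T : Ω → S → S} (η : Measure Ω) [IsProbabilityMeasure η]

/-- An invariant density defines an absolutely continuous stationary measure. -/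
theorem isACStationary_withDensity (hT : IsRandomMap T) {L : ℝ} {ρ : C(S, ℝ)} (hρ : IsDensity L ρ)
    (hinv : IsTransfer (markovCLM η hT) ρ ρ) :
    IsACStationary η T ((volume : Measure S).withDensity fun x => ENNReal.ofReal (ρ x)) := by
  set μ := (volume : Measure S).withDensity fun x => ENNReal.ofReal (ρ x) with hμ
  have hprob : IsProbabilityMeasure μ := by
    refine ⟨?_⟩
    rw [hμ, withDensity_apply _ MeasurableSet.univ, Measure.restrict_univ,
      ← ofReal_integral_eq_lintegral_ofReal (integrable_of_continuous ρ.continuous)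
        (Eventually.of_forall hρ.nonneg), hρ.mass, ENNReal.ofReal_one]
  have hint : ∀ φ : C(S, ℝ), ∫ x, φ x ∂μ = pairing ρ φ := by
    intro φ
    rw [hμ, integral_withDensity_eq_integral_toReal_smul ρ.continuous.measurable.ennreal_ofReal
      (Eventually.of_forall fun x => ENNReal.ofReal_lt_top), pairing_apply]
    congr 1; ext x
    rw [ENNReal.toReal_ofReal (hρ.nonneg x), smul_eq_mul]
  -- Continuous test functions determine a finite measure, so stationarity extends from them to
  -- bounded measurable functions.
  have hmap : (η.prod μ).map (fun p : Ω × S => T p.1 p.2) = μ := by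
    have : IsProbabilityMeasure ((η.prod μ).map (fun p : Ω × S => T p.1 p.2)) :=
      Measure.isProbabilityMeasure_map hT.measurable.aemeasurable
    refine ext_of_forall_integral_eq_of_IsFiniteMeasure fun f => ?_
    have hf : Measurable fun p : Ω × S => f (T p.1 p.2) := f.continuous.measurable.comp hT.measurable
    rw [integral_map hT.measurable.aemeasurable f.continuous.aestronglyMeasurable,
      integral_prod_symm _ (Integrable.of_bound hf.aestronglyMeasurable ‖f‖
        (Eventually.of_forall fun p => f.norm_coe_le_norm _))]
    exact (hint (markovCLM η hT f.toContinuousMap)).trans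
      ((hinv f.toContinuousMap).symm.trans (hint f.toContinuousMap).symm)
  refine ⟨hprob, withDensity_absolutelyContinuous _ _, fun f hf ⟨C, hC⟩ => ?_⟩
  have hfm : Measurable fun p : Ω × S => f (T p.1 p.2) := hf.comp hT.measurable
  conv_rhs => rw [← hmap]
  rw [integral_map hT.measurable.aemeasurable hf.aestronglyMeasurable,
    integral_prod_symm _ (Integrable.of_bound hfm.aestronglyMeasurable C
      (Eventually.of_forall fun p => hC _))]
  rfl

variable {η}

theorem IsACStationary.integral_markovCLM_pow (hT : IsRandomMap T) {μ : Measure S}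
    (hμ : IsACStationary η T μ) (k : ℕ) (φ : C(S, ℝ)) :
    ∫ x, (markovCLM η hT ^ k) φ x ∂μ = ∫ x, φ x ∂μ := by
  induction k generalizing φ with
  | zero => simp
  | succ k ih =>
    rw [pow_succ, mul_apply_eq_comp, ih]
    exact hμ.stationary φ φ.continuous.measurable ⟨‖φ‖, fun x => φ.norm_coe_le_norm x⟩

/-- Every absolutely continuous stationary measure has the invariant density. -/
theorem IsACStationary.integral_eq_pairing (hT : IsRandomMap T) {A B K c : ℝ} {N : ℕ}
    (H : HasDoeblin (markovCLM η hT) A B K c N) {ρ : C(S, ℝ)} (hρ : IsDensity B ρ)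
    (hinv : IsTransfer (markovCLM η hT) ρ ρ) {μ : Measure S} (hμ : IsACStationary η T μ)
    (φ : C(S, ℝ)) : ∫ x, φ x ∂μ = pairing ρ φ := by
  have := hμ.isProbabilityMeasure
  set r : S → ℝ := fun x => (μ.rnDeriv volume x).toReal with hr
  have hri : Integrable r volume := Measure.integrable_toReal_rnDeriv
  have hrint : ∀ ψ : C(S, ℝ), ∫ x, r x * ψ x = ∫ x, ψ x ∂μ := fun ψ =>
    integral_rnDeriv_smul hμ.absolutelyContinuous
  have hr1 : ∫ x, r x = 1 := by
    have := hrint 1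
    simpa using this
  -- The density of `μ` is replaced by a Lipschitz `g`, up to `2 * ε` in `L¹`. Stationarity makes `∫
  -- (Q ^ k) φ ∂μ` independent of `k`, while `pairing g ((Q ^ k) φ)` tends to `(∫ g) * pairing ρ φ`.
  have key : ∀ ε : ℝ, 0 < ε →
      |∫ x, φ x ∂μ - pairing ρ φ| ≤ 2 * ε * (‖φ‖ + |pairing ρ φ|) := by
    intro ε hε
    obtain ⟨g₀, -, hg₀, hg₀c, -⟩ := hri.exists_hasCompactSupport_integral_sub_le hε
    obtain ⟨g, M, hM, hg, hgg⟩ := exists_lipschitz_near ⟨g₀, hg₀c⟩ hε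
    have hrg : Integrable (fun x => r x - g x) (volume : Measure S) :=
      hri.sub (integrable_of_continuous g.continuous)
    have hL1 : ∫ x, |r x - g x| ≤ 2 * ε := by
      have i1 : Integrable (fun x => |r x - g₀ x|) (volume : Measure S) :=
        (hri.sub (integrable_of_continuous hg₀c)).abs
      have h1 : ∫ x, |r x - g x| ≤ ∫ x, (|r x - g₀ x| + ε) := by
        refine integral_mono hrg.abs (i1.add (integrable_const _)) fun x => ?_
        have h2 := hgg x
        simp only [ContinuousMap.coe_mk] at h2
        have h3 := abs_sub_le (r x) (g₀ x) (g x)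
        simp only
        linarith
      rw [integral_add i1 (integrable_const _), integral_const_volume] at h1
      simp only [Real.norm_eq_abs] at hg₀
      linarith
    have hclose : ∀ ψ : C(S, ℝ), ‖ψ‖ ≤ ‖φ‖ → |∫ x, ψ x ∂μ - pairing g ψ| ≤ 2 * ε * ‖φ‖ := by
      intro ψ hψ
      have i1 : Integrable (fun x => r x * ψ x) (volume : Measure S) :=
        hri.mul_bdd (c := ‖ψ‖) ψ.continuous.aestronglyMeasurable
          (Eventually.of_forall fun x => ψ.norm_coe_le_norm x)
      rw [← hrint ψ, pairing_apply, ← integral_sub i1 (integrable_of_continuous (by fun_prop))]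
      calc |∫ x, (r x * ψ x - g x * ψ x)| ≤ ∫ x, |r x - g x| * ‖φ‖ := by
            rw [← Real.norm_eq_abs]
            refine norm_integral_le_of_norm_le (hrg.abs.mul_const _)
              (Eventually.of_forall fun x => ?_)
            rw [← sub_mul, norm_mul]
            exact mul_le_mul_of_nonneg_left ((ψ.norm_coe_le_norm x).trans hψ) (abs_nonneg _)
        _ ≤ 2 * ε * ‖φ‖ := by
            rw [integral_mul_const]
            gcongr
    have hmass : |(∫ x, g x) - 1| ≤ 2 * ε := by
      have e : (∫ x, g x) - 1 = -∫ x, (r x - g x) := by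
        rw [integral_sub hri (integrable_of_continuous g.continuous), hr1]; ring
      rw [e, abs_neg]
      exact (abs_integral_le_integral_abs).trans hL1
    have hnorm : ∀ k : ℕ, ‖(markovCLM η hT ^ k) φ‖ ≤ ‖φ‖ := by
      intro k
      induction k with
      | zero => simp
      | succ k ih =>
        rw [pow_succ', mul_apply_eq_comp]
        exact (norm_markovCLM_apply_le η hT _).trans ih
    have hlim := H.tendsto_pairing hρ hinv hM hg φ
    have h1 : |∫ x, φ x ∂μ - (∫ x, g x) * pairing ρ φ| ≤ 2 * ε * ‖φ‖ := by
      refine le_of_tendsto (hlim.const_sub (∫ x, φ x ∂μ)).abs (Eventually.of_forall fun k => ?_)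
      have := hclose _ (hnorm k)
      rwa [hμ.integral_markovCLM_pow hT] at this
    have e : ∫ x, φ x ∂μ - pairing ρ φ =
        (∫ x, φ x ∂μ - (∫ x, g x) * pairing ρ φ) + ((∫ x, g x) - 1) * pairing ρ φ := by ring
    rw [e]
    refine (abs_add_le _ _).trans ?_
    rw [abs_mul, mul_add]
    exact add_le_add h1 (mul_le_mul_of_nonneg_right hmass (abs_nonneg _))
  have hz : |∫ x, φ x ∂μ - pairing ρ φ| ≤ 0 := by
    have ht : Tendsto (fun n : ℕ => 2 * (1 / ((n : ℝ) + 1)) * (‖φ‖ + |pairing ρ φ|)) atTop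
        (𝓝 0) := by
      simpa using (tendsto_one_div_add_atTop_nhds_zero_nat.const_mul 2).mul_const
        (‖φ‖ + |pairing ρ φ|)
    exact ge_of_tendsto' ht fun n => key _ (by positivity)
  exact sub_eq_zero.1 (abs_nonpos_iff.1 hz)

/-! ### Correlations -/

/-- The Markov property: coordinate `n` is resampled, and `X_k` with `k ≤ n` does not depend on it.
-/
theorem integral_mul_chain_succ (hT : IsRandomMap T) (ν : Measure S) [IsProbabilityMeasure ν]
    {k n : ℕ} (hk : k ≤ n) (f φ : C(S, ℝ)) :
    ∫ p, f (chain T k p.1 p.2) * φ (chain T (n + 1) p.1 p.2) ∂(pathMeasure η ν) =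
      ∫ p, f (chain T k p.1 p.2) * markovCLM η hT φ (chain T n p.1 p.2) ∂(pathMeasure η ν) := by
  have hm : ∀ j, Measurable fun p : (ℕ → Ω) × S => chain T j p.1 p.2 := measurable_chain hT.measurable
  rw [integral_path_update η ν n
    (G := fun p => f (chain T k p.1 p.2) * φ (chain T (n + 1) p.1 p.2)) (C := ‖f‖ * ‖φ‖)]
  · simp only [chain_update hk, chain_succ_update, integral_const_mul]
    rfl
  · exact (f.continuous.measurable.comp (hm k)).mul (φ.continuous.measurable.comp (hm (n + 1)))
  · intro p
    rw [abs_mul]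
    exact mul_le_mul (f.norm_coe_le_norm _) (φ.norm_coe_le_norm _) (abs_nonneg _) (norm_nonneg _)

instance isProbabilityMeasure_pathMeasure (ν : Measure S) [IsProbabilityMeasure ν] :
    IsProbabilityMeasure (pathMeasure η ν) := by
  unfold pathMeasure; infer_instance

theorem integral_chain (hT : IsRandomMap T) {μ : Measure S} (hμ : IsACStationary η T μ) (k : ℕ)
    (φ : C(S, ℝ)) : ∫ p, φ (chain T k p.1 p.2) ∂(pathMeasure η μ) = ∫ x, φ x ∂μ := by
  have := hμ.isProbabilityMeasure
  induction k generalizing φ with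
  | zero =>
    simp only [chain, pathMeasure]
    rw [integral_fun_snd (μ := Measure.infinitePi fun _ : ℕ => η) (fun x => φ x)]
    simp
  | succ k ih =>
    have h1 := integral_mul_chain_succ hT μ (Nat.zero_le k) 1 φ (η := η)
    simp only [ContinuousMap.one_apply, one_mul] at h1
    rw [h1, ih]
    simpa using hμ.integral_markovCLM_pow hT 1 φ

theorem integral_mul_chain (hT : IsRandomMap T) {μ : Measure S} (hμ : IsACStationary η T μ)
    (k m : ℕ) (f φ : C(S, ℝ)) :
    ∫ p, f (chain T k p.1 p.2) * φ (chain T (k + m) p.1 p.2) ∂(pathMeasure η μ) =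
      ∫ x, (f * (markovCLM η hT ^ m) φ) x ∂μ := by
  have := hμ.isProbabilityMeasure
  induction m generalizing φ with
  | zero => exact integral_chain hT hμ k (f * φ)
  | succ m ih =>
    rw [← add_assoc, integral_mul_chain_succ hT μ (Nat.le_add_right k m), ih, pow_succ,
      mul_apply_eq_comp]

theorem measurable_scalarSum (hT : IsRandomMap T) (f : C(S, ℝ)) (n : ℕ) :
    Measurable (scalarSum T f n) :=
  Finset.measurable_sum _ fun k _ =>
    f.continuous.measurable.comp (measurable_chain hT.measurable k)

theorem integrable_mul_of_bounded {ν : Measure ((ℕ → Ω) × S)} [IsFiniteMeasure ν]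
    {u v : (ℕ → Ω) × S → ℝ} (hu : Measurable u) (hv : Measurable v) {a b : ℝ}
    (hua : ∀ p, |u p| ≤ a) (hvb : ∀ p, |v p| ≤ b) : Integrable (fun p => u p * v p) ν := by
  refine Integrable.of_bound (hu.mul hv).aestronglyMeasurable (a * b)
    (Eventually.of_forall fun p => ?_)
  rw [norm_mul]
  exact mul_le_mul (hua p) (hvb p) (abs_nonneg _) ((abs_nonneg _).trans (hua p))

theorem integral_scalarSum_mul_last (hT : IsRandomMap T) {μ : Measure S}
    (hμ : IsACStationary η T μ) (f₁ f₂ : C(S, ℝ)) (n : ℕ) :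
    ∫ p, scalarSum T f₁ n p * f₂ (chain T n p.1 p.2) ∂(pathMeasure η μ) =
      ∑ k ∈ Finset.range n, ∫ x, (f₁ * (markovCLM η hT ^ (k + 1)) f₂) x ∂μ := by
  have := hμ.isProbabilityMeasure
  have hm : ∀ j, Measurable fun p : (ℕ → Ω) × S => chain T j p.1 p.2 := measurable_chain hT.measurable
  simp only [scalarSum, Finset.sum_mul]
  have hi : ∀ k ∈ Finset.range n, Integrable (fun p : (ℕ → Ω) × S =>
      f₁ (chain T k p.1 p.2) * f₂ (chain T n p.1 p.2)) (pathMeasure η μ) := fun k _ =>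
    integrable_mul_of_bounded (f₁.continuous.measurable.comp (hm k))
      (f₂.continuous.measurable.comp (hm n)) (fun p => f₁.norm_coe_le_norm _)
      (fun p => f₂.norm_coe_le_norm _)
  -- Reversing the sum indexes the terms by their lag: time `n - 1 - k` lies `k + 1` steps before
  -- `n`.
  rw [integral_finsetSum _ hi, ← Finset.sum_range_reflect]
  refine Finset.sum_congr rfl fun k hk => ?_
  rw [← integral_mul_chain hT hμ (n - 1 - k) (k + 1) f₁ f₂]
  have : n - 1 - k + (k + 1) = n := by have := Finset.mem_range.1 hk; omega
  rw [this]

/-- The limit covariance of two observables, in terms of their correlations. -/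
theorem tendsto_covariance (hT : IsRandomMap T) {μ : Measure S} (hμ : IsACStationary η T μ)
    {f₁ f₂ : C(S, ℝ)} {σ₁ σ₂ : ℝ}
    (h₁ : HasSum (fun k : ℕ => ∫ x, (f₁ * (markovCLM η hT ^ (k + 1)) f₂) x ∂μ) σ₁)
    (h₂ : HasSum (fun k : ℕ => ∫ x, (f₂ * (markovCLM η hT ^ (k + 1)) f₁) x ∂μ) σ₂) :
    Tendsto (fun n : ℕ => (1 / (n : ℝ)) *
      ∫ p, scalarSum T f₁ n p * scalarSum T f₂ n p ∂(pathMeasure η μ)) atTop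
      (𝓝 (σ₁ + σ₂ + ∫ x, (f₁ * f₂) x ∂μ)) := by
  have := hμ.isProbabilityMeasure
  have hm : ∀ j, Measurable fun p : (ℕ → Ω) × S => chain T j p.1 p.2 := measurable_chain hT.measurable
  -- `s n` is the increment of the expected product from `n` to `n + 1`. It converges, so the
  -- averages converge to the same limit by Cesàro.
  let s : ℕ → ℝ := fun n =>
    (∑ k ∈ Finset.range n, ∫ x, (f₁ * (markovCLM η hT ^ (k + 1)) f₂) x ∂μ) +
    (∑ k ∈ Finset.range n, ∫ x, (f₂ * (markovCLM η hT ^ (k + 1)) f₁) x ∂μ) +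
    ∫ x, (f₁ * f₂) x ∂μ
  have hs : Tendsto s atTop (𝓝 (σ₁ + σ₂ + ∫ x, (f₁ * f₂) x ∂μ)) :=
    (h₁.tendsto_sum_nat.add h₂.tendsto_sum_nat).add_const _
  have hsum : ∀ n, ∫ p, scalarSum T f₁ n p * scalarSum T f₂ n p ∂(pathMeasure η μ) =
      ∑ l ∈ Finset.range n, s l := by
    intro n
    induction n with
    | zero => simp [scalarSum]
    | succ n ih =>
      rw [Finset.sum_range_succ, ← ih]
      have m1 := measurable_scalarSum hT f₁ n
      have m2 := measurable_scalarSum hT f₂ n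
      have n1 := f₁.continuous.measurable.comp (hm n)
      have n2 := f₂.continuous.measurable.comp (hm n)
      have i1 := integrable_mul_of_bounded (ν := pathMeasure η μ) m1 m2 (abs_scalarSum_le f₁ n)
        (abs_scalarSum_le f₂ n)
      have i2 := integrable_mul_of_bounded (ν := pathMeasure η μ) m1 n2 (abs_scalarSum_le f₁ n)
        (fun p => f₂.norm_coe_le_norm _)
      have i3 := integrable_mul_of_bounded (ν := pathMeasure η μ) m2 n1 (abs_scalarSum_le f₂ n)
        (fun p => f₁.norm_coe_le_norm _)
      have i4 := integrable_mul_of_bounded (ν := pathMeasure η μ) n1 n2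
        (fun p => f₁.norm_coe_le_norm _) (fun p => f₂.norm_coe_le_norm _)
      simp only [Function.comp_apply] at i2 i3 i4
      have e : ∀ p : (ℕ → Ω) × S, scalarSum T f₁ (n + 1) p * scalarSum T f₂ (n + 1) p =
          scalarSum T f₁ n p * scalarSum T f₂ n p +
          (scalarSum T f₁ n p * f₂ (chain T n p.1 p.2) +
          scalarSum T f₂ n p * f₁ (chain T n p.1 p.2) +
          f₁ (chain T n p.1 p.2) * f₂ (chain T n p.1 p.2)) := by
        intro p
        simp only [scalarSum, Finset.sum_range_succ]
        ring
      simp only [e]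
      rw [integral_add i1 (by exact (i2.add i3).add i4), integral_add (by exact i2.add i3) i4,
        integral_add i2 i3, integral_scalarSum_mul_last hT hμ, integral_scalarSum_mul_last hT hμ]
      congr 2
      exact integral_chain hT hμ n (f₁ * f₂)
  simp only [hsum, one_div]
  exact hs.cesaro

end Stationary

/-! ### Degenerate covariance and coboundaries -/

theorem isHolder_of_abs_le {g : S → ℝ} {C β : ℝ} (hβ0 : 0 < β) (hβ1 : β < 1)
    (h : ∀ x y, |g x - g y| ≤ C * dist x y ^ β) : IsHolder g := by
  refine ⟨C.toNNReal, β.toNNReal, by simpa using hβ0, by simpa using hβ1, fun x y => ?_⟩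
  rw [Real.coe_toNNReal β hβ0.le, edist_dist, edist_dist,
    ENNReal.ofReal_rpow_of_nonneg dist_nonneg hβ0.le, Real.dist_eq]
  rcases le_total 0 C with hC | hC
  · change _ ≤ ENNReal.ofReal C * _
    rw [← ENNReal.ofReal_mul hC]
    exact ENNReal.ofReal_le_ofReal (h x y)
  · have h0 : C * dist x y ^ β ≤ 0 := mul_nonpos_of_nonpos_of_nonneg hC (by positivity)
    rw [ENNReal.ofReal_of_nonpos ((h x y).trans h0)]
    exact zero_le

theorem exists_holder_mul {f ρ : C(S, ℝ)} {C β L : ℝ} (hβ0 : 0 < β) (hβ1 : β < 1)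
    (hf : ∀ x y, |f x - f y| ≤ C * dist x y ^ β) (hρ : ∀ x y, |ρ x - ρ y| ≤ L * dist x y) :
    ∃ C' : ℝ, ∀ x y, |(ρ * f) x - (ρ * f) y| ≤ C' * dist x y ^ β := by
  refine ⟨|C| * ‖ρ‖ + ‖f‖ * |L|, fun x y => ?_⟩
  have e : (ρ * f) x - (ρ * f) y = (f x - f y) * ρ x + f y * (ρ x - ρ y) := by
    simp only [ContinuousMap.mul_apply]; ring
  -- Distances on the circle are below one, so Lipschitz bounds imply Hölder bounds.
  have hd : dist x y ≤ dist x y ^ β := by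
    have := Real.rpow_le_rpow_of_exponent_ge' dist_nonneg
      ((dist_le_half x y).trans (by norm_num)) hβ0.le hβ1.le
    simpa using this
  have hβd : 0 ≤ dist x y ^ β := by positivity
  have b1 : |f x - f y| ≤ |C| * dist x y ^ β :=
    (hf x y).trans (mul_le_mul_of_nonneg_right (le_abs_self C) hβd)
  have b2 : |ρ x - ρ y| ≤ |L| * dist x y ^ β :=
    (hρ x y).trans (mul_le_mul (le_abs_self L) hd dist_nonneg (abs_nonneg _))
  rw [e]
  refine (abs_add_le _ _).trans ?_
  rw [abs_mul, abs_mul]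
  have b3 : |f x - f y| * |ρ x| ≤ |C| * dist x y ^ β * ‖ρ‖ :=
    mul_le_mul b1 (ρ.norm_coe_le_norm x) (abs_nonneg _) (by positivity)
  have b4 : |f y| * |ρ x - ρ y| ≤ ‖f‖ * (|L| * dist x y ^ β) :=
    mul_le_mul (f.norm_coe_le_norm y) b2 (abs_nonneg _) (norm_nonneg _)
  linarith

theorem pairing_mul (h φ ψ : C(S, ℝ)) : pairing h (φ * ψ) = pairing (h * φ) ψ := by
  simp only [pairing_apply, ContinuousMap.mul_apply, mul_assoc]

/-- The quotient of a Hölder function by a positive Lipschitz function. -/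
theorem exists_holder_div {G ρ : C(S, ℝ)} {C β L c : ℝ} (hβ0 : 0 < β) (hβ1 : β < 1) (hc : 0 < c)
    (hρc : ∀ x, c ≤ ρ x) (hG : ∀ x y, |G x - G y| ≤ C * dist x y ^ β)
    (hρ : ∀ x y, |ρ x - ρ y| ≤ L * dist x y) :
    ∃ g : C(S, ℝ), ρ * g = G ∧ ∃ C' : ℝ, ∀ x y, |g x - g y| ≤ C' * dist x y ^ β := by
  have hpos : ∀ x, 0 < ρ x := fun x => hc.trans_le (hρc x)
  let τ : C(S, ℝ) := ⟨fun x => (ρ x)⁻¹, ρ.continuous.inv₀ fun x => (hpos x).ne'⟩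
  have hτ : ∀ x y, |τ x - τ y| ≤ L / c ^ 2 * dist x y := by
    intro x y
    have e : τ x - τ y = (ρ y - ρ x) / (ρ x * ρ y) := by
      simp only [τ, ContinuousMap.coe_mk]
      field_simp [(hpos x).ne', (hpos y).ne']
    rw [e, abs_div, abs_of_pos (mul_pos (hpos x) (hpos y)), abs_sub_comm, div_mul_eq_mul_div, sq]
    exact div_le_div₀ ((abs_nonneg _).trans (hρ x y)) (hρ x y) (by positivity)
      (mul_le_mul (hρc x) (hρc y) hc.le (hpos x).le)
  refine ⟨τ * G, ?_, exists_holder_mul hβ0 hβ1 hG hτ⟩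
  ext x
  simp only [τ, ContinuousMap.mul_apply, ContinuousMap.coe_mk]
  rw [← mul_assoc, mul_inv_cancel₀ (hpos x).ne', one_mul]

section Coboundary

variable {Ω : Type*} [MeasurableSpace Ω] {T : Ω → S → S} {η : Measure Ω} [IsProbabilityMeasure η]

/-- If the asymptotic variance vanishes, the observable is a coboundary. -/
theorem coboundary_of_variance_eq_zero (hT : IsRandomMap T) {L c : ℝ} {ρ : C(S, ℝ)}
    (hρ : IsDensity L ρ) (hinv : IsTransfer (markovCLM η hT) ρ ρ) (hc : 0 < c)
    (hρc : ∀ x, c ≤ ρ x) {f g₀ : C(S, ℝ)}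
    (hG : ∀ φ, pairing (ρ * f + ρ * g₀) (markovCLM η hT φ) = pairing (ρ * g₀) φ)
    (hσ : pairing (ρ * f) f + 2 * pairing (ρ * g₀) f = 0) :
    ∀ᵐ ω ∂η, ∀ x, f x = g₀ (T ω x) - g₀ x := by
  set Q := markovCLM η hT
  set u := f + g₀ with hu
  have hρu : ρ * u = ρ * f + ρ * g₀ := by rw [hu, mul_add]
  -- `Φ x` is the mean square of `u x - g₀ (T ω x)`, written through `Q` so that it is continuous
  -- and can be paired with `ρ`.
  set Φ : C(S, ℝ) := u * u - (2 : ℝ) • (u * Q g₀) + Q (g₀ * g₀) with hΦ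
  have hΦint : ∀ x, Φ x = ∫ ω, (u x - g₀ (T ω x)) ^ 2 ∂η := by
    intro x
    have i1 : Integrable (fun ω => 2 * u x * g₀ (T ω x)) η :=
      (hT.integrable_comp η g₀ x).const_mul _
    have i2 : Integrable (fun ω => (g₀ * g₀) (T ω x)) η := hT.integrable_comp η (g₀ * g₀) x
    have e : ∀ ω, (u x - g₀ (T ω x)) ^ 2 = u x * u x - 2 * u x * g₀ (T ω x) +
        (g₀ * g₀) (T ω x) := fun ω => by simp only [ContinuousMap.mul_apply]; ring
    simp only [e]
    have e1 : ∫ ω, 2 * u x * g₀ (T ω x) ∂η = 2 * u x * ∫ ω, g₀ (T ω x) ∂η :=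
      integral_const_mul _ _
    rw [integral_add (by exact (integrable_const _).sub i1) i2, integral_sub (integrable_const _) i1,
      e1]
    simp only [hΦ, ContinuousMap.add_apply, ContinuousMap.sub_apply, ContinuousMap.smul_apply,
      smul_eq_mul, integral_const, probReal_univ, one_mul]
    simp only [ContinuousMap.mul_apply, Q, markovCLM_apply]
    ring
  have hΦ0 : ∀ x, 0 ≤ Φ x := fun x => by
    rw [hΦint]; exact integral_nonneg fun _ => sq_nonneg _
  -- By `hG` the cross term is `-2 ∫ ρ g₀²`, and by invariance the last term is `∫ ρ g₀²`. What is
  -- left is `∫ ρ (f² + 2 f g₀)`, the asymptotic variance.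
  have hzero : pairing ρ Φ = 0 := by
    have p1 : pairing ρ (u * u) = pairing (ρ * f) f + pairing (ρ * f) g₀ + pairing (ρ * g₀) f +
        pairing (ρ * g₀) g₀ := by
      rw [pairing_mul, hρu, hu, pairing_add_left, map_add, map_add]; ring
    have p2 : pairing ρ (u * Q g₀) = pairing (ρ * g₀) g₀ := by rw [pairing_mul, hρu, hG]
    have p3 : pairing ρ (Q (g₀ * g₀)) = pairing (ρ * g₀) g₀ := by
      rw [← hinv (g₀ * g₀), pairing_mul]
    have p4 : pairing (ρ * f) g₀ = pairing (ρ * g₀) f := by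
      rw [← pairing_mul, ← pairing_mul, mul_comm f]
    rw [hΦ, map_add, map_sub, map_smul, p1, p2, p3, smul_eq_mul]
    linarith
  have hΦz : ∀ x, Φ x = 0 := by
    intro x
    by_contra hx
    have h3 : 0 < ∫ x, ρ x * Φ x := by
      refine (ρ.continuous.mul Φ.continuous).integral_pos_of_hasCompactSupport_nonneg_nonzero
        (HasCompactSupport.of_compactSpace _) (fun x => mul_nonneg (hρ.nonneg x) (hΦ0 x)) (x := x) ?_
      exact mul_ne_zero (hc.trans_le (hρc x)).ne' hx
    exact h3.ne' hzero
  -- The exceptional null set depends on the point. A countable dense set of points gives a common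
  -- one, and continuity then covers the circle.
  have hae : ∀ n : ℕ, ∀ᵐ ω ∂η, u (TopologicalSpace.denseSeq S n) =
      g₀ (T ω (TopologicalSpace.denseSeq S n)) := by
    intro n
    set x := TopologicalSpace.denseSeq S n
    have h1 := hΦint x
    rw [hΦz x] at h1
    have hi : Integrable (fun ω => (u x - g₀ (T ω x)) ^ 2) η := by
      refine Integrable.of_bound (Measurable.aestronglyMeasurable ?_) ((|u x| + ‖g₀‖) ^ 2)
        (Eventually.of_forall fun ω => ?_)
      · exact ((g₀.continuous.measurable.comp
          (hT.measurable.comp measurable_prodMk_right)).const_sub _).pow_const 2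
      · rw [norm_pow]
        gcongr
        exact (abs_sub _ _).trans (by gcongr; exact g₀.norm_coe_le_norm _)
    have h2 := (integral_eq_zero_iff_of_nonneg (fun ω => sq_nonneg (u x - g₀ (T ω x))) hi).1 h1.symm
    filter_upwards [h2] with ω hω
    exact sub_eq_zero.1 (pow_eq_zero_iff two_ne_zero |>.1 hω)
  filter_upwards [ae_all_iff.2 hae] with ω hω
  have hTc := hT.continuous ω
  have heq : (fun x => u x) = fun x => g₀ (T ω x) :=
    Continuous.ext_on (TopologicalSpace.denseRange_denseSeq S) u.continuous
      (g₀.continuous.comp hTc) (by rintro _ ⟨n, rfl⟩; exact hω n)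
  intro x
  have := congrFun heq x
  simp only [hu, ContinuousMap.add_apply] at this
  linarith

/-- Partial sums of a coboundary are bounded, so that the asymptotic variance vanishes. -/
theorem tendsto_variance_zero_of_coboundary (μ : Measure S) [IsProbabilityMeasure μ]
    {f g : C(S, ℝ)} (hfg : ∀ᵐ ω ∂η, ∀ x, f x = g x - g (T ω x)) :
    Tendsto (fun n : ℕ => (1 / (n : ℝ)) *
      ∫ p, scalarSum T f n p * scalarSum T f n p ∂(pathMeasure η μ)) atTop (𝓝 0) := by
  have hall : ∀ᵐ p ∂(pathMeasure η μ), ∀ k x, f x = g x - g (T (p.1 k) x) := by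
    have h1 : ∀ᵐ ω ∂(Measure.infinitePi fun _ : ℕ => η), ∀ k x, f x = g x - g (T (ω k) x) :=
      ae_all_iff.2 fun k =>
        (measurePreserving_eval_infinitePi (fun _ : ℕ => η) k).quasiMeasurePreserving.ae hfg
    exact Measure.quasiMeasurePreserving_fst.ae h1
  have htel : ∀ᵐ p ∂(pathMeasure η μ), ∀ n, scalarSum T f n p = g p.2 - g (chain T n p.1 p.2) := by
    filter_upwards [hall] with p hp n
    induction n with
    | zero => simp [scalarSum, chain]
    | succ n ih =>
      rw [scalarSum, Finset.sum_range_succ, ← scalarSum, ih, hp n]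
      simp only [chain]
      ring
  have hbd : ∀ n : ℕ, |∫ p, scalarSum T f n p * scalarSum T f n p ∂(pathMeasure η μ)| ≤
      (2 * ‖g‖) * (2 * ‖g‖) := by
    intro n
    have := norm_integral_le_of_norm_le_const (μ := pathMeasure η μ) (C := (2 * ‖g‖) * (2 * ‖g‖))
      (f := fun p => scalarSum T f n p * scalarSum T f n p) (by
        filter_upwards [htel] with p hp
        have h1 : |scalarSum T f n p| ≤ 2 * ‖g‖ := by
          rw [hp n]
          refine (abs_sub _ _).trans ?_
          have h2 : |g p.2| ≤ ‖g‖ := g.norm_coe_le_norm _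
          have h3 : |g (chain T n p.1 p.2)| ≤ ‖g‖ := g.norm_coe_le_norm _
          linarith
        rw [norm_mul]
        exact mul_le_mul h1 h1 (abs_nonneg _) (by positivity))
    simpa using this
  have hz : Tendsto (fun n : ℕ => (1 / (n : ℝ)) * ((2 * ‖g‖) * (2 * ‖g‖))) atTop (𝓝 0) := by
    simpa using tendsto_one_div_atTop_nhds_zero_nat.mul_const ((2 * ‖g‖) * (2 * ‖g‖))
  refine squeeze_zero_norm (fun n => ?_) hz
  rw [norm_mul, Real.norm_of_nonneg (by positivity : (0 : ℝ) ≤ 1 / (n : ℝ))]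
  exact mul_le_mul_of_nonneg_left (hbd n) (by positivity)

end Coboundary

/-- A coordinate of a continuous vector valued observable. -/
def coord {d : ℕ} (f : S → Fin d → ℝ) (hf : Continuous f) (i : Fin d) : C(S, ℝ) :=
  ⟨fun x => f x i, (continuous_apply i).comp hf⟩

end RandomCircle

/-! ### The main theorem -/

open RandomCircle in
theorem mainTheorem6 {Ω : Type*} [MeasurableSpace Ω] (η : Measure Ω) [IsProbabilityMeasure η]
    (T : Ω → S → S) (hT : IsExpandingOnAverage η T) :
    (∃ μ : Measure S, IsACStationary η T μ) ∧
    ∀ μ : Measure S, IsACStationary η T μ →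
      ∀ (d : ℕ) (f : S → Fin d → ℝ), IsHolder f → ∫ x, f x ∂μ = 0 →
        ∃ Sig : Matrix (Fin d) (Fin d) ℝ, IsLimitCovariance η T μ f Sig ∧
          ∀ v : Fin d → ℝ, v ≠ 0 →
            (v ⬝ᵥ (Sig.mulVec v) = 0 ↔
              ∃ g : S → ℝ, IsHolder g ∧
                ∀ᵐ ω ∂η, ∀ x : S, v ⬝ᵥ f x = g x - g (T ω x)) := by
  have hr := hT.isRandomMap
  obtain ⟨A, B, K, c, N, H⟩ := hT.exists_hasDoeblin η
  obtain ⟨ρ, hρ, hinv, hρc⟩ := H.exists_invariant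
  refine ⟨⟨_, isACStationary_withDensity η hr hρ hinv⟩, fun μ hμ d f hf hmean => ?_⟩
  have := hμ.isProbabilityMeasure
  have hμρ : ∀ φ : C(S, ℝ), ∫ x, φ x ∂μ = pairing ρ φ := hμ.integral_eq_pairing hr H hρ hinv
  obtain ⟨C₀, α, hα0, hα1, hHol⟩ := hf
  have hfc : Continuous f := hHol.continuous hα0
  have hα0' : (0 : ℝ) < α := by exact_mod_cast hα0
  have hα1' : (α : ℝ) < 1 := by exact_mod_cast hα1
  set F := coord f hfc with hF
  have hFhol : ∀ i x y, |F i x - F i y| ≤ C₀ * dist x y ^ (α : ℝ) := fun i x y =>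
    (dist_le_pi_dist (f x) (f y) i).trans (hHol.dist_le x y)
  have hFmean : ∀ i, ∫ x, F i x ∂μ = 0 := by
    intro i
    have hfi : Integrable f μ :=
      hfc.integrable_of_hasCompactSupport (HasCompactSupport.of_compactSpace f)
    have h1 := (ContinuousLinearMap.proj (R := ℝ) (φ := fun _ : Fin d => ℝ) i).integral_comp_comm hfi
    rw [hmean, map_zero] at h1
    exact h1
  -- correctors for observables of mean zero
  have hcorr : ∀ φ : C(S, ℝ), ∫ x, φ x ∂μ = 0 →
      (∃ C : ℝ, ∀ x y, |φ x - φ y| ≤ C * dist x y ^ (α : ℝ)) →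
      ∃ G : C(S, ℝ), (∃ C : ℝ, ∀ x y, |G x - G y| ≤ C * dist x y ^ ((α : ℝ) / 2)) ∧
        (∀ ψ, pairing (ρ * φ + G) (markovCLM η hr ψ) = pairing G ψ) ∧
        ∀ ψ, HasSum (fun k : ℕ => ∫ x, (φ * (markovCLM η hr ^ (k + 1)) ψ) x ∂μ) (pairing G ψ) := by
    rintro φ hφ ⟨C, hC⟩
    obtain ⟨C', hC'⟩ := exists_holder_mul hα0' hα1' hC hρ.lip
    obtain ⟨G, hGh, hG⟩ := H.exists_corrector (h := ρ * φ) ((hμρ φ).symm.trans hφ) hα0' hα1' hC'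
    refine ⟨G, hGh, pairing_corrector hG, fun ψ => ?_⟩
    simpa only [hμρ, pairing_mul] using hG ψ
  choose G _ _ hGsum using fun i => hcorr (F i) (hFmean i) ⟨C₀, hFhol i⟩
  have hlim : ∀ i j, Tendsto (fun n : ℕ => (1 / (n : ℝ)) *
      ∫ p, scalarSum T (F i) n p * scalarSum T (F j) n p ∂(pathMeasure η μ)) atTop
      (𝓝 (pairing (G i) (F j) + pairing (G j) (F i) + ∫ x, (F i * F j) x ∂μ)) := fun i j =>
    tendsto_covariance hr hμ (hGsum i (F j)) (hGsum j (F i))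
  have hbirk : ∀ i n p, birkhoff T f n p i = scalarSum T (F i) n p := by
    intro i n p
    simp only [birkhoff, Finset.sum_apply, scalarSum]
    rfl
  refine ⟨Matrix.of fun i j => pairing (G i) (F j) + pairing (G j) (F i) + ∫ x, (F i * F j) x ∂μ,
    fun i j => by simp only [hbirk]; exact hlim i j, fun v _ => ?_⟩
  set Sig : Matrix (Fin d) (Fin d) ℝ :=
    Matrix.of fun i j => pairing (G i) (F j) + pairing (G j) (F i) + ∫ x, (F i * F j) x ∂μ
  -- the scalar observable in the direction of `v`
  set fv : C(S, ℝ) := ∑ i, v i • F i with hfv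
  have hfvx : ∀ x, fv x = v ⬝ᵥ f x := by
    intro x
    simp only [hfv, ContinuousMap.sum_apply, ContinuousMap.smul_apply, smul_eq_mul, dotProduct]
    rfl
  have hsumv : ∀ n p, scalarSum T fv n p = ∑ i, v i * scalarSum T (F i) n p := by
    intro n p
    simp only [scalarSum, hfv, ContinuousMap.sum_apply, ContinuousMap.smul_apply, smul_eq_mul,
      Finset.mul_sum]
    exact Finset.sum_comm
  -- By bilinearity, `v ⬝ᵥ Sig.mulVec v` is the asymptotic variance of the scalar observable `fv`.
  have hvlim : Tendsto (fun n : ℕ => (1 / (n : ℝ)) *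
      ∫ p, scalarSum T fv n p * scalarSum T fv n p ∂(pathMeasure η μ)) atTop
      (𝓝 (v ⬝ᵥ Sig.mulVec v)) := by
    have h1 : Tendsto (fun n : ℕ => ∑ i, ∑ j, v i * v j * ((1 / (n : ℝ)) *
        ∫ p, scalarSum T (F i) n p * scalarSum T (F j) n p ∂(pathMeasure η μ))) atTop
        (𝓝 (∑ i, ∑ j, v i * v j * Sig i j)) :=
      tendsto_finsetSum _ fun i _ => tendsto_finsetSum _ fun j _ => (hlim i j).const_mul _
    have h2 : v ⬝ᵥ Sig.mulVec v = ∑ i, ∑ j, v i * v j * Sig i j := by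
      simp only [dotProduct, Matrix.mulVec, Finset.mul_sum]
      refine Finset.sum_congr rfl fun i _ => Finset.sum_congr rfl fun j _ => by ring
    rw [h2]
    refine h1.congr fun n => ?_
    have hint : ∀ i j, Integrable (fun p => scalarSum T (F i) n p * scalarSum T (F j) n p)
        (pathMeasure η μ) := fun i j =>
      integrable_mul_of_bounded (measurable_scalarSum hr (F i) n) (measurable_scalarSum hr (F j) n)
        (abs_scalarSum_le (F i) n) (abs_scalarSum_le (F j) n)
    have h3 : ∫ p, scalarSum T fv n p * scalarSum T fv n p ∂(pathMeasure η μ) =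
        ∑ i, ∑ j, v i * v j *
          ∫ p, scalarSum T (F i) n p * scalarSum T (F j) n p ∂(pathMeasure η μ) := by
      have e : ∀ p, scalarSum T fv n p * scalarSum T fv n p =
          ∑ i, ∑ j, v i * v j * (scalarSum T (F i) n p * scalarSum T (F j) n p) := by
        intro p
        rw [hsumv, Finset.sum_mul_sum]
        refine Finset.sum_congr rfl fun i _ => Finset.sum_congr rfl fun j _ => by ring
      simp only [e]
      rw [integral_finsetSum _ fun i _ => integrable_finsetSum _ fun j _ => (hint i j).const_mul _]
      refine Finset.sum_congr rfl fun i _ => ?_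
      rw [integral_finsetSum _ fun j _ => (hint i j).const_mul _]
      exact Finset.sum_congr rfl fun j _ => integral_const_mul _ _
    rw [h3, Finset.mul_sum]
    refine Finset.sum_congr rfl fun i _ => ?_
    rw [Finset.mul_sum]
    exact Finset.sum_congr rfl fun j _ => by ring
  constructor
  · intro hσ
    have hfvmean : ∫ x, fv x ∂μ = 0 := by
      rw [hμρ, hfv, map_sum]
      refine Finset.sum_eq_zero fun i _ => ?_
      rw [map_smul, ← hμρ, hFmean, smul_zero]
    have hfvhol : ∃ C : ℝ, ∀ x y, |fv x - fv y| ≤ C * dist x y ^ (α : ℝ) := by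
      refine ⟨(∑ i, |v i|) * C₀, fun x y => ?_⟩
      have e : fv x - fv y = ∑ i, v i * (F i x - F i y) := by
        simp only [hfv, ContinuousMap.sum_apply, ContinuousMap.smul_apply, smul_eq_mul, mul_sub,
          Finset.sum_sub_distrib]
      rw [e, mul_assoc, Finset.sum_mul]
      refine (Finset.abs_sum_le_sum_abs _ _).trans (Finset.sum_le_sum fun i _ => ?_)
      rw [abs_mul]
      exact mul_le_mul_of_nonneg_left (hFhol i x y) (abs_nonneg _)
    obtain ⟨Gv, ⟨C₁, hC₁⟩, hGv, hGvsum⟩ := hcorr fv hfvmean hfvhol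
    obtain ⟨g₀, hg₀, C₂, hC₂⟩ := exists_holder_div (by linarith) (by linarith) H.c_pos hρc hC₁ hρ.lip
    -- The same limit computed from the correlations of `fv` itself expresses the variance through
    -- its own corrector `Gv = ρ * g₀`.
    have hvar := tendsto_nhds_unique hvlim (tendsto_covariance hr hμ (hGvsum fv) (hGvsum fv))
    rw [hσ, hμρ, pairing_mul] at hvar
    rw [← hg₀] at hGv hvar
    have hco := coboundary_of_variance_eq_zero hr hρ hinv H.c_pos hρc hGv (by linarith)
    refine ⟨fun x => -g₀ x, isHolder_of_abs_le (by linarith) (by linarith) (C := C₂)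
      (β := (α : ℝ) / 2) (fun x y => ?_), ?_⟩
    · rw [← abs_neg]
      convert hC₂ x y using 2
      ring
    · filter_upwards [hco] with ω hω x
      rw [← hfvx, hω x]
      ring
  · rintro ⟨g, ⟨C', β, hβ0, -, hg⟩, hco⟩
    refine tendsto_nhds_unique hvlim (tendsto_variance_zero_of_coboundary μ
      (g := ⟨g, hg.continuous hβ0⟩) ?_)
    filter_upwards [hco] with ω hω x
    rw [hfvx]
    exact hω x
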